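/- **Setting.** For a data table $g:\mathbb F_2^n\to\mathbb F_2$ let $V(g)|x\rangle=(-1)^{g(x)}|x\rangle$ and $|\Psi(g)\rangle=V(g)|+\rangle^{\otimes n}$. A QRAM device enacting the $n$-qubit channel $\widetilde{\mathcal V}(g)$ has *dataset-independent noise* if there are channels $\mathcal N_1,\mathcal N_2$, independent of $g$, with $\widetilde{\mathcal V}(g)=\mathcal N_2\circ\big(V(g)[\cdot]V(g)^\dagger\big)\circ\mathcal N_1$ for all $g$. Let $E$ be the encoding isometry of a code from $n$ logical into $n'$ physical qubits, $\mathcal Q$ a QEC projector (a channel that maps every state into the codespace and fixes encoded states), and let $\widetilde{\mathcal E}_{\rm FT}$, $\widetilde{\mathcal Q}_{\rm FT}$ be channels (the noisy encoder and the noisy error-correction gadget). Put $$\overline{\phi(g)}=\mathcal Q\circ\widetilde{\mathcal Q}_{\rm FT}\circ\widetilde{\mathcal E}_{\rm FT}\circ\widetilde{\mathcal V}(g)\big[|+\rangle\langle+|^{\otimes n}\big],\qquad |\overline{\Psi(g)}\rangle=E|\Psi(g)\rangle .$$ For $A\in GL_n(\mathbb F_2)$, $B$ strictly upper triangular over $\mathbb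 F_2$ and $u,v\in\mathbb F_2^n$, let $M_A|x\rangle=|Ax\rangle$, $Q_B=\prod_{i<j}\mathrm{CZ}_{ij}^{B_{ij}}$, $C=(Z^vQ_BM_A^\dagger X^u)^\dagger$, $\overline C=ECE^\dagger$ and $g_C(x)=g(Ax\oplus u)\oplus x\cdot v\oplus x^{\top}Bx$. With $(A,B,u,v)$ uniformly random, let $$\overline{\phi(g)}_{\rm twirl}=\mathbb E_C\ \overline C\,\overline{\phi(g_C)}\,\overline C^{\dagger}.$$ A distillation protocol is an adaptive logical circuit that may request fresh copies of an unknown $n$-qubit state. Besides discarding the content of a register and loading a copy there, its operations are the preparation of a qubit in $|0\rangle$, single-qubit gates, single-qubit measurements, and fractional swaps $e^{-it\mathbb S}=\cos t\,\mathbb I-i\sin t\,\mathbb S$ of two disjoint equal-size registers, each implemented by a circuit of single-qubit gates and controlled swaps of qubits with one helper qubit that starts and ends in $|0\rangle$. **Proposition.** There is a universal constant $K>0$ such that for all $n$, all $F_{\min}\ge 2^{-n+2}$ and all $\varepsilon_{\rm dist}>0$ there is a distillation protocol, depending only on $n,F_{\min},\varepsilon_{\rm dist}$, with the following properties. 1.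 At any time during any run in which $a$ copies have been consumed so far, at most $Ka$ single-qubit operations (gates, preparations and measurements) and at most $Kna$ controlled swaps of qubits have been used; that is, $O(1)$ single-qubit gates and $O(n)$ controlled swaps per copy consumed. 2. Suppose that the QRAM device has dataset-independent noise and that $\langle\overline{\Psi(g)}|\overline{\phi(g)}|\overline{\Psi(g)}\rangle\ge F_{\min}$ for every $g$. Then, for every $g$, the protocol run on copies of $\overline{\phi(g)}_{\rm twirl}$ halts with probability $1$. In expectation it uses at most $$1+K\,\frac{1-F_{\min}}{F_{\min}^2}\Big(\frac1{\varepsilon_{\rm dist}}+\frac1{F_{\min}}\Big)\ \text{ copies and at most }\ K\,\frac{1-F_{\min}}{F_{\min}^2}\Big(\frac1{\varepsilon_{\rm dist}}+\frac1{F_{\min}}\Big)\ \text{ fractional swaps},$$ and its output $\overline{\phi(g)}_{\rm dist}$ satisfies $\tfrac12\big\|\,|\overline{\Psi(g)}\rangle\langle\overline{\Psi(g)}|-\overline{\phi(g)}_{\rm dist}\big\|_1\le\varepsilon_{\rm dist}$. In particular, for $\varepsilon_{\rm dist}<1-F_{\min}$ the expected number of copies is $O\big(\frac{1-F_{\min}}{F_{\min}^2}(\frac1{\varepsilon_{\rm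 dist}}+\frac1{F_{\min}})\big)$. -/

import Mathlib

open scoped Matrix Topology

noncomputable section

/-- Bit strings of length `k`, as vectors over `𝔽₂`. They label the computational basis of `k`
qubits. -/
abbrev Bits (k : ℕ) : Type := Fin k → ZMod 2

/-- Operators from `l` qubits to `k` qubits, in the computational basis. -/
abbrev Op (k l : ℕ) : Type := Matrix (Bits k) (Bits l) ℂ

/-! ### States, channels, trace distance -/

/-- The operator `|ψ⟩⟨ψ|`. -/
def ketbra {k : ℕ} (ψ : Bits k → ℂ) : Op k k := Matrix.vecMulVec ψ (star ψ)

/-- The fidelity `⟨ψ|σ|ψ⟩`. -/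
def fidelity {k : ℕ} (ψ : Bits k → ℂ) (σ : Op k k) : ℝ := (star ψ ⬝ᵥ (σ *ᵥ ψ)).re

/-- The Schatten 1-norm: the sum of the singular values. -/
def traceNorm {k : ℕ} (M : Op k k) : ℝ :=
  ∑ i ∈ Finset.range (Fintype.card (Bits k)), (Matrix.toEuclideanLin M).singularValues i

/-- The trace distance `½ ‖ρ - σ‖₁`. -/
def traceDist {k : ℕ} (ρ σ : Op k k) : ℝ := 1 / 2 * traceNorm (ρ - σ)

/-- Linear maps from `k`-qubit operators to `l`-qubit operators. -/
abbrev SuperOp (k l : ℕ) : Type := Op k k →ₗ[ℂ] Op l l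

/-- Quantum channels (completely positive trace-preserving maps), in Kraus form. -/
def IsChannel {k l : ℕ} (Φ : SuperOp k l) : Prop :=
  ∃ (r : ℕ) (K : Fin r → Op l k),
    (∀ σ, Φ σ = ∑ i, K i * σ * (K i)ᴴ) ∧ ∑ i, (K i)ᴴ * K i = 1

/-- The channel `σ ↦ U σ U†`. -/
def conjBy {k l : ℕ} (U : Op l k) : SuperOp k l where
  toFun σ := U * σ * Uᴴ
  map_add' σ τ := by rw [Matrix.mul_add, Matrix.add_mul]
  map_smul' c σ := by simp

/-! ### The QRAM unitary, its resource states, and noise -/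

/-- The sign `(-1)^b`. -/
def sgn (b : ZMod 2) : ℂ := if b = 0 then 1 else -1

/-- The QRAM unitary `V(g) : |x⟩ ↦ (-1)^{g(x)} |x⟩`. -/
def qram {n : ℕ} (g : Bits n → ZMod 2) : Op n n := Matrix.diagonal fun x => sgn (g x)

/-- The state `|+⟩^{⊗n}`. -/
def plusState (n : ℕ) : Bits n → ℂ := fun _ => ((Real.sqrt (2 ^ n) : ℝ) : ℂ)⁻¹

/-- The QRAM resource state `|Ψ(g)⟩ = V(g) |+⟩^{⊗n}`. -/
def resourceState {n : ℕ} (g : Bits n → ZMod 2) : Bits n → ℂ := qram g *ᵥ plusState n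

/-- A device that enacts the channel `𝒱(g)` on data table `g` has dataset-independent noise. -/
def DatasetIndependent {n : ℕ} (dev : (Bits n → ZMod 2) → SuperOp n n) : Prop :=
  ∃ N₁ N₂ : SuperOp n n, IsChannel N₁ ∧ IsChannel N₂ ∧
    ∀ g, dev g = N₂ ∘ₗ conjBy (qram g) ∘ₗ N₁

/-- `Q` is a QEC projector for the code with encoding isometry `E`: a channel that sends every state
into the codespace and fixes the encoded states. -/
def IsQECProjector {n n' : ℕ} (E : Op n' n) (Q : SuperOp n' n') : Prop :=
  IsChannel Q ∧ (∀ τ, Q (conjBy E τ) = conjBy E τ) ∧ ∀ σ, ∃ τ, Q σ = conjBy E τ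

/-- The encoded noisy resource state: the device acts on `|+⟩^{⊗n}`, followed by the noisy
encoder `encN`, the noisy error-correction gadget `qecN` and the ideal QEC projector `Q`. -/
def encodedState {n n' : ℕ} (dev : (Bits n → ZMod 2) → SuperOp n n) (encN : SuperOp n n')
    (qecN Q : SuperOp n' n') (g : Bits n → ZMod 2) : Op n' n' :=
  Q (qecN (encN (dev g (ketbra (plusState n)))))

/-! ### Partial Clifford twirling -/

/-- The gate `X^u : |x⟩ ↦ |x ⊕ u⟩`. -/
def gateX {n : ℕ} (u : Bits n) : Op n n := fun y x => if y = x + u then 1 else 0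

/-- The gate `Z^v`. -/
def gateZ {n : ℕ} (v : Bits n) : Op n n := Matrix.diagonal fun x => sgn (x ⬝ᵥ v)

/-- The gate `M_A : |x⟩ ↦ |A x⟩`. -/
def gateM {n : ℕ} (A : Matrix (Fin n) (Fin n) (ZMod 2)) : Op n n :=
  fun y x => if y = A *ᵥ x then 1 else 0

/-- The gate `Q_B`, the product of the gates `CZ_{ij}` over all `i < j` with `B i j = 1`. For
strictly upper triangular `B` this is the sign `(-1)^{xᵀ B x}`. -/
def gateQ {n : ℕ} (B : Matrix (Fin n) (Fin n) (ZMod 2)) : Op n n :=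
  Matrix.diagonal fun x => sgn (x ⬝ᵥ (B *ᵥ x))

/-- The choices `(A, B, u, v)`. -/
abbrev TwirlData (n : ℕ) : Type :=
  Matrix (Fin n) (Fin n) (ZMod 2) × Matrix (Fin n) (Fin n) (ZMod 2) × Bits n × Bits n

/-- The twirling gate `C = (Z^v Q_B M_A† X^u)† = X^u M_A Q_B Z^v`. -/
def twirlGate {n : ℕ} (c : TwirlData n) : Op n n :=
  gateX c.2.2.1 * gateM c.1 * gateQ c.2.1 * gateZ c.2.2.2

/-- The transformed data table `g_C(x) = g(Ax ⊕ u) ⊕ x·v ⊕ xᵀBx`. -/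
def twirlTable {n : ℕ} (g : Bits n → ZMod 2) (c : TwirlData n) : Bits n → ZMod 2 := fun x =>
  g (c.1 *ᵥ x + c.2.2.1) + x ⬝ᵥ c.2.2.2 + x ⬝ᵥ (c.2.1 *ᵥ x)

open Classical in
/-- The choices with `A` invertible and `B` strictly upper triangular. -/
def twirlSet (n : ℕ) : Finset (TwirlData n) :=
  Finset.univ.filter fun c => IsUnit c.1.det ∧ ∀ i j, j ≤ i → c.2.1 i j = 0

/-- The twirled encoded state `𝔼_C  C̄ φ(g_C) C̄†`, over uniformly random `(A, B, u, v)`, where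
`C̄ = E C E†` is the logical version of `C`. -/
def twirledState {n n' : ℕ} (E : Op n' n) (φ : (Bits n → ZMod 2) → Op n' n')
    (g : Bits n → ZMod 2) : Op n' n' :=
  ((twirlSet n).card : ℂ)⁻¹ • ∑ c ∈ twirlSet n,
    conjBy (E * twirlGate c * Eᴴ) (φ (twirlTable g c))

/-- The logical content of a state `σ` supported in the codespace of `E`: the operator `ρ` with
`σ = E ρ E†`. A logical circuit acts on encoded states by acting on their logical content. -/
def logicalState {n n' : ℕ} (E : Op n' n) (σ : Op n' n') : Op n n := conjBy Eᴴ σ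

/-! ### Circuits over single-qubit gates and controlled swaps -/

/-- Elementary gates on `m` qubits. -/
inductive Gate (m : ℕ) : Type
  | single (i : Fin m) (U : Matrix.unitaryGroup (ZMod 2) ℂ)
  | cswap (c i j : Fin m) (hci : c ≠ i) (hcj : c ≠ j) (hij : i ≠ j)

/-- The single-qubit operator `U` acting on qubit `i` of `m`. -/
def onQubit {m : ℕ} (i : Fin m) (U : Matrix (ZMod 2) (ZMod 2) ℂ) : Op m m :=
  fun y x => if ∀ j, j ≠ i → y j = x j then U (y i) (x i) else 0

/-- The unitary of an elementary gate; a controlled swap exchanges the qubits `i` and `j` if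
qubit `c` is `1`. -/
def Gate.toOp {m : ℕ} : Gate m → Op m m
  | .single i U => onQubit i U.1
  | .cswap c i j _ _ _ =>
      fun y x => if y = (if x c = 1 then x ∘ Equiv.swap i j else x) then 1 else 0

/-- Number of single-qubit gates of an elementary gate. -/
def Gate.singles {m : ℕ} : Gate m → ℕ
  | .single _ _ => 1
  | .cswap .. => 0

/-- Number of controlled swaps of an elementary gate. -/
def Gate.cswaps {m : ℕ} : Gate m → ℕ
  | .single _ _ => 0
  | .cswap .. => 1

/-- The unitary of a circuit; the head of the list is applied first. -/
def circuitOp {m : ℕ} : List (Gate m) → Op m m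
  | [] => 1
  | G :: L => circuitOp L * G.toOp

/-- The swap of the registers `r₁` and `r₂` of a memory of `m` qubits. -/
def regSwap {m k : ℕ} (r₁ r₂ : Fin k ↪ Fin m) : Op m m :=
  fun y x => if y = x ∘ ((List.finRange k).map fun j => Equiv.swap (r₁ j) (r₂ j)).prod
    then 1 else 0

/-- The fractional swap `exp(-i t 𝕊) = cos t - i sin t 𝕊` of the registers `r₁` and `r₂`. -/
def fracSwap {m k : ℕ} (t : ℝ) (r₁ r₂ : Fin k ↪ Fin m) : Op m m :=
  (Real.cos t : ℂ) • (1 : Op m m) - (Complex.I * (Real.sin t : ℂ)) • regSwap r₁ r₂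

/-- The circuit `L`, on the memory and one helper qubit (qubit `0`), implements `W` on the memory:
the helper starts in `|0⟩` and is returned to `|0⟩`. -/
def Implements {m : ℕ} (L : List (Gate (m + 1))) (W : Op m m) : Prop :=
  ∀ (y x : Bits m) (b : ZMod 2),
    circuitOp L (Fin.cons b y : Bits (m + 1)) (Fin.cons 0 x : Bits (m + 1)) =
      if b = 0 then W y x else 0

/-! ### Adaptive distillation protocols -/

/-- Instructions of an adaptive protocol with a memory of `m` qubits, classical control states `S`,
and access to fresh copies of an unknown `n`-qubit state. The fields of type `S` are the control
state that follows.
* `load r`: discard the content of register `r` and put a fresh copy of the unknown state there;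
* `prep i`: reset qubit `i` to `|0⟩`;
* `gate i U`: apply `U` to qubit `i`;
* `fswap t r₁ r₂ L`: apply the fractional swap of the disjoint registers `r₁`, `r₂`, by means of the
  circuit `L` of single-qubit gates and controlled swaps;
* `measure i`: measure qubit `i` in the computational basis and branch on the outcome;
* `halt r`: stop, the output is the content of register `r`. -/
inductive Instr (n m : ℕ) (S : Type) : Type
  | load (r : Fin n ↪ Fin m) (next : S)
  | prep (i : Fin m) (next : S)
  | gate (i : Fin m) (U : Matrix.unitaryGroup (ZMod 2) ℂ) (next : S)
  | fswap (t : ℝ) (k : ℕ) (r₁ r₂ : Fin k ↪ Fin m) (disj : ∀ i j, r₁ i ≠ r₂ j)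
      (L : List (Gate (m + 1))) (hL : Implements L (fracSwap t r₁ r₂)) (next : S)
  | measure (i : Fin m) (next : ZMod 2 → S)
  | halt (r : Fin n ↪ Fin m)

namespace Instr

variable {n m : ℕ} {S : Type}

/-- The possible next control states. -/
def succ : Instr n m S → List S
  | load _ s => [s]
  | prep _ s => [s]
  | gate _ _ s => [s]
  | fswap _ _ _ _ _ _ _ s => [s]
  | measure _ s => [s 0, s 1]
  | halt _ => []

/-- Number of copies consumed. -/
def copies : Instr n m S → ℕ
  | load _ _ => 1
  | _ => 0

/-- Number of fractional swaps. -/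
def fswaps : Instr n m S → ℕ
  | fswap .. => 1
  | _ => 0

/-- Number of single-qubit operations, among which preparations and measurements are counted. -/
def singles : Instr n m S → ℕ
  | prep _ _ => 1
  | gate _ _ _ => 1
  | measure _ _ => 1
  | fswap _ _ _ _ _ L _ _ => (L.map Gate.singles).sum
  | _ => 0

/-- Number of controlled swaps of qubits. -/
def cswaps : Instr n m S → ℕ
  | fswap _ _ _ _ _ L _ _ => (L.map Gate.cswaps).sum
  | _ => 0

/-- The effect of `load r` when the unknown state is `ρ`: `σ ↦ Tr_r[σ] ⊗ ρ`. -/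
def loadState (ρ : Op n n) (r : Fin n ↪ Fin m) (σ : Op m m) : Op m m := fun y x =>
  (∑ z : Bits n, σ (Function.extend r z y) (Function.extend r z x)) * ρ (y ∘ r) (x ∘ r)

/-- The effect of `prep i`. -/
def prepState (i : Fin m) (σ : Op m m) : Op m m := fun y x =>
  if y i = 0 ∧ x i = 0 then
    ∑ b : ZMod 2, σ (Function.update y i b) (Function.update x i b)
  else 0

/-- The subnormalized state after outcome `b` of a measurement of qubit `i`. -/
def measState (i : Fin m) (b : ZMod 2) (σ : Op m m) : Op m m := fun y x =>
  if y i = b ∧ x i = b then σ y x else 0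

/-- The reduced state of register `r`. -/
def reducedState (r : Fin n ↪ Fin m) (σ : Op m m) : Op n n := fun a b =>
  ∑ y : Bits m, if y ∘ r = a then σ y (Function.extend r b y) else 0

/-- The branches of one step: next control states with the (subnormalized) memory states. -/
def branches (ρ : Op n n) (σ : Op m m) : Instr n m S → List (S × Op m m)
  | load r s => [(s, loadState ρ r σ)]
  | prep i s => [(s, prepState i σ)]
  | gate i U s => [(s, conjBy (onQubit i U.1) σ)]
  | fswap t _ r₁ r₂ _ _ _ s => [(s, conjBy (fracSwap t r₁ r₂) σ)]
  | measure i s => [(s 0, measState i 0 σ), (s 1, measState i 1 σ)]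
  | halt _ => []

/-- The (subnormalized) output of this step. -/
def output (σ : Op m m) : Instr n m S → Op n n
  | halt r => reducedState r σ
  | _ => 0

end Instr

/-- An adaptive protocol that consumes copies of an unknown `n`-qubit state. -/
structure Protocol (n : ℕ) where
  /-- number of qubits of memory -/
  mem : ℕ
  /-- classical control states -/
  Ctrl : Type
  /-- initial control state -/
  start : Ctrl
  /-- the instruction executed in each control state -/
  instr : Ctrl → Instr n mem Ctrl

namespace Protocol

variable {n : ℕ}

/-- The memory state `|0⋯0⟩⟨0⋯0|`. -/
def zeroState (m : ℕ) : Op m m := fun y x => if y = 0 ∧ x = 0 then 1 else 0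

/-- The subnormalized output of the runs that halt within `T` steps, from control state `s` and
memory state `σ`, when the unknown state is `ρ`. Its trace is the probability of halting. -/
def outputFrom (P : Protocol n) (ρ : Op n n) : ℕ → P.Ctrl → Op P.mem P.mem → Op n n
  | 0, _, _ => 0
  | T + 1, s, σ => (P.instr s).output σ +
      (((P.instr s).branches ρ σ).map fun b => outputFrom P ρ T b.1 b.2).sum

/-- The expected total of a cost `w` over the first `T` steps, from control state `s` and
memory state `σ`. -/
def expectedFrom (P : Protocol n) (ρ : Op n n) (w : Instr n P.mem P.Ctrl → ℕ) :
    ℕ → P.Ctrl → Op P.mem P.mem → ℝ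
  | 0, _, _ => 0
  | T + 1, s, σ => w (P.instr s) * (Matrix.trace σ).re +
      (((P.instr s).branches ρ σ).map fun b => expectedFrom P ρ w T b.1 b.2).sum

/-- Output of the runs that halt within `T` steps. -/
def outputWithin (P : Protocol n) (ρ : Op n n) (T : ℕ) : Op n n :=
  P.outputFrom ρ T P.start (zeroState P.mem)

/-- Expected number of copies consumed in the first `T` steps. -/
def expectedCopies (P : Protocol n) (ρ : Op n n) (T : ℕ) : ℝ :=
  P.expectedFrom ρ Instr.copies T P.start (zeroState P.mem)

/-- Expected number of fractional swaps in the first `T` steps. -/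
def expectedFracSwaps (P : Protocol n) (ρ : Op n n) (T : ℕ) : ℝ :=
  P.expectedFrom ρ Instr.fswaps T P.start (zeroState P.mem)

/-- With probability 1 the protocol halts on copies of `ρ`, and its output is then `out`. -/
def Outputs (P : Protocol n) (ρ out : Op n n) : Prop :=
  Filter.Tendsto (P.outputWithin ρ) Filter.atTop (𝓝 out) ∧ out.trace = 1

/-- `P.Reaches s a b c`: some sequence of measurement outcomes leads to control state `s` after
`a` copies, `b` single-qubit operations and `c` controlled swaps. -/
inductive Reaches (P : Protocol n) : P.Ctrl → ℕ → ℕ → ℕ → Prop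
  | start : Reaches P P.start 0 0 0
  | step {s s' : P.Ctrl} {a b c : ℕ} (h : Reaches P s a b c) (hs : s' ∈ (P.instr s).succ) :
      Reaches P s' (a + (P.instr s).copies) (b + (P.instr s).singles) (c + (P.instr s).cswaps)

end Protocol

end

noncomputable section

/-! ### Signs and quadratic forms over `𝔽₂` -/

/-! Twirling makes the unknown state isotropic. By dataset independence the logical content of the
noisy state for a table `G` is `Λ (V(G) ρ₀ V(G)†)`, with `Λ` and `ρ₀` independent of `G`. Expand a
matrix entry of the twirled state in matrix units: the signs of the gate at `x`, `y` and those of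
the table at `a`, `b` multiply to `(-1)^(q(x)+q(y)+q(a)+q(b))` for a random quadratic form `q`.
Averaging over `q` kills every quadruple that does not cancel in pairs (`sum_quadSign`). What
survives is `sgn (g x) * sgn (g y)` times a kernel independent of `g`. Averaging the kernel over the
affine group, which is doubly transitive, leaves one diagonal and one off-diagonal constant
(`sum_kernel_eq`). So the logical state `ρ` has eigenvalue `F ≥ Fmin` on `ψ = |Ψ(g)⟩` and a single
eigenvalue `lam` on the complement (`twirledState_isotropic`); `Fmin ≥ 4 / 2^n` gives `lam ≤ Fmin /
4`.

It remains to produce the principal eigenvector of `ρ`. A fractional swap by a small angle `t` of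
(control, data) with (`|1⟩`, fresh copy) acts to first order as a controlled `exp(-i t ρ)`; to
second order it replaces the register, with probability `sin² t`. A trial starts the control in
`|+⟩`, applies such swaps until a coin says stop, and measures the control in the basis `|±⟩`. Put
`f = Fmin`. On an eigenspace with eigenvalue `x` the coherence is multiplied on average by `(1-η) /
(1 + i x/f)`, where `η` is the probability of a replacement. Up to this contamination, the outcome
`|−⟩` has probability at least `1/4` along `ψ` and at most `1/34` orthogonally. A trial takes of the
order of `1 / (η f²)` copies.

The protocol is a random walk on levels: `|−⟩` moves 8 levels up, `|+⟩` one level down, below level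
0 the data is reloaded, and from level `H` on it is output. Along `ψ` the walk drifts up,
orthogonally it drifts down. Trials at level `k` have `η = 1 / (200 · 1.1^k)`: they become clean and
expensive only when the data is probably good. Costs grow geometrically with the level, so the top
level dominates: about `1.1^H / f²` copies with `1.1^H` of order `(1-f)/ε + 1/f`, without a
logarithmic factor.

The analysis is exact. The first register always has one 2×2 control matrix per eigenspace (`Blk`),
so runs are described by a transition system on real parameters (`Conf.branches_eq`). Two
supermartingales on it (`Pot.Valid.value_step`) bound the expected number of steps (`costPot`) and
the output weight orthogonal to `ψ` (`errorPot`); finite expected length gives halting with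
probability 1. If `ε ≥ 1 - f`, one undistilled copy suffices. -/

lemma zmod_two_cases (b : ZMod 2) : b = 0 ∨ b = 1 := by
  revert b; decide

lemma sgn_zero : sgn 0 = 1 := by simp [sgn]

lemma sgn_one : sgn 1 = -1 := by simp [sgn]

lemma sgn_add (a b : ZMod 2) : sgn (a + b) = sgn a * sgn b := by
  rcases zmod_two_cases a with rfl | rfl <;> rcases zmod_two_cases b with rfl | rfl <;>
    simp [sgn, show (1 + 1 : ZMod 2) = 0 from rfl]

lemma sgn_mul_self (a : ZMod 2) : sgn a * sgn a = 1 := by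
  rcases zmod_two_cases a with rfl | rfl <;> simp [sgn]

lemma star_sgn (a : ZMod 2) : star (sgn a) = sgn a := by
  rcases zmod_two_cases a with rfl | rfl <;> simp [sgn]

lemma bits_add_self {n : ℕ} (x : Bits n) : x + x = 0 := by
  ext i; exact CharTwo.add_self_eq_zero (x i)

/-- The sign `(-1)^{x·v + xᵀBx}`. -/
def quadSign {n : ℕ} (B : Matrix (Fin n) (Fin n) (ZMod 2)) (v x : Bits n) : ℂ :=
  sgn (x ⬝ᵥ v + x ⬝ᵥ (B *ᵥ x))

lemma quadSign_add {n : ℕ} (B B' : Matrix (Fin n) (Fin n) (ZMod 2)) (v v' x : Bits n) :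
    quadSign (B + B') (v + v') x = quadSign B v x * quadSign B' v' x := by
  rw [quadSign, quadSign, quadSign, ← sgn_add]
  congr 1
  rw [Matrix.add_mulVec, dotProduct_add, dotProduct_add]
  ring

/-- Four points that cancel in pairs. -/
def Paired {n : ℕ} (x y a b : Bits n) : Prop :=
  (x = y ∧ a = b) ∨ (x = a ∧ y = b) ∨ (x = b ∧ y = a)

lemma eq_of_add_eq_zero' {n : ℕ} {x y : Bits n} (h : x + y = 0) : x = y := by
  ext i
  have := congrFun h i
  simp only [Pi.add_apply, Pi.zero_apply] at this
  exact CharTwo.add_eq_zero.mp this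

/-- Distinct nonzero vectors over `𝔽₂` are linearly independent, so some 2×2 minor is nonzero; in
characteristic 2 its sign is immaterial. -/
lemma exists_minor {n : ℕ} {α β : Bits n} (hα : α ≠ 0) (hβ : β ≠ 0) (hne : α ≠ β) :
    ∃ i j, α i * β j + α j * β i = 1 := by
  obtain ⟨i, hi⟩ := Function.ne_iff.mp hα
  have hi1 : α i = 1 := (zmod_two_cases _).resolve_left hi
  rcases zmod_two_cases (β i) with h0 | h1
  · obtain ⟨j, hj⟩ := Function.ne_iff.mp hβ
    have hj1 : β j = 1 := (zmod_two_cases _).resolve_left hj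
    exact ⟨i, j, by rw [hi1, hj1, h0]; simp⟩
  · obtain ⟨j, hj⟩ := Function.ne_iff.mp hne
    refine ⟨i, j, ?_⟩
    rw [hi1, h1]
    rcases zmod_two_cases (α j) with h | h <;> rcases zmod_two_cases (β j) with h' | h' <;>
      simp_all

lemma quadSign_single {n : ℕ} (i j : Fin n) (x : Bits n) :
    quadSign (Matrix.single i j 1) 0 x = sgn (x i * x j) := by
  rw [quadSign]
  congr 1
  simp [Matrix.single_mulVec, dotProduct, Function.update_apply]

lemma quadSign_linear {n : ℕ} (i : Fin n) (x : Bits n) :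
    quadSign 0 (Pi.single i 1) x = sgn (x i) := by
  simp [quadSign]

/-- Points that do not cancel in pairs are separated by a quadratic form. -/
lemma exists_quadSign_ne {n : ℕ} {x y a b : Bits n} (h : ¬ Paired x y a b) :
    ∃ (B : Matrix (Fin n) (Fin n) (ZMod 2)) (v : Bits n), (∀ i j, j ≤ i → B i j = 0) ∧
      quadSign B v x * quadSign B v y * quadSign B v a * quadSign B v b = -1 := by
  by_cases hlin : x + y + a + b = 0
  · have hb : b = x + y + a := by
      have := eq_of_add_eq_zero' hlin
      exact this.symm
    have hxy : x ≠ y := by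
      rintro rfl
      exact h (Or.inl ⟨rfl, by rw [hb, bits_add_self, zero_add]⟩)
    have hxa : x ≠ a := by
      rintro rfl
      exact h (Or.inr (Or.inl ⟨rfl, by rw [hb, add_comm x y, add_assoc, bits_add_self, add_zero]⟩))
    have hya : y ≠ a := by
      rintro rfl
      exact h (Or.inr (Or.inr ⟨by rw [hb, add_assoc, bits_add_self, add_zero], rfl⟩))
    -- When the four points sum to zero, linear forms cannot separate them. The sum of the form `z i
    -- * z j` over the four points is then the minor of `x + y` and `x + a`.
    obtain ⟨i, j, hij⟩ := exists_minor (α := x + y) (β := x + a)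
      (fun h0 => hxy (eq_of_add_eq_zero' h0)) (fun h0 => hxa (eq_of_add_eq_zero' h0))
      (fun h0 => hya (add_left_cancel h0))
    have hne : i ≠ j := by
      rintro rfl
      rw [mul_comm, CharTwo.add_self_eq_zero] at hij
      exact zero_ne_one hij
    have key : ∀ p q : Fin n, (x + y) p * (x + a) q + (x + y) q * (x + a) p = 1 →
        sgn (x p * x q) * sgn (y p * y q) * sgn (a p * a q) * sgn (b p * b q) = -1 := by
      intro p q hpq
      rw [← sgn_add, ← sgn_add, ← sgn_add, ← sgn_one]
      congr 1
      rw [← hpq, hb]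
      simp only [Pi.add_apply]
      generalize x p = a1
      generalize x q = a2
      generalize y p = a3
      generalize y q = a4
      generalize a p = a5
      generalize a q = a6
      revert a1 a2 a3 a4 a5 a6
      decide
    rcases lt_or_gt_of_ne hne with hlt | hlt
    · refine ⟨Matrix.single i j 1, 0, ?_, ?_⟩
      · intro p q hqp
        rw [Matrix.single_apply_of_ne]
        rintro ⟨rfl, rfl⟩
        exact absurd hlt (not_lt.mpr hqp)
      · simp only [quadSign_single]
        exact key i j hij
    · refine ⟨Matrix.single j i 1, 0, ?_, ?_⟩
      · intro p q hqp
        rw [Matrix.single_apply_of_ne]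
        rintro ⟨rfl, rfl⟩
        exact absurd hlt (not_lt.mpr hqp)
      · simp only [quadSign_single]
        exact key j i (by rw [add_comm]; exact hij)
  · obtain ⟨i, hi⟩ := Function.ne_iff.mp hlin
    have hi1 := (zmod_two_cases _).resolve_left hi
    refine ⟨0, Pi.single i 1, by simp, ?_⟩
    simp only [quadSign_linear]
    rw [← sgn_add, ← sgn_add, ← sgn_add, ← sgn_one]
    exact congrArg sgn hi1

open Classical in
/-- The strictly upper triangular matrices. -/
def upperSet (n : ℕ) : Finset (Matrix (Fin n) (Fin n) (ZMod 2)) :=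
  Finset.univ.filter fun B => ∀ i j, j ≤ i → B i j = 0

open Classical in
/-- The invertible matrices. -/
def unitSet (n : ℕ) : Finset (Matrix (Fin n) (Fin n) (ZMod 2)) :=
  Finset.univ.filter fun A => IsUnit A.det

lemma quadSign_mul_self {n : ℕ} (B : Matrix (Fin n) (Fin n) (ZMod 2)) (v x : Bits n) :
    quadSign B v x * quadSign B v x = 1 := sgn_mul_self _

lemma quadSign_of_paired {n : ℕ} {x y a b : Bits n} (h : Paired x y a b)
    (B : Matrix (Fin n) (Fin n) (ZMod 2)) (v : Bits n) :
    quadSign B v x * quadSign B v y * quadSign B v a * quadSign B v b = 1 := by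
  have hx := quadSign_mul_self B v x
  have hy := quadSign_mul_self B v y
  rcases h with ⟨rfl, rfl⟩ | ⟨rfl, rfl⟩ | ⟨rfl, rfl⟩
  · linear_combination hx * quadSign B v a * quadSign B v a + quadSign_mul_self B v a
  · linear_combination hx * quadSign B v y * quadSign B v y + hy
  · linear_combination hx * quadSign B v y * quadSign B v y + hy

open Classical in
-- Orthogonality of characters: if the points do not cancel in pairs, translating `(B, v)` by a
-- separating form changes the sign of every term, so the sum equals its negative.
lemma sum_quadSign {n : ℕ} (x y a b : Bits n) :
    ∑ p ∈ upperSet n ×ˢ (Finset.univ : Finset (Bits n)),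
      quadSign p.1 p.2 x * quadSign p.1 p.2 y * quadSign p.1 p.2 a * quadSign p.1 p.2 b =
    if Paired x y a b then ((upperSet n ×ˢ (Finset.univ : Finset (Bits n))).card : ℂ) else 0 := by
  split_ifs with h
  · rw [Finset.sum_congr rfl fun p _ => quadSign_of_paired h p.1 p.2]
    simp
  · obtain ⟨B, v, hB, hq⟩ := exists_quadSign_ne h
    set S := ∑ p ∈ upperSet n ×ˢ (Finset.univ : Finset (Bits n)),
      quadSign p.1 p.2 x * quadSign p.1 p.2 y * quadSign p.1 p.2 a * quadSign p.1 p.2 b with hS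
    have hB2 : B + B = 0 := by ext i j; exact CharTwo.add_self_eq_zero _
    have : S = -S := by
      nth_rewrite 1 [hS]
      rw [hS, ← Finset.sum_neg_distrib]
      refine Finset.sum_bij' (fun p _ => (p.1 + B, p.2 + v)) (fun p _ => (p.1 + B, p.2 + v))
        ?_ ?_ ?_ ?_ ?_
      · intro p hp
        simp only [upperSet, Finset.mem_product, Finset.mem_filter, Finset.mem_univ, true_and,
          and_true] at hp ⊢
        intro i j hij
        rw [Matrix.add_apply, hp i j hij, hB i j hij, add_zero]
      · intro p hp
        simp only [upperSet, Finset.mem_product, Finset.mem_filter, Finset.mem_univ, true_and,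
          and_true] at hp ⊢
        intro i j hij
        rw [Matrix.add_apply, hp i j hij, hB i j hij, add_zero]
      · intro p _
        simp [add_assoc, hB2, bits_add_self]
      · intro p _
        simp [add_assoc, hB2, bits_add_self]
      · intro p _
        simp only [quadSign_add]
        linear_combination (quadSign p.1 p.2 x * quadSign p.1 p.2 y *
          quadSign p.1 p.2 a * quadSign p.1 p.2 b) * hq
    have h2 : (2 : ℂ) * S = 0 := by linear_combination this
    simpa using h2

/-! ### Action of the twirling gates -/

lemma twirlSet_eq_product (n : ℕ) : twirlSet n =
    unitSet n ×ˢ (upperSet n ×ˢ ((Finset.univ : Finset (Bits n)) ×ˢ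
      (Finset.univ : Finset (Bits n)))) := by
  ext c
  simp [twirlSet, unitSet, upperSet]

lemma twirlGate_apply {n : ℕ} (c : TwirlData n) (y x : Bits n) :
    twirlGate c y x = if y = c.1 *ᵥ x + c.2.2.1 then quadSign c.2.1 c.2.2.2 x else 0 := by
  have hq : quadSign c.2.1 c.2.2.2 x = sgn (x ⬝ᵥ (c.2.1 *ᵥ x)) * sgn (x ⬝ᵥ c.2.2.2) := by
    rw [quadSign, sgn_add, mul_comm]
  rw [twirlGate, gateZ, gateQ, Matrix.mul_diagonal, Matrix.mul_diagonal, Matrix.mul_apply, hq]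
  simp [gateX, gateM]

lemma twirlGate_conj_apply {n : ℕ} {c : TwirlData n} (hc : c.1 ∈ unitSet n) (M : Op n n)
    (x' y' : Bits n) :
    (twirlGate c * M * (twirlGate c)ᴴ) x' y' =
      quadSign c.2.1 c.2.2.2 (c.1⁻¹ *ᵥ (x' + c.2.2.1)) *
      quadSign c.2.1 c.2.2.2 (c.1⁻¹ *ᵥ (y' + c.2.2.1)) *
      M (c.1⁻¹ *ᵥ (x' + c.2.2.1)) (c.1⁻¹ *ᵥ (y' + c.2.2.1)) := by
  have hdet : IsUnit c.1.det := by simpa [unitSet] using hc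
  have hiff : ∀ x y : Bits n, (y = c.1 *ᵥ x + c.2.2.1) ↔ (x = c.1⁻¹ *ᵥ (y + c.2.2.1)) := by
    intro x y
    constructor
    · rintro rfl
      rw [add_assoc, bits_add_self, add_zero, Matrix.mulVec_mulVec, Matrix.nonsing_inv_mul _ hdet,
        Matrix.one_mulVec]
    · rintro rfl
      rw [Matrix.mulVec_mulVec, Matrix.mul_nonsing_inv _ hdet, Matrix.one_mulVec, add_assoc,
        bits_add_self, add_zero]
  rw [Matrix.mul_apply]
  simp only [Matrix.mul_apply, Matrix.conjTranspose_apply, twirlGate_apply, hiff]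
  simp only [ite_mul, zero_mul, Finset.sum_ite_eq', Finset.mem_univ, if_true,
    apply_ite star, star_zero, mul_ite, mul_zero]
  rw [show star (quadSign c.2.1 c.2.2.2 (c.1⁻¹ *ᵥ (y' + c.2.2.1))) =
    quadSign c.2.1 c.2.2.2 (c.1⁻¹ *ᵥ (y' + c.2.2.1)) from star_sgn _]
  ring

lemma sgn_twirlTable {n : ℕ} (g : Bits n → ZMod 2) (c : TwirlData n) (x : Bits n) :
    sgn (twirlTable g c x) = sgn (g (c.1 *ᵥ x + c.2.2.1)) * quadSign c.2.1 c.2.2.2 x := by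
  rw [twirlTable, add_assoc, sgn_add, quadSign]

lemma conjBy_apply {k l : ℕ} (U : Op l k) (σ : Op k k) : conjBy U σ = U * σ * Uᴴ := rfl

lemma conj_qram_apply {n : ℕ} (g : Bits n → ZMod 2) (M : Op n n) (a b : Bits n) :
    conjBy (qram g) M a b = sgn (g a) * sgn (g b) * M a b := by
  simp [conjBy, qram, Matrix.diagonal_conjTranspose, Matrix.mul_diagonal, Matrix.diagonal_mul,
    star_sgn]
  ring

lemma superOp_apply {n : ℕ} (Λ : SuperOp n n) (M : Op n n) (x y : Bits n) :
    Λ M x y = ∑ a, ∑ b, M a b * Λ (Matrix.single a b 1) x y := by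
  conv_lhs => rw [Matrix.matrix_eq_sum_single M]
  rw [map_sum, Matrix.sum_apply]
  refine Finset.sum_congr rfl fun a _ => ?_
  rw [map_sum, Matrix.sum_apply]
  refine Finset.sum_congr rfl fun b _ => ?_
  rw [show Matrix.single a b (M a b) = M a b • Matrix.single a b (1 : ℂ) by
    rw [Matrix.smul_single, smul_eq_mul, mul_one], map_smul]
  rfl

/-- What remains of the noise after averaging over quadratic signs. -/
def pairedKernel {n : ℕ} (Λ : SuperOp n n) (ρ₀ : Op n n) (x y : Bits n) : ℂ :=
  if x = y then ∑ a, Λ (Matrix.single a a 1) x x * ρ₀ a a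
  else Λ (Matrix.single x y 1) x y * ρ₀ x y + Λ (Matrix.single y x 1) x y * ρ₀ y x

open Classical in
lemma sum_paired {n : ℕ} (Λ : SuperOp n n) (ρ₀ : Op n n) (s : Bits n → ℂ)
    (hs : ∀ x, s x * s x = 1) (x y : Bits n) :
    ∑ a, ∑ b, (if Paired x y a b then s a * s b * ρ₀ a b * Λ (Matrix.single a b 1) x y else 0) =
      s x * s y * pairedKernel Λ ρ₀ x y := by
  by_cases h : x = y
  · subst h
    have : ∀ a b, Paired x x a b ↔ b = a := by
      intro a b
      constructor
      · rintro (⟨-, h⟩ | ⟨h, h'⟩ | ⟨h, h'⟩)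
        · exact h.symm
        · exact h'.symm.trans h
        · exact h.symm.trans h'
      · rintro rfl; exact Or.inl ⟨rfl, rfl⟩
    simp only [this, Finset.sum_ite_eq', Finset.mem_univ, if_true, pairedKernel, hs, one_mul]
    exact Finset.sum_congr rfl fun a _ => mul_comm _ _
  · have : ∀ a b, Paired x y a b ↔ ((a, b) = (x, y) ∨ (a, b) = (y, x)) := by
      intro a b
      simp only [Paired, Prod.mk.injEq]
      constructor
      · rintro (⟨h', -⟩ | ⟨rfl, rfl⟩ | ⟨rfl, rfl⟩)
        · exact absurd h' h
        · exact Or.inl ⟨rfl, rfl⟩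
        · exact Or.inr ⟨rfl, rfl⟩
      · rintro (⟨rfl, rfl⟩ | ⟨rfl, rfl⟩)
        · exact Or.inr (Or.inl ⟨rfl, rfl⟩)
        · exact Or.inr (Or.inr ⟨rfl, rfl⟩)
    rw [← Finset.sum_product']
    simp only [this]
    rw [← Finset.sum_filter]
    have hset : ((Finset.univ ×ˢ Finset.univ : Finset (Bits n × Bits n)).filter
        fun p => p = (x, y) ∨ p = (y, x)) = {(x, y), (y, x)} := by
      ext p; simp
    rw [show (Finset.filter (fun p : Bits n × Bits n => (p.1, p.2) = (x, y) ∨ (p.1, p.2) = (y, x))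
      (Finset.univ ×ˢ Finset.univ)) = {(x, y), (y, x)} from hset,
      Finset.sum_pair (by simp [h])]
    simp only [pairedKernel, h, if_false]
    ring

/-- For fixed `A` and `u`, the sum over `(B, v)` keeps only `a = b` when `x = y`, and `{a, b} = {x,
y}` otherwise. In both cases the signs of `g` combine to those at `x'` and `y'`, and the rest no
longer depends on `g`. -/
lemma sum_twirl_apply {n : ℕ} (Λ : SuperOp n n) (ρ₀ : Op n n) (g : Bits n → ZMod 2)
    (x' y' : Bits n) :
    ∑ c ∈ twirlSet n, (twirlGate c * Λ (conjBy (qram (twirlTable g c)) ρ₀) * (twirlGate c)ᴴ) x' y' =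
      sgn (g x') * sgn (g y') * (((upperSet n ×ˢ (Finset.univ : Finset (Bits n))).card : ℂ) *
        ∑ A ∈ unitSet n, ∑ u, pairedKernel Λ ρ₀ (A⁻¹ *ᵥ (x' + u)) (A⁻¹ *ᵥ (y' + u))) := by
  classical
  rw [twirlSet_eq_product, Finset.sum_product, Finset.mul_sum, Finset.mul_sum]
  refine Finset.sum_congr rfl fun A hA => ?_
  have hdet : IsUnit A.det := by simpa [unitSet] using hA
  rw [Finset.sum_product]
  simp only [Finset.sum_product]
  rw [Finset.sum_comm, Finset.mul_sum, Finset.mul_sum]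
  refine Finset.sum_congr rfl fun u _ => ?_
  set x := A⁻¹ *ᵥ (x' + u) with hx
  set y := A⁻¹ *ᵥ (y' + u) with hy
  have hx' : A *ᵥ x + u = x' := by
    rw [hx, Matrix.mulVec_mulVec, Matrix.mul_nonsing_inv _ hdet, Matrix.one_mulVec, add_assoc,
      bits_add_self, add_zero]
  have hy' : A *ᵥ y + u = y' := by
    rw [hy, Matrix.mulVec_mulVec, Matrix.mul_nonsing_inv _ hdet, Matrix.one_mulVec, add_assoc,
      bits_add_self, add_zero]
  have step : ∀ B v, (twirlGate (A, B, u, v) *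
        Λ (conjBy (qram (twirlTable g (A, B, u, v))) ρ₀) * (twirlGate (A, B, u, v))ᴴ) x' y' =
      ∑ a, ∑ b, (sgn (g (A *ᵥ a + u)) * sgn (g (A *ᵥ b + u)) * ρ₀ a b *
        Λ (Matrix.single a b 1) x y) *
        (quadSign B v x * quadSign B v y * quadSign B v a * quadSign B v b) := by
    intro B v
    rw [twirlGate_conj_apply (c := (A, B, u, v)) hA, superOp_apply, Finset.mul_sum]
    refine Finset.sum_congr rfl fun a _ => ?_
    rw [Finset.mul_sum]
    refine Finset.sum_congr rfl fun b _ => ?_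
    simp only [conj_qram_apply, sgn_twirlTable, ← hx, ← hy]
    ring
  simp only [step]
  rw [← Finset.sum_product', Finset.sum_comm]
  have : ∀ a ∈ (Finset.univ : Finset (Bits n)),
      ∑ p ∈ upperSet n ×ˢ (Finset.univ : Finset (Bits n)), ∑ b,
        (sgn (g (A *ᵥ a + u)) * sgn (g (A *ᵥ b + u)) * ρ₀ a b * Λ (Matrix.single a b 1) x y) *
        (quadSign p.1 p.2 x * quadSign p.1 p.2 y * quadSign p.1 p.2 a * quadSign p.1 p.2 b) =
      ∑ b, ((upperSet n ×ˢ (Finset.univ : Finset (Bits n))).card : ℂ) *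
        (if Paired x y a b then (sgn (g (A *ᵥ a + u)) * sgn (g (A *ᵥ b + u)) * ρ₀ a b *
          Λ (Matrix.single a b 1) x y) else 0) := by
    intro a _
    rw [Finset.sum_comm]
    refine Finset.sum_congr rfl fun b _ => ?_
    rw [← Finset.mul_sum, sum_quadSign]
    split_ifs <;> ring
  rw [Finset.sum_congr rfl this]
  simp only [← Finset.mul_sum]
  rw [sum_paired Λ ρ₀ (fun a => sgn (g (A *ᵥ a + u))) (fun _ => sgn_mul_self _) x y, hx', hy']
  ring

/-! ### Two-transitivity of the affine group -/

/-- The isomorphism between the lines spanned by `x` and `y` extends to an automorphism of the whole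
space. -/
lemma exists_unit_mulVec {n : ℕ} {x y : Bits n} (hx : x ≠ 0) (hy : y ≠ 0) :
    ∃ A ∈ unitSet n, A *ᵥ x = y := by
  obtain ⟨e, he⟩ := Submodule.exists_linearEquiv_restrict_eq
    ((LinearEquiv.toSpanNonzeroSingleton (ZMod 2) (Bits n) x hx).symm ≪≫ₗ
      LinearEquiv.toSpanNonzeroSingleton (ZMod 2) (Bits n) y hy)
  refine ⟨LinearMap.toMatrix' e.toLinearMap, ?_, ?_⟩
  · simp only [unitSet, Finset.mem_filter, Finset.mem_univ, true_and]
    exact LinearEquiv.isUnit_det e (Pi.basisFun _ _) (Pi.basisFun _ _)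
  · rw [LinearMap.toMatrix'_mulVec]
    have h := he ⟨x, Submodule.mem_span_singleton_self x⟩
    have h1 : (LinearEquiv.toSpanNonzeroSingleton (ZMod 2) (Bits n) x hx).symm
        ⟨x, Submodule.mem_span_singleton_self x⟩ = 1 :=
      LinearEquiv.coord_self (ZMod 2) (Bits n) x hx
    rw [LinearEquiv.trans_apply, h1] at h
    simpa using h.symm

/-- Invariance of the average under the affine group: substitute `A₀ A` for `A` and `A₀ u + w` for
`u`; the two shifts by `w` cancel in characteristic 2. -/
lemma sum_kernel_affine {n : ℕ} (κ : Bits n → Bits n → ℂ)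
    {A₀ : Matrix (Fin n) (Fin n) (ZMod 2)} (h₀ : A₀ ∈ unitSet n) (w x y : Bits n) :
    ∑ A ∈ unitSet n, ∑ u, κ (A⁻¹ *ᵥ ((A₀ *ᵥ x + w) + u)) (A⁻¹ *ᵥ ((A₀ *ᵥ y + w) + u)) =
      ∑ A ∈ unitSet n, ∑ u, κ (A⁻¹ *ᵥ (x + u)) (A⁻¹ *ᵥ (y + u)) := by
  classical
  have hdet : IsUnit A₀.det := by simpa [unitSet] using h₀
  symm
  refine Finset.sum_bij' (fun A _ => A₀ * A) (fun A _ => A₀⁻¹ * A) ?_ ?_ ?_ ?_ ?_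
  · intro A hA
    simp only [unitSet, Finset.mem_filter, Finset.mem_univ, true_and, Matrix.det_mul] at hA ⊢
    exact hdet.mul hA
  · intro A hA
    simp only [unitSet, Finset.mem_filter, Finset.mem_univ, true_and, Matrix.det_mul] at hA ⊢
    exact (Matrix.isUnit_nonsing_inv_det A₀ hdet).mul hA
  · intro A _
    simp [← Matrix.mul_assoc, Matrix.nonsing_inv_mul _ hdet]
  · intro A _
    simp [← Matrix.mul_assoc, Matrix.mul_nonsing_inv _ hdet]
  · intro A hA
    refine Fintype.sum_bijective (fun u => A₀ *ᵥ u + w) ?_ _ _ ?_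
    · refine Function.bijective_iff_has_inverse.mpr ⟨fun z => A₀⁻¹ *ᵥ (z + w), fun u => ?_,
        fun z => ?_⟩
      · simp [add_assoc, bits_add_self, Matrix.mulVec_mulVec, Matrix.nonsing_inv_mul _ hdet]
      · simp [add_assoc, bits_add_self, Matrix.mulVec_mulVec, Matrix.mul_nonsing_inv _ hdet]
    · intro u
      have : ∀ z : Bits n, (A₀ * A)⁻¹ *ᵥ ((A₀ *ᵥ z + w) + (A₀ *ᵥ u + w)) = A⁻¹ *ᵥ (z + u) := by
        intro z
        rw [show (A₀ *ᵥ z + w) + (A₀ *ᵥ u + w) = A₀ *ᵥ (z + u) by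
          rw [Matrix.mulVec_add, add_add_add_comm, bits_add_self, add_zero], Matrix.mul_inv_rev,
          Matrix.mulVec_mulVec, Matrix.mul_assoc, Matrix.nonsing_inv_mul _ hdet, Matrix.mul_one]
      rw [this, this]

lemma exists_affine_map {n : ℕ} {x y x' y' : Bits n} (h : x ≠ y) (h' : x' ≠ y') :
    ∃ A ∈ unitSet n, ∃ w, A *ᵥ x + w = x' ∧ A *ᵥ y + w = y' := by
  obtain ⟨A, hA, hxy⟩ := exists_unit_mulVec (x := x + y) (y := x' + y')
    (fun h0 => h (eq_of_add_eq_zero' h0)) (fun h0 => h' (eq_of_add_eq_zero' h0))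
  refine ⟨A, hA, A *ᵥ x + x', ?_, ?_⟩
  · rw [← add_assoc, bits_add_self, zero_add]
  · rw [← add_assoc, ← Matrix.mulVec_add, add_comm y x, hxy, add_right_comm, bits_add_self,
      zero_add]

lemma one_mem_unitSet (n : ℕ) : (1 : Matrix (Fin n) (Fin n) (ZMod 2)) ∈ unitSet n := by
  simp [unitSet]

/-- The affine group acts transitively on points and on ordered pairs of distinct points, so the
invariant average has only two values. -/
lemma sum_kernel_eq {n : ℕ} (κ : Bits n → Bits n → ℂ) :
    ∃ d c : ℂ, ∀ x y : Bits n,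
      ∑ A ∈ unitSet n, ∑ u, κ (A⁻¹ *ᵥ (x + u)) (A⁻¹ *ᵥ (y + u)) = if x = y then d else c := by
  refine ⟨∑ A ∈ unitSet n, ∑ u, κ (A⁻¹ *ᵥ (0 + u)) (A⁻¹ *ᵥ (0 + u)), ?_⟩
  have hd : ∀ x, ∑ A ∈ unitSet n, ∑ u, κ (A⁻¹ *ᵥ (x + u)) (A⁻¹ *ᵥ (x + u)) =
      ∑ A ∈ unitSet n, ∑ u, κ (A⁻¹ *ᵥ (0 + u)) (A⁻¹ *ᵥ (0 + u)) := by
    intro x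
    simpa using sum_kernel_affine κ (one_mem_unitSet n) x 0 0
  by_cases hex : ∃ p : Bits n × Bits n, p.1 ≠ p.2
  · obtain ⟨⟨x₀, y₀⟩, h0⟩ := hex
    refine ⟨∑ A ∈ unitSet n, ∑ u, κ (A⁻¹ *ᵥ (x₀ + u)) (A⁻¹ *ᵥ (y₀ + u)), fun x y => ?_⟩
    split_ifs with hxy
    · subst hxy; exact hd x
    · obtain ⟨A₀, hA₀, w, rfl, rfl⟩ := exists_affine_map h0 hxy
      exact sum_kernel_affine κ hA₀ w x₀ y₀
  -- No two distinct points exist (`n = 0`); the off-diagonal constant is irrelevant.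
  · push Not at hex
    refine ⟨0, fun x y => ?_⟩
    obtain rfl : x = y := hex (x, y)
    rw [if_pos rfl]
    exact hd x

/-- The twirl of a covariant family of states is, up to the signs of the data table, a combination
of the identity and the all-ones matrix. -/
lemma exists_twirl_form {n : ℕ} (Λ : SuperOp n n) (ρ₀ : Op n n) (g : Bits n → ZMod 2) :
    ∃ d c : ℂ, ∀ x y, (((twirlSet n).card : ℂ)⁻¹ • ∑ c ∈ twirlSet n,
        conjBy (twirlGate c) (Λ (conjBy (qram (twirlTable g c)) ρ₀))) x y =
      sgn (g x) * sgn (g y) * if x = y then d else c := by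
  obtain ⟨d, c, hdc⟩ := sum_kernel_eq (pairedKernel Λ ρ₀)
  refine ⟨((twirlSet n).card : ℂ)⁻¹ *
    (((upperSet n ×ˢ (Finset.univ : Finset (Bits n))).card : ℂ) * d), ((twirlSet n).card : ℂ)⁻¹ *
    (((upperSet n ×ˢ (Finset.univ : Finset (Bits n))).card : ℂ) * c), fun x y => ?_⟩
  have := sum_twirl_apply Λ ρ₀ g x y
  rw [hdc] at this
  rw [Matrix.smul_apply, Matrix.sum_apply, smul_eq_mul]
  simp only [conjBy_apply (twirlGate _)]
  rw [this]
  split_ifs <;> ring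

end

noncomputable section

open scoped ComplexOrder

/-! ### Channels -/

lemma IsChannel.posSemidef {k l : ℕ} {Φ : SuperOp k l} (h : IsChannel Φ) {σ : Op k k}
    (hσ : σ.PosSemidef) : (Φ σ).PosSemidef := by
  obtain ⟨r, K, hK, -⟩ := h
  rw [hK]
  exact Matrix.posSemidef_sum _ fun i _ => hσ.mul_mul_conjTranspose_same (K i)

lemma IsChannel.trace {k l : ℕ} {Φ : SuperOp k l} (h : IsChannel Φ) (σ : Op k k) :
    (Φ σ).trace = σ.trace := by
  obtain ⟨r, K, hK, hsum⟩ := h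
  have h1 : ∑ i, (K i * σ * (K i)ᴴ).trace = ((∑ i, (K i)ᴴ * K i) * σ).trace := by
    rw [Matrix.sum_mul, Matrix.trace_sum]
    refine Finset.sum_congr rfl fun i _ => ?_
    rw [Matrix.trace_mul_comm, Matrix.mul_assoc]
  rw [hK, Matrix.trace_sum, h1, hsum, Matrix.one_mul]

lemma conjBy_conjBy {k l m : ℕ} (U : Op m l) (W : Op l k) (σ : Op k k) :
    conjBy U (conjBy W σ) = conjBy (U * W) σ := by
  simp only [conjBy_apply, Matrix.conjTranspose_mul, Matrix.mul_assoc]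

lemma trace_conjBy {k l : ℕ} {U : Op l k} (hU : Uᴴ * U = 1) (σ : Op k k) :
    (conjBy U σ).trace = σ.trace := by
  rw [conjBy_apply, Matrix.mul_assoc, Matrix.trace_mul_comm, Matrix.mul_assoc, hU, Matrix.mul_one]

lemma conjBy_one {k : ℕ} (σ : Op k k) : conjBy (1 : Op k k) σ = σ := by
  simp [conjBy_apply]

/-! ### Resource states -/

lemma card_bits (n : ℕ) : Fintype.card (Bits n) = 2 ^ n := by
  simp [ZMod.card]

lemma resourceState_apply {n : ℕ} (g : Bits n → ZMod 2) (x : Bits n) :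
    resourceState g x = sgn (g x) * ((Real.sqrt (2 ^ n) : ℝ) : ℂ)⁻¹ := by
  simp [resourceState, qram, plusState, Matrix.mulVec_diagonal]

lemma inv_sqrt_mul_self (n : ℕ) :
    ((Real.sqrt (2 ^ n) : ℝ) : ℂ)⁻¹ * ((Real.sqrt (2 ^ n) : ℝ) : ℂ)⁻¹ = ((2 : ℂ) ^ n)⁻¹ := by
  rw [← mul_inv, ← Complex.ofReal_mul, Real.mul_self_sqrt (by positivity)]
  norm_num

lemma ketbra_resourceState {n : ℕ} (g : Bits n → ZMod 2) (x y : Bits n) :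
    ketbra (resourceState g) x y = sgn (g x) * sgn (g y) * ((2 : ℂ) ^ n)⁻¹ := by
  rw [ketbra, Matrix.vecMulVec_apply, Pi.star_apply, resourceState_apply, resourceState_apply,
    star_mul', star_sgn, ← inv_sqrt_mul_self]
  rw [Complex.star_def, map_inv₀, Complex.conj_ofReal]
  ring

lemma resourceState_norm {n : ℕ} (g : Bits n → ZMod 2) :
    star (resourceState g) ⬝ᵥ resourceState g = 1 := by
  have h : star (resourceState g) ⬝ᵥ resourceState g = (ketbra (resourceState g)).trace := by
    rw [ketbra, Matrix.trace_vecMulVec, dotProduct_comm]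
  rw [h, Matrix.trace]
  simp only [Matrix.diag_apply, ketbra_resourceState, sgn_mul_self, one_mul]
  rw [Finset.sum_const, Finset.card_univ, card_bits, nsmul_eq_mul]
  push_cast
  exact mul_inv_cancel₀ (by positivity)

lemma twirlGate_unitary {n : ℕ} {c : TwirlData n} (hc : c.1 ∈ unitSet n) :
    (twirlGate c)ᴴ * twirlGate c = 1 := by
  have hdet : IsUnit c.1.det := by simpa [unitSet] using hc
  have hinj : ∀ x y : Bits n, c.1 *ᵥ x + c.2.2.1 = c.1 *ᵥ y + c.2.2.1 ↔ x = y := by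
    intro x y
    rw [add_left_inj]
    exact (Matrix.mulVec_injective_of_isUnit ((Matrix.isUnit_iff_isUnit_det _).mpr hdet)).eq_iff
  ext x y
  rw [Matrix.mul_apply, Matrix.one_apply]
  simp only [Matrix.conjTranspose_apply, twirlGate_apply, apply_ite star, star_zero, ite_mul,
    zero_mul, mul_ite, mul_zero, Finset.sum_ite_eq', Finset.mem_univ, if_true, hinj]
  by_cases h : x = y
  · subst h
    simp only [if_true]
    rw [show star (quadSign c.2.1 c.2.2.2 x) = quadSign c.2.1 c.2.2.2 x from star_sgn _,
      quadSign_mul_self]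
  · simp [h, Ne.symm h]

/-- The table `g_C` is designed for this: its quadratic sign cancels the one applied by the gate,
and the affine substitution is undone by the permutation of the basis. -/
lemma twirlGate_resourceState {n : ℕ} (g : Bits n → ZMod 2) {c : TwirlData n}
    (hc : c.1 ∈ unitSet n) :
    twirlGate c *ᵥ resourceState (twirlTable g c) = resourceState g := by
  have hdet : IsUnit c.1.det := by simpa [unitSet] using hc
  ext y
  have hiff : ∀ x : Bits n, (y = c.1 *ᵥ x + c.2.2.1) ↔ (x = c.1⁻¹ *ᵥ (y + c.2.2.1)) := by
    intro x
    constructor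
    · rintro rfl
      rw [add_assoc, bits_add_self, add_zero, Matrix.mulVec_mulVec, Matrix.nonsing_inv_mul _ hdet,
        Matrix.one_mulVec]
    · rintro rfl
      rw [Matrix.mulVec_mulVec, Matrix.mul_nonsing_inv _ hdet, Matrix.one_mulVec, add_assoc,
        bits_add_self, add_zero]
  rw [Matrix.mulVec, dotProduct]
  simp only [twirlGate_apply, hiff, ite_mul, zero_mul, Finset.sum_ite_eq',
    Finset.mem_univ, if_true, resourceState_apply, sgn_twirlTable]
  rw [Matrix.mulVec_mulVec, Matrix.mul_nonsing_inv _ hdet, Matrix.one_mulVec, add_assoc,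
    bits_add_self, add_zero]
  linear_combination (sgn (g y) * ((Real.sqrt (2 ^ n) : ℝ) : ℂ)⁻¹) *
    quadSign_mul_self c.2.1 c.2.2.2 (c.1⁻¹ *ᵥ (y + c.2.2.1))

/-! ### The twirled state is isotropic -/

/-- The operator with eigenvalue `F` on `ψ` and `lam` on the orthogonal complement. -/
def isotropic {n : ℕ} (ψ : Bits n → ℂ) (F lam : ℝ) : Op n n :=
  (F : ℂ) • ketbra ψ + (lam : ℂ) • (1 - ketbra ψ)

lemma fidelity_conjBy {k l : ℕ} (U : Op l k) (ψ : Bits l → ℂ) (σ : Op k k) :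
    fidelity ψ (conjBy U σ) = fidelity (Uᴴ *ᵥ ψ) σ := by
  rw [fidelity, fidelity, conjBy_apply, Matrix.star_mulVec, Matrix.conjTranspose_conjTranspose,
    ← Matrix.mulVec_mulVec, ← Matrix.mulVec_mulVec, Matrix.dotProduct_mulVec]

lemma fidelity_sum {k : ℕ} {ι : Type*} (s : Finset ι) (ψ : Bits k → ℂ) (f : ι → Op k k) :
    fidelity ψ (∑ i ∈ s, f i) = ∑ i ∈ s, fidelity ψ (f i) := by
  simp only [fidelity]
  rw [Matrix.sum_mulVec, dotProduct_sum, Complex.re_sum]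

lemma fidelity_smul {k : ℕ} (r : ℝ) (ψ : Bits k → ℂ) (σ : Op k k) :
    fidelity ψ ((r : ℂ) • σ) = r * fidelity ψ σ := by
  simp only [fidelity]
  rw [Matrix.smul_mulVec, dotProduct_smul, smul_eq_mul, Complex.re_ofReal_mul]

lemma twirlSet_nonempty (n : ℕ) : (twirlSet n).Nonempty :=
  ⟨(1, 0, 0, 0), by simp [twirlSet]⟩

lemma mem_unitSet_of_mem_twirlSet {n : ℕ} {c : TwirlData n} (hc : c ∈ twirlSet n) :
    c.1 ∈ unitSet n := by
  rw [twirlSet_eq_product] at hc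
  exact (Finset.mem_product.mp hc).1

/-- Conjugated by the signs, `T` is `(d - c) 1 + c J` with `J` the all-ones matrix, whose range is
spanned by the uniform vector. Thus `lam = d - c`, and the trace fixes the other eigenvalue. -/
lemma isotropic_of_form {n : ℕ} (g : Bits n → ZMod 2) {T : Op n n} (hT : T.PosSemidef)
    (htr : T.trace = 1) {d c : ℂ}
    (hform : ∀ x y, T x y = sgn (g x) * sgn (g y) * if x = y then d else c) :
    ∃ F lam : ℝ, 0 ≤ lam ∧ F + (2 ^ n - 1) * lam = 1 ∧ T = isotropic (resourceState g) F lam ∧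
      F = fidelity (resourceState g) T := by
  obtain ⟨c', hform', hc'⟩ : ∃ c' : ℂ, (∀ x y, T x y = sgn (g x) * sgn (g y) *
      if x = y then d else c') ∧ 0 ≤ d - c' := by
    by_cases hex : ∃ p : Bits n × Bits n, p.1 ≠ p.2
    · obtain ⟨⟨x, y⟩, hxy⟩ := hex
      simp only at hxy
      refine ⟨c, hform, ?_⟩
      -- This vector is orthogonal to `resourceState g`, so positivity of `T` on it says exactly `0
      -- ≤ d - c`.
      have h1 := hT.dotProduct_mulVec_nonneg (Pi.single x (sgn (g x)) - Pi.single y (sgn (g y)))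
      have h2 : star (Pi.single x (sgn (g x)) - Pi.single y (sgn (g y)) : Bits n → ℂ) ⬝ᵥ
          (T *ᵥ (Pi.single x (sgn (g x)) - Pi.single y (sgn (g y)))) = 2 * (d - c) := by
        rw [star_sub, ← Pi.single_star, ← Pi.single_star, star_sgn, star_sgn, sub_dotProduct,
          Matrix.mulVec_sub, dotProduct_sub, dotProduct_sub]
        simp only [single_dotProduct, Matrix.mulVec_single, Matrix.col_apply,
          Pi.smul_apply, MulOpposite.smul_eq_mul_unop, MulOpposite.unop_op, hform, if_true, hxy,
          Ne.symm hxy, if_false]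
        have hx := sgn_mul_self (g x)
        have hy := sgn_mul_self (g y)
        linear_combination (d * (sgn (g x) * sgn (g x) + 1) - c * (sgn (g y) * sgn (g y))
          - c * (sgn (g y) * sgn (g y))) * hx +
          (d * (sgn (g y) * sgn (g y) + 1) - 2 * c) * hy
      rw [h2] at h1
      have h3 := mul_nonneg (show (0 : ℂ) ≤ ((1 / 2 : ℝ) : ℂ) by
        rw [Complex.zero_le_real]; norm_num) h1
      convert h3 using 1
      push_cast
      ring
    · push Not at hex
      -- With a single basis vector `c` never occurs in `T`; replacing it by `d` makes `lam = 0`.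
      exact ⟨d, fun x y => by rw [hform, if_pos (hex (x, y))]; simp, by simp⟩
  have hN : (2 : ℂ) ^ n * d = 1 := by
    rw [← htr, Matrix.trace]
    simp only [Matrix.diag_apply, hform, sgn_mul_self, one_mul, if_true]
    rw [Finset.sum_const, Finset.card_univ, card_bits, nsmul_eq_mul]
    push_cast; rfl
  have hN0 : (2 : ℂ) ^ n ≠ 0 := by positivity
  obtain ⟨lam, hlam⟩ : ∃ lam : ℝ, (lam : ℂ) = d - c' :=
    ⟨(d - c').re, by
      have := (Complex.nonneg_iff.mp hc').2
      apply Complex.ext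
      · simp
      · rw [← this]; simp⟩
  have hlam0 : 0 ≤ lam := by rwa [← hlam, Complex.zero_le_real] at hc'
  have hTeq : T = isotropic (resourceState g) (1 - (2 ^ n - 1) * lam) lam := by
    ext x y
    rw [hform', isotropic, Matrix.add_apply, Matrix.smul_apply, Matrix.smul_apply,
      Matrix.sub_apply, ketbra_resourceState, smul_eq_mul, smul_eq_mul, Matrix.one_apply]
    push_cast
    by_cases hxy : x = y
    · subst hxy
      simp only [if_true, sgn_mul_self]
      field_simp
      linear_combination hN
    · simp only [hxy, if_false]
      rw [hlam]
      field_simp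
      linear_combination (sgn (g x) * sgn (g y)) * hN
  refine ⟨1 - (2 ^ n - 1) * lam, lam, hlam0, by ring, hTeq, ?_⟩
  rw [hTeq, fidelity, isotropic]
  rw [Matrix.add_mulVec, Matrix.smul_mulVec, Matrix.smul_mulVec, Matrix.sub_mulVec,
    Matrix.one_mulVec, ketbra, Matrix.vecMulVec_mulVec, resourceState_norm]
  simp only [MulOpposite.op_one, one_smul, sub_self, smul_zero, add_zero, dotProduct_smul,
    resourceState_norm]
  rw [smul_eq_mul, mul_one, Complex.ofReal_re]

lemma ketbra_posSemidef {k : ℕ} (ψ : Bits k → ℂ) : (ketbra ψ).PosSemidef :=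
  Matrix.posSemidef_vecMulVec_self_star ψ

lemma trace_ketbra {k : ℕ} (ψ : Bits k → ℂ) : (ketbra ψ).trace = star ψ ⬝ᵥ ψ := by
  rw [ketbra, Matrix.trace_vecMulVec, dotProduct_comm]

lemma plusState_norm (n : ℕ) : star (plusState n) ⬝ᵥ plusState n = 1 := by
  have : plusState n = resourceState (fun _ => 0) := by
    ext x
    rw [resourceState_apply, sgn_zero, one_mul, plusState]
  rw [this, resourceState_norm]

/-- After twirling, the logical content of the encoded noisy resource state is isotropic around
the ideal resource state, and its fidelity is at least the worst-case fidelity. -/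
theorem twirledState_isotropic {n n' : ℕ} {E : Op n' n} {dev : (Bits n → ZMod 2) → SuperOp n n}
    {encN : SuperOp n n'} {qecN Q : SuperOp n' n'} {Fmin : ℝ} (hE : Eᴴ * E = 1)
    (hdev : DatasetIndependent dev) (henc : IsChannel encN) (hqec : IsChannel qecN)
    (hQ : IsQECProjector E Q)
    (hF : ∀ g, Fmin ≤ fidelity (E *ᵥ resourceState g) (encodedState dev encN qecN Q g))
    (g : Bits n → ZMod 2) :
    ∃ F lam : ℝ, Fmin ≤ F ∧ 0 ≤ lam ∧ F + (2 ^ n - 1) * lam = 1 ∧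
      logicalState E (twirledState E (encodedState dev encN qecN Q) g) =
        isotropic (resourceState g) F lam := by
  obtain ⟨N₁, N₂, hN₁, hN₂, hdev⟩ := hdev
  set φ := encodedState dev encN qecN Q with hφ
  set Λ : SuperOp n n := conjBy Eᴴ ∘ₗ Q ∘ₗ qecN ∘ₗ encN ∘ₗ N₂ with hΛ
  set ρ₀ := N₁ (ketbra (plusState n)) with hρ₀
  have hlog : ∀ G, conjBy Eᴴ (φ G) = Λ (conjBy (qram G) ρ₀) := by
    intro G
    rw [hφ, hΛ, hρ₀, encodedState, hdev]
    rfl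
  have hρ₀p : ρ₀.PosSemidef := hN₁.posSemidef (ketbra_posSemidef _)
  have hρ₀t : ρ₀.trace = 1 := by rw [hN₁.trace, trace_ketbra, plusState_norm]
  have hqu : ∀ G : Bits n → ZMod 2, (qram G)ᴴ * qram G = 1 := by
    intro G
    rw [qram, Matrix.diagonal_conjTranspose, Matrix.diagonal_mul_diagonal, ← Matrix.diagonal_one]
    congr 1
    ext x
    rw [Pi.star_apply, star_sgn, sgn_mul_self]
  have hφp : ∀ G, (conjBy Eᴴ (φ G)).PosSemidef := by
    intro G
    refine Matrix.PosSemidef.mul_mul_conjTranspose_same ?_ _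
    rw [hφ, encodedState, hdev]
    exact hQ.1.posSemidef (hqec.posSemidef (henc.posSemidef (hN₂.posSemidef
      (hρ₀p.mul_mul_conjTranspose_same _))))
  have hφt : ∀ G, (conjBy Eᴴ (φ G)).trace = 1 := by
    intro G
    have h1 : (φ G).trace = 1 := by
      rw [hφ, encodedState, hdev, hQ.1.trace, hqec.trace, henc.trace]
      rw [LinearMap.comp_apply, LinearMap.comp_apply, hN₂.trace, trace_conjBy (hqu G)]
      exact hρ₀t
    -- Decoding by `Eᴴ` preserves the trace only on operators supported in the codespace, which is
    -- where the QEC projector puts the state.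
    obtain ⟨τ, hτ⟩ := hQ.2.2 (qecN (encN (dev G (ketbra (plusState n)))))
    have h2 : φ G = conjBy E τ := hτ
    rw [h2, conjBy_conjBy, hE, conjBy_one, ← trace_conjBy hE τ, ← h2, h1]
  set T := logicalState E (twirledState E φ g) with hT
  have hTsum : T = ((twirlSet n).card : ℂ)⁻¹ • ∑ c ∈ twirlSet n,
      conjBy (twirlGate c) (conjBy Eᴴ (φ (twirlTable g c))) := by
    rw [hT, logicalState, twirledState, map_smul, map_sum]
    congr 1
    refine Finset.sum_congr rfl fun c _ => ?_
    rw [conjBy_conjBy, conjBy_conjBy]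
    congr 2
    rw [← Matrix.mul_assoc, ← Matrix.mul_assoc, hE, Matrix.one_mul]
  have hcard : ((twirlSet n).card : ℂ) ≠ 0 := by
    exact_mod_cast (Finset.card_pos.mpr (twirlSet_nonempty n)).ne'
  have hTp : T.PosSemidef := by
    rw [hTsum]
    refine Matrix.PosSemidef.smul (Matrix.posSemidef_sum _ fun c _ =>
      (hφp _).mul_mul_conjTranspose_same _) ?_
    rw [show ((twirlSet n).card : ℂ)⁻¹ = ((((twirlSet n).card : ℝ)⁻¹ : ℝ) : ℂ) by push_cast; rfl,
      Complex.zero_le_real]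
    positivity
  have hTt : T.trace = 1 := by
    rw [hTsum, Matrix.trace_smul, Matrix.trace_sum, Finset.sum_congr rfl fun c hc => by
      rw [trace_conjBy (twirlGate_unitary (mem_unitSet_of_mem_twirlSet hc)), hφt]]
    simp [hcard]
  obtain ⟨d, c, hform⟩ := exists_twirl_form Λ ρ₀ g
  have hform' : ∀ x y, T x y = sgn (g x) * sgn (g y) * if x = y then d else c := by
    intro x y
    rw [← hform, hTsum]
    simp only [hlog]
  obtain ⟨F, lam, h0, h1, h2, h3⟩ := isotropic_of_form g hTp hTt hform'
  refine ⟨F, lam, ?_, h0, h1, h2⟩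
  rw [h3, hTsum]
  rw [show ((twirlSet n).card : ℂ)⁻¹ = ((((twirlSet n).card : ℝ)⁻¹ : ℝ) : ℂ) by push_cast; rfl,
    fidelity_smul, fidelity_sum]
  have hle : ∑ c ∈ twirlSet n, Fmin ≤ ∑ c ∈ twirlSet n, fidelity (resourceState g)
      (conjBy (twirlGate c) (conjBy Eᴴ (φ (twirlTable g c)))) := by
    refine Finset.sum_le_sum fun c hc => ?_
    have hu := twirlGate_unitary (mem_unitSet_of_mem_twirlSet hc)
    -- Each term of the twirl has, with respect to `g`, the fidelity that the device has on the
    -- table `g_C`, so the worst-case bound applies to every term.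
    have hinv : (twirlGate c)ᴴ *ᵥ resourceState g = resourceState (twirlTable g c) := by
      rw [← twirlGate_resourceState g (mem_unitSet_of_mem_twirlSet hc), Matrix.mulVec_mulVec, hu,
        Matrix.one_mulVec]
    rw [fidelity_conjBy, fidelity_conjBy, Matrix.conjTranspose_conjTranspose, hinv]
    exact hF _
  rw [Finset.sum_const, nsmul_eq_mul] at hle
  have hpos : (0 : ℝ) < (twirlSet n).card := by
    exact_mod_cast Finset.card_pos.mpr (twirlSet_nonempty n)
  rw [le_inv_mul_iff₀ hpos]
  exact hle

end

noncomputable section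

open scoped ComplexOrder

/-! ### Trace distance -/

open Module InnerProductSpace in
-- Here `P` is the absolute value of `M`. An eigenvector of `Mᴴ M = P²` with eigenvalue `s²` is an
-- eigenvector of the positive `P` with eigenvalue `s`, so the trace of `P` in this basis dominates
-- the sum of the singular values.
lemma traceNorm_le_of_abs {k : ℕ} {M P : Op k k} (hP : P.PosSemidef) (h : Mᴴ * M = P * P) :
    traceNorm M ≤ P.trace.re := by
  set T := Matrix.toEuclideanLin M with hT
  set A := Matrix.toEuclideanLin P with hA
  have hn : finrank ℂ (EuclideanSpace ℂ (Bits k)) = Fintype.card (Bits k) :=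
    finrank_euclideanSpace
  have hadj : LinearMap.adjoint T ∘ₗ T = A ∘ₗ A := by
    rw [hT, ← Matrix.toEuclideanLin_conjTranspose_eq_adjoint]
    ext v : 1
    simp only [LinearMap.comp_apply, hA, Matrix.toLpLin_apply, Matrix.mulVec_mulVec, h]
  have hApos : A.IsPositive := Matrix.isPositive_toEuclideanLin_iff.mpr hP
  set b := T.isSymmetric_adjoint_comp_self.eigenvectorBasis hn with hb
  have key : ∀ i : Fin (Fintype.card (Bits k)), T.singularValues i ≤ RCLike.re (inner ℂ (b i) (A (b i))) := by
    intro i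
    set s := T.singularValues i with hs
    have hs0 : 0 ≤ s := T.singularValues_nonneg i
    have heig : A (A (b i)) = ((s ^ 2 : ℝ) : ℂ) • b i := by
      have h1 := (T.isSymmetric_adjoint_comp_self.hasEigenvector_eigenvectorBasis hn i).apply_eq_smul
      rw [hs, T.sq_singularValues_fin hn, ← LinearMap.comp_apply, ← hadj]
      exact h1
    have hnn := hApos.re_inner_nonneg_right (b i)
    rcases hs0.eq_or_lt with h0 | hpos
    · rw [← h0]; exact hnn
    -- Since `(A + s)(A - s)` kills `b i`, the vector `w` would be an eigenvector of `A` with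
    -- eigenvalue `-s < 0`, unless it vanishes.
    set w := A (b i) - (s : ℂ) • b i with hw
    have hAw : A w = -((s : ℂ) • w) := by
      rw [hw, map_sub, map_smul, heig, smul_sub, smul_smul]
      push_cast
      rw [← sq]
      abel
    have h2 := hApos.re_inner_nonneg_right w
    rw [hAw, inner_neg_right, inner_smul_right, inner_self_eq_norm_sq_to_K] at h2
    have hw0 : w = 0 := by
      have h3 : s * ‖w‖ ^ 2 ≤ 0 := by
        have : RCLike.re (-((s : ℂ) * ((‖w‖ : ℂ)) ^ 2)) = -(s * ‖w‖ ^ 2) := by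
          rw [← Complex.ofReal_pow, ← Complex.ofReal_mul, ← Complex.ofReal_neg]
          exact Complex.ofReal_re _
        have h4 : 0 ≤ -(s * ‖w‖ ^ 2) := by rw [← this]; exact h2
        linarith
      have h5 : ‖w‖ ^ 2 ≤ 0 := by
        by_contra hcon
        push Not at hcon
        exact absurd h3 (not_le.mpr (mul_pos hpos hcon))
      have h6 : ‖w‖ = 0 := by
        have := sq_nonneg ‖w‖
        exact pow_eq_zero_iff (two_ne_zero) |>.mp (le_antisymm h5 this)
      exact norm_eq_zero.mp h6
    have h7 : A (b i) = (s : ℂ) • b i := sub_eq_zero.mp hw0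
    rw [h7, inner_smul_right, inner_self_eq_norm_sq_to_K, b.orthonormal.1 i]
    simp
  have htr : P.trace = ∑ i, inner ℂ (b i) (A (b i)) := by
    rw [← LinearMap.trace_eq_sum_inner A b, hA]
    exact (Matrix.trace_toLin_eq P (PiLp.basisFun 2 ℂ (Bits k))).symm
  rw [traceNorm, Finset.sum_range, htr, Complex.re_sum]
  exact Finset.sum_le_sum fun i _ => key i

lemma ketbra_mul_self {k : ℕ} {ψ : Bits k → ℂ} (hψ : star ψ ⬝ᵥ ψ = 1) :
    ketbra ψ * ketbra ψ = ketbra ψ := by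
  rw [ketbra, Matrix.vecMulVec_mul_vecMulVec, hψ, one_smul]

lemma ketbra_conjTranspose {k : ℕ} (ψ : Bits k → ℂ) : (ketbra ψ)ᴴ = ketbra ψ :=
  (ketbra_posSemidef ψ).isHermitian

lemma one_sub_ketbra_posSemidef {k : ℕ} {ψ : Bits k → ℂ} (hψ : star ψ ⬝ᵥ ψ = 1) :
    (1 - ketbra ψ).PosSemidef := by
  have h : (1 - ketbra ψ) = (1 - ketbra ψ)ᴴ * (1 - ketbra ψ) := by
    rw [Matrix.conjTranspose_sub, Matrix.conjTranspose_one, ketbra_conjTranspose, Matrix.sub_mul,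
      Matrix.one_mul, Matrix.mul_sub, Matrix.mul_one, ketbra_mul_self hψ, sub_self, sub_zero]
  rw [h]
  exact Matrix.posSemidef_conjTranspose_mul_self _

lemma conjBy_ketbra {k l : ℕ} (E : Op l k) (ψ : Bits k → ℂ) :
    conjBy E (ketbra ψ) = ketbra (E *ᵥ ψ) := by
  rw [conjBy_apply, ketbra, ketbra, Matrix.mul_vecMulVec, Matrix.vecMulVec_mul, Matrix.star_mulVec]

lemma conjBy_mul_conjBy {k l : ℕ} {E : Op l k} (hE : Eᴴ * E = 1) (σ τ : Op k k) :
    conjBy E σ * conjBy E τ = conjBy E (σ * τ) := by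
  simp only [conjBy_apply]
  calc E * σ * Eᴴ * (E * τ * Eᴴ) = E * σ * (Eᴴ * E) * τ * Eᴴ := by simp only [Matrix.mul_assoc]
    _ = E * (σ * τ) * Eᴴ := by rw [hE, Matrix.mul_one]; simp only [Matrix.mul_assoc]

lemma trace_isotropic {n : ℕ} {ψ : Bits n → ℂ} (hψ : star ψ ⬝ᵥ ψ = 1) (F lam : ℝ) :
    (isotropic ψ F lam).trace = ((F + (2 ^ n - 1) * lam : ℝ) : ℂ) := by
  rw [isotropic, Matrix.trace_add, Matrix.trace_smul, Matrix.trace_smul, Matrix.trace_sub,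
    trace_ketbra, hψ, Matrix.trace_one, card_bits]
  push_cast
  simp only [smul_eq_mul]
  ring

/-- The trace distance from a pure encoded state to an isotropic state around it. -/
lemma traceDist_isotropic {n n' : ℕ} {E : Op n' n} (hE : Eᴴ * E = 1) {ψ : Bits n → ℂ}
    (hψ : star ψ ⬝ᵥ ψ = 1) {α lam : ℝ} (hlam : 0 ≤ lam) (h : α + (2 ^ n - 1) * lam = 1) :
    traceDist (ketbra (E *ᵥ ψ)) (conjBy E (isotropic ψ α lam)) ≤ 1 - α := by
  have hN : (1 : ℝ) ≤ 2 ^ n := one_le_pow₀ (by norm_num)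
  have hα : 0 ≤ 1 - α := by nlinarith
  set D : Op n n := ((1 - α : ℝ) : ℂ) • ketbra ψ - (lam : ℂ) • (1 - ketbra ψ) with hD
  set P : Op n n := isotropic ψ (1 - α) lam with hP
  have hM : ketbra (E *ᵥ ψ) - conjBy E (isotropic ψ α lam) = conjBy E D := by
    rw [← conjBy_ketbra, ← map_sub, hD, isotropic]
    congr 1
    push_cast
    module
  have hPp : P.PosSemidef := by
    refine ((ketbra_posSemidef ψ).smul ?_).add ((one_sub_ketbra_posSemidef hψ).smul ?_)
    · exact Complex.zero_le_real.mpr hα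
    · exact Complex.zero_le_real.mpr hlam
  have hDP : Dᴴ * D = P * P := by
    have hDh : Dᴴ = D := by
      rw [hD]
      simp [Matrix.conjTranspose_sub, Matrix.conjTranspose_smul, ketbra_conjTranspose]
    rw [hDh, hD, hP, isotropic]
    simp only [Matrix.sub_mul, Matrix.mul_sub, Matrix.add_mul, Matrix.mul_add, Matrix.smul_mul,
      Matrix.mul_smul, Matrix.one_mul, Matrix.mul_one, ketbra_mul_self hψ, sub_self, smul_zero,
      sub_zero, add_zero]
    simp
  have hle := traceNorm_le_of_abs (M := conjBy E D) (P := conjBy E P)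
    (hPp.mul_mul_conjTranspose_same E) (by
      have : (conjBy E D)ᴴ = conjBy E Dᴴ := by
        simp only [conjBy_apply, Matrix.conjTranspose_mul, Matrix.conjTranspose_conjTranspose,
          Matrix.mul_assoc]
      rw [this, conjBy_mul_conjBy hE, conjBy_mul_conjBy hE, hDP])
  rw [trace_conjBy hE, hP, trace_isotropic hψ, Complex.ofReal_re] at hle
  rw [traceDist, hM]
  linarith

end

noncomputable section

open scoped ComplexOrder

/-! ### A memory of two registers, each a qubit followed by `n` qubits -/

/-- Number of qubits of the memory. -/
abbrev memSize (n : ℕ) : ℕ := n + 1 + (n + 1)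

/-- The first register: control qubit and data. -/
def regA (n : ℕ) : Fin (n + 1) ↪ Fin (memSize n) := Fin.castAddEmb (n + 1)

/-- The second register: coin qubit and program. -/
def regB (n : ℕ) : Fin (n + 1) ↪ Fin (memSize n) := Fin.natAddEmb (n + 1)

/-- The control qubit. -/
def ctrlQ (n : ℕ) : Fin (memSize n) := regA n 0

/-- The coin qubit. -/
def coinQ (n : ℕ) : Fin (memSize n) := regB n 0

/-- The data register. -/
def dataR (n : ℕ) : Fin n ↪ Fin (memSize n) := (Fin.succEmb n).trans (regA n)

/-- The program register. -/
def progR (n : ℕ) : Fin n ↪ Fin (memSize n) := (Fin.succEmb n).trans (regB n)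

variable {n : ℕ}

lemma regA_apply (j : Fin (n + 1)) : regA n j = Fin.castAdd (n + 1) j := rfl

lemma regB_apply (j : Fin (n + 1)) : regB n j = Fin.natAdd (n + 1) j := rfl

lemma regA_ne_regB (i j : Fin (n + 1)) : regA n i ≠ regB n j := by
  rw [regA_apply, regB_apply]
  intro h
  have := congrArg Fin.val h
  simp only [Fin.val_castAdd, Fin.val_natAdd] at this
  omega

lemma bits_ext {y x : Bits (memSize n)} (hA : y ∘ regA n = x ∘ regA n)
    (hB : y ∘ regB n = x ∘ regB n) : y = x := by
  funext i
  refine Fin.addCases (fun j => ?_) (fun j => ?_) i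
  · exact congrFun hA j
  · exact congrFun hB j

/-- The memory content with the given contents of the two registers. -/
def joinBits (a b : Bits (n + 1)) : Bits (memSize n) := Fin.append a b

lemma joinBits_regA (a b : Bits (n + 1)) : joinBits a b ∘ regA n = a := by
  funext j; exact Fin.append_left a b j

lemma joinBits_regB (a b : Bits (n + 1)) : joinBits a b ∘ regB n = b := by
  funext j; exact Fin.append_right a b j

lemma sum_bits_succ {M : Type*} [AddCommMonoid M] (f : Bits (n + 1) → M) :
    ∑ a, f a = ∑ b : ZMod 2, ∑ z : Bits n, f (Fin.cons b z : Bits (n + 1)) := by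
  rw [← (Fin.consEquiv fun _ : Fin (n + 1) => ZMod 2).sum_comp, Fintype.sum_prod_type]
  rfl

lemma sum_bits_mem {M : Type*} [AddCommMonoid M] (f : Bits (memSize n) → M) :
    ∑ y, f y = ∑ a : Bits (n + 1), ∑ b : Bits (n + 1), f (joinBits a b) := by
  rw [← Fintype.sum_prod_type' (f := fun a b => f (joinBits a b))]
  refine (Function.Bijective.sum_comp (e := fun p : Bits (n + 1) × Bits (n + 1) =>
    joinBits p.1 p.2) ?_ f).symm
  refine Function.bijective_iff_has_inverse.mpr
    ⟨fun y => (y ∘ regA n, y ∘ regB n), fun p => ?_, fun y => ?_⟩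
  · simp [joinBits_regA, joinBits_regB]
  · exact bits_ext (joinBits_regA _ _) (joinBits_regB _ _)

/-- Product of an operator on a qubit and an operator on `n` qubits. -/
def joint (A : Matrix (ZMod 2) (ZMod 2) ℂ) (χ : Op n n) : Op (n + 1) (n + 1) :=
  fun a b => A (a 0) (b 0) * χ (a ∘ Fin.succ) (b ∘ Fin.succ)

/-- Product of operators on the two registers. -/
def tens (ω τ : Op (n + 1) (n + 1)) : Op (memSize n) (memSize n) :=
  fun y x => ω (y ∘ regA n) (x ∘ regA n) * τ (y ∘ regB n) (x ∘ regB n)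

lemma cons_comp_succ (b : ZMod 2) (z : Bits n) : (Fin.cons b z : Bits (n + 1)) ∘ Fin.succ = z := by
  funext j; simp

lemma joint_cons (A : Matrix (ZMod 2) (ZMod 2) ℂ) (χ : Op n n) (b b' : ZMod 2) (z z' : Bits n) :
    joint A χ (Fin.cons b z : Bits (n + 1)) (Fin.cons b' z' : Bits (n + 1)) = A b b' * χ z z' := by
  simp only [joint, Fin.cons_zero, cons_comp_succ]

lemma trace_joint (A : Matrix (ZMod 2) (ZMod 2) ℂ) (χ : Op n n) :
    (joint A χ).trace = A.trace * χ.trace := by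
  rw [Matrix.trace, Matrix.trace, Matrix.trace, sum_bits_succ, Finset.sum_mul]
  refine Finset.sum_congr rfl fun b _ => ?_
  rw [Finset.mul_sum]
  exact Finset.sum_congr rfl fun z _ => joint_cons A χ b b z z

lemma joint_mul_joint (A B : Matrix (ZMod 2) (ZMod 2) ℂ) (χ π : Op n n) :
    joint A χ * joint B π = joint (A * B) (χ * π) := by
  ext a b
  rw [Matrix.mul_apply, sum_bits_succ, joint, Matrix.mul_apply, Matrix.mul_apply, Finset.sum_mul]
  refine Finset.sum_congr rfl fun c _ => ?_
  rw [Finset.mul_sum]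
  refine Finset.sum_congr rfl fun z _ => ?_
  simp only [joint, Fin.cons_zero, cons_comp_succ]
  ring

lemma joint_add_left (A B : Matrix (ZMod 2) (ZMod 2) ℂ) (χ : Op n n) :
    joint (A + B) χ = joint A χ + joint B χ := by
  ext a b; simp [joint, add_mul]

lemma joint_add_right (A : Matrix (ZMod 2) (ZMod 2) ℂ) (χ π : Op n n) :
    joint A (χ + π) = joint A χ + joint A π := by
  ext a b; simp [joint, mul_add]

lemma joint_smul_left (c : ℂ) (A : Matrix (ZMod 2) (ZMod 2) ℂ) (χ : Op n n) :
    joint (c • A) χ = c • joint A χ := by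
  ext a b; simp [joint, mul_assoc]

lemma joint_smul_right (c : ℂ) (A : Matrix (ZMod 2) (ZMod 2) ℂ) (χ : Op n n) :
    joint A (c • χ) = c • joint A χ := by
  ext a b; simp [joint, mul_left_comm]

lemma tens_add_left (ω ω' τ : Op (n + 1) (n + 1)) : tens (ω + ω') τ = tens ω τ + tens ω' τ := by
  ext y x; simp [tens, add_mul]

lemma tens_smul_left (c : ℂ) (ω τ : Op (n + 1) (n + 1)) : tens (c • ω) τ = c • tens ω τ := by
  ext y x; simp [tens, mul_assoc]

lemma trace_tens (ω τ : Op (n + 1) (n + 1)) : (tens ω τ).trace = ω.trace * τ.trace := by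
  rw [Matrix.trace, Matrix.trace, Matrix.trace, sum_bits_mem, Finset.sum_mul]
  refine Finset.sum_congr rfl fun b _ => ?_
  rw [Finset.mul_sum]
  refine Finset.sum_congr rfl fun z _ => ?_
  simp only [Matrix.diag_apply, tens, joinBits_regA, joinBits_regB]

/-- The matrix unit `|b⟩⟨b|` of a qubit. -/
def proj (b : ZMod 2) : Matrix (ZMod 2) (ZMod 2) ℂ := Matrix.single b b 1

lemma proj_apply (b i j : ZMod 2) : proj b i j = if i = b ∧ j = b then 1 else 0 := by
  simp [proj, Matrix.single_apply, eq_comm]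

lemma trace_proj (b : ZMod 2) : (proj b).trace = 1 := by
  simp [proj]

/-! ### Additivity of the instructions -/

section additivity

variable {m : ℕ}

lemma measState_add (i : Fin m) (b : ZMod 2) (σ τ : Op m m) :
    Instr.measState i b (σ + τ) = Instr.measState i b σ + Instr.measState i b τ := by
  ext y x
  simp only [Instr.measState, Matrix.add_apply]
  split_ifs <;> simp

end additivity

/-! ### Instructions on product states -/

lemma extend_dataR_regA (z : Bits n) (y : Bits (memSize n)) :
    Function.extend (dataR n) z y ∘ regA n = (Fin.cons (y (ctrlQ n)) z : Bits (n + 1)) := by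
  funext j
  refine Fin.cases ?_ (fun i => ?_) j
  · simp only [Function.comp_apply, Fin.cons_zero]
    rw [Function.extend_apply']
    · rfl
    · rintro ⟨i, hi⟩
      exact (Fin.succ_ne_zero i) ((regA n).injective hi)
  · simp only [Function.comp_apply, Fin.cons_succ]
    exact (dataR n).injective.extend_apply z y i

lemma extend_dataR_regB (z : Bits n) (y : Bits (memSize n)) :
    Function.extend (dataR n) z y ∘ regB n = y ∘ regB n := by
  funext j
  simp only [Function.comp_apply]
  rw [Function.extend_apply']
  rintro ⟨i, hi⟩
  exact regA_ne_regB _ _ hi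

lemma extend_progR_regB (z : Bits n) (y : Bits (memSize n)) :
    Function.extend (progR n) z y ∘ regB n = (Fin.cons (y (coinQ n)) z : Bits (n + 1)) := by
  funext j
  refine Fin.cases ?_ (fun i => ?_) j
  · simp only [Function.comp_apply, Fin.cons_zero]
    rw [Function.extend_apply']
    · rfl
    · rintro ⟨i, hi⟩
      exact (Fin.succ_ne_zero i) ((regB n).injective hi)
  · simp only [Function.comp_apply, Fin.cons_succ]
    exact (progR n).injective.extend_apply z y i

lemma extend_progR_regA (z : Bits n) (y : Bits (memSize n)) :
    Function.extend (progR n) z y ∘ regA n = y ∘ regA n := by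
  funext j
  simp only [Function.comp_apply]
  rw [Function.extend_apply']
  rintro ⟨i, hi⟩
  exact regA_ne_regB _ _ hi.symm

lemma update_ctrlQ_regA (y : Bits (memSize n)) (b : ZMod 2) :
    Function.update y (ctrlQ n) b ∘ regA n = (Fin.cons b (y ∘ dataR n) : Bits (n + 1)) := by
  funext j
  refine Fin.cases ?_ (fun i => ?_) j
  · simp [ctrlQ]
  · simp only [Function.comp_apply, Fin.cons_succ]
    rw [Function.update_of_ne]
    · rfl
    · intro h
      exact Fin.succ_ne_zero i ((regA n).injective h)

lemma update_ctrlQ_regB (y : Bits (memSize n)) (b : ZMod 2) :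
    Function.update y (ctrlQ n) b ∘ regB n = y ∘ regB n := by
  funext j
  simp only [Function.comp_apply]
  rw [Function.update_of_ne]
  exact (regA_ne_regB _ _).symm

lemma update_coinQ_regB (y : Bits (memSize n)) (b : ZMod 2) :
    Function.update y (coinQ n) b ∘ regB n = (Fin.cons b (y ∘ progR n) : Bits (n + 1)) := by
  funext j
  refine Fin.cases ?_ (fun i => ?_) j
  · simp [coinQ]
  · simp only [Function.comp_apply, Fin.cons_succ]
    rw [Function.update_of_ne]
    · rfl
    · intro h
      exact Fin.succ_ne_zero i ((regB n).injective h)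

lemma update_coinQ_regA (y : Bits (memSize n)) (b : ZMod 2) :
    Function.update y (coinQ n) b ∘ regA n = y ∘ regA n := by
  funext j
  simp only [Function.comp_apply]
  rw [Function.update_of_ne]
  exact regA_ne_regB _ _

lemma joint_regA (A : Matrix (ZMod 2) (ZMod 2) ℂ) (χ : Op n n) (y x : Bits (memSize n)) :
    joint A χ (y ∘ regA n) (x ∘ regA n) =
      A (y (ctrlQ n)) (x (ctrlQ n)) * χ (y ∘ dataR n) (x ∘ dataR n) := rfl

lemma joint_regB (A : Matrix (ZMod 2) (ZMod 2) ℂ) (χ : Op n n) (y x : Bits (memSize n)) :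
    joint A χ (y ∘ regB n) (x ∘ regB n) =
      A (y (coinQ n)) (x (coinQ n)) * χ (y ∘ progR n) (x ∘ progR n) := rfl

lemma loadState_dataR (ρ : Op n n) (A : Matrix (ZMod 2) (ZMod 2) ℂ) (χ : Op n n)
    (τ : Op (n + 1) (n + 1)) :
    Instr.loadState ρ (dataR n) (tens (joint A χ) τ) = χ.trace • tens (joint A ρ) τ := by
  ext y x
  simp only [Instr.loadState, tens, Matrix.smul_apply, extend_dataR_regA, extend_dataR_regB,
    joint_cons, joint_regA, Matrix.trace, Matrix.diag_apply, smul_eq_mul, Finset.sum_mul]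
  exact Finset.sum_congr rfl fun z _ => by ring

lemma loadState_progR (ρ : Op n n) (B : Matrix (ZMod 2) (ZMod 2) ℂ) (π : Op n n)
    (ω : Op (n + 1) (n + 1)) :
    Instr.loadState ρ (progR n) (tens ω (joint B π)) = π.trace • tens ω (joint B ρ) := by
  ext y x
  simp only [Instr.loadState, tens, Matrix.smul_apply, extend_progR_regA, extend_progR_regB,
    joint_cons, joint_regB, Matrix.trace, Matrix.diag_apply, smul_eq_mul, Finset.sum_mul]
  exact Finset.sum_congr rfl fun z _ => by ring

lemma prepState_ctrlQ (A : Matrix (ZMod 2) (ZMod 2) ℂ) (χ : Op n n) (τ : Op (n + 1) (n + 1)) :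
    Instr.prepState (ctrlQ n) (tens (joint A χ) τ) = A.trace • tens (joint (proj 0) χ) τ := by
  ext y x
  simp only [Instr.prepState, tens, Matrix.smul_apply, update_ctrlQ_regA, update_ctrlQ_regB,
    joint_cons, joint_regA, Matrix.trace, Matrix.diag_apply, smul_eq_mul, proj_apply]
  split_ifs
  · rw [Finset.sum_mul]
    exact Finset.sum_congr rfl fun z _ => by ring
  · simp

lemma prepState_coinQ (B : Matrix (ZMod 2) (ZMod 2) ℂ) (π : Op n n) (ω : Op (n + 1) (n + 1)) :
    Instr.prepState (coinQ n) (tens ω (joint B π)) = B.trace • tens ω (joint (proj 0) π) := by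
  ext y x
  simp only [Instr.prepState, tens, Matrix.smul_apply, update_coinQ_regA, update_coinQ_regB,
    joint_cons, joint_regB, Matrix.trace, Matrix.diag_apply, smul_eq_mul, proj_apply]
  split_ifs
  · rw [Finset.sum_mul]
    exact Finset.sum_congr rfl fun z _ => by ring
  · simp

lemma measState_ctrlQ (b : ZMod 2) (A : Matrix (ZMod 2) (ZMod 2) ℂ) (χ : Op n n)
    (τ : Op (n + 1) (n + 1)) :
    Instr.measState (ctrlQ n) b (tens (joint A χ) τ) = A b b • tens (joint (proj b) χ) τ := by
  ext y x
  simp only [Instr.measState, tens, Matrix.smul_apply, joint_regA, smul_eq_mul, proj_apply]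
  split_ifs with h
  · rw [h.1, h.2]; ring
  · simp

lemma measState_coinQ (b : ZMod 2) (B : Matrix (ZMod 2) (ZMod 2) ℂ) (π : Op n n)
    (ω : Op (n + 1) (n + 1)) :
    Instr.measState (coinQ n) b (tens ω (joint B π)) = B b b • tens ω (joint (proj b) π) := by
  ext y x
  simp only [Instr.measState, tens, Matrix.smul_apply, joint_regB, smul_eq_mul, proj_apply]
  split_ifs with h
  · rw [h.1, h.2]; ring
  · simp

lemma reducedState_dataR (A : Matrix (ZMod 2) (ZMod 2) ℂ) (χ : Op n n) (τ : Op (n + 1) (n + 1)) :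
    Instr.reducedState (dataR n) (tens (joint A χ) τ) = (A.trace * τ.trace) • χ := by
  ext a b
  simp only [Instr.reducedState]
  rw [sum_bits_mem, sum_bits_succ]
  have hd : ∀ (e : ZMod 2) (z : Bits n) (w : Bits (n + 1)),
      joinBits (Fin.cons e z : Bits (n + 1)) w ∘ dataR n = z := by
    intro e z w
    have := congrArg (fun v => v ∘ Fin.succ) (joinBits_regA (Fin.cons e z : Bits (n + 1)) w)
    rw [cons_comp_succ] at this
    exact this
  have hc : ∀ (e : ZMod 2) (z : Bits n) (w : Bits (n + 1)),
      joinBits (Fin.cons e z : Bits (n + 1)) w (ctrlQ n) = e := by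
    intro e z w
    exact congrFun (joinBits_regA (Fin.cons e z : Bits (n + 1)) w) 0
  simp only [hd, tens, extend_dataR_regA, extend_dataR_regB, joinBits_regA, joinBits_regB,
    joint_cons, hc]
  have hswap : ∀ e : ZMod 2, ∑ z : Bits n, ∑ w : Bits (n + 1),
      (if z = a then A e e * χ z b * τ w w else 0) = A e e * (τ.trace * χ a b) := by
    intro e
    rw [Finset.sum_comm]
    simp only [Finset.sum_ite_eq', Finset.mem_univ, if_true]
    rw [← Finset.mul_sum]
    simp only [Matrix.trace, Matrix.diag_apply]
    ring
  rw [Finset.sum_congr rfl fun e _ => hswap e, ← Finset.sum_mul, Matrix.smul_apply, smul_eq_mul,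
    mul_assoc]
  rfl

lemma sum_onQubit {m : ℕ} (i : Fin m) (U : Matrix (ZMod 2) (ZMod 2) ℂ) (y : Bits m)
    (f : Bits m → ℂ) :
    ∑ z, onQubit i U y z * f z = ∑ b, U (y i) b * f (Function.update y i b) := by
  symm
  refine Fintype.sum_of_injective (fun b => Function.update y i b) ?_ _ _ ?_ ?_
  · intro b b' h
    simpa using congrFun h i
  · intro z hz
    rw [onQubit, if_neg, zero_mul]
    intro h
    refine hz ⟨z i, ?_⟩
    funext j
    by_cases hj : j = i
    · subst hj; simp
    · simp [hj, h j hj]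
  · intro b
    simp only [onQubit, Function.update_self]
    rw [if_pos]
    intro j hj
    simp [hj]

lemma conjBy_onQubit {m : ℕ} (i : Fin m) (U : Matrix (ZMod 2) (ZMod 2) ℂ) (σ : Op m m)
    (y x : Bits m) :
    conjBy (onQubit i U) σ y x = ∑ b, ∑ b', U (y i) b * σ (Function.update y i b)
      (Function.update x i b') * star (U (x i) b') := by
  rw [conjBy_apply, Matrix.mul_assoc, Matrix.mul_apply, sum_onQubit]
  refine Finset.sum_congr rfl fun b _ => ?_
  rw [Matrix.mul_apply]
  have h : ∑ z, σ (Function.update y i b) z * (onQubit i U)ᴴ z x =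
      star (∑ z, onQubit i U x z * star (σ (Function.update y i b) z)) := by
    rw [star_sum]
    refine Finset.sum_congr rfl fun z _ => ?_
    rw [star_mul', star_star, Matrix.conjTranspose_apply, mul_comm]
  rw [h, sum_onQubit, star_sum, Finset.mul_sum]
  refine Finset.sum_congr rfl fun b' _ => ?_
  rw [star_mul', star_star]
  ring

lemma conjBy_onQubit_ctrlQ (U A : Matrix (ZMod 2) (ZMod 2) ℂ) (χ : Op n n)
    (τ : Op (n + 1) (n + 1)) :
    conjBy (onQubit (ctrlQ n) U) (tens (joint A χ) τ) = tens (joint (U * A * Uᴴ) χ) τ := by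
  ext y x
  rw [conjBy_onQubit]
  simp only [tens, update_ctrlQ_regA, update_ctrlQ_regB, joint_cons, joint_regA, Matrix.mul_apply,
    Matrix.conjTranspose_apply, Finset.sum_mul]
  rw [Finset.sum_comm]
  refine Finset.sum_congr rfl fun b _ => Finset.sum_congr rfl fun b' _ => ?_
  ring

lemma conjBy_onQubit_coinQ (U B : Matrix (ZMod 2) (ZMod 2) ℂ) (π : Op n n)
    (ω : Op (n + 1) (n + 1)) :
    conjBy (onQubit (coinQ n) U) (tens ω (joint B π)) = tens ω (joint (U * B * Uᴴ) π) := by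
  ext y x
  rw [conjBy_onQubit]
  simp only [tens, update_coinQ_regA, update_coinQ_regB, joint_cons, joint_regB, Matrix.mul_apply,
    Matrix.conjTranspose_apply, Finset.sum_mul, Finset.mul_sum]
  rw [Finset.sum_comm]
  refine Finset.sum_congr rfl fun b _ => Finset.sum_congr rfl fun b' _ => ?_
  ring

/-! ### Single-qubit gates -/

lemma sum_zmod_two {M : Type*} [AddCommMonoid M] (f : ZMod 2 → M) : ∑ b, f b = f 0 + f 1 :=
  Fin.sum_univ_two f

/-- The `2 × 2` matrix with rows `(a, b)` and `(c, d)`. -/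
def qmat (a b c d : ℂ) : Matrix (ZMod 2) (ZMod 2) ℂ :=
  fun i j => if i = 0 then (if j = 0 then a else b) else if j = 0 then c else d

lemma qmat_ext {A B : Matrix (ZMod 2) (ZMod 2) ℂ} (h00 : A 0 0 = B 0 0) (h01 : A 0 1 = B 0 1)
    (h10 : A 1 0 = B 1 0) (h11 : A 1 1 = B 1 1) : A = B := by
  ext i j
  rcases zmod_two_cases i with rfl | rfl <;> rcases zmod_two_cases j with rfl | rfl <;> assumption

section qmat
variable (a b c d : ℂ)
@[simp] lemma qmat_zero_zero : qmat a b c d 0 0 = a := by simp [qmat]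
@[simp] lemma qmat_zero_one : qmat a b c d 0 1 = b := by simp [qmat]
@[simp] lemma qmat_one_zero : qmat a b c d 1 0 = c := by simp [qmat]
@[simp] lemma qmat_one_one : qmat a b c d 1 1 = d := by simp [qmat]
end qmat

lemma qmat_mul (a b c d a' b' c' d' : ℂ) : qmat a b c d * qmat a' b' c' d' =
    qmat (a * a' + b * c') (a * b' + b * d') (c * a' + d * c') (c * b' + d * d') := by
  apply qmat_ext <;> simp [Matrix.mul_apply, sum_zmod_two]

lemma qmat_conjTranspose (a b c d : ℂ) :
    (qmat a b c d)ᴴ = qmat (star a) (star c) (star b) (star d) := by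
  apply qmat_ext <;> simp [Matrix.conjTranspose_apply]

lemma qmat_one : (1 : Matrix (ZMod 2) (ZMod 2) ℂ) = qmat 1 0 0 1 := by
  apply qmat_ext <;> simp

lemma proj_zero : proj 0 = qmat 1 0 0 0 := by
  apply qmat_ext <;> simp [proj_apply]

lemma proj_one : proj 1 = qmat 0 0 0 1 := by
  apply qmat_ext <;> simp [proj_apply]

lemma trace_qmat (a b c d : ℂ) : (qmat a b c d).trace = a + d := by
  rw [Matrix.trace, sum_zmod_two]; simp

/-- The real rotation with first column `(c, s)`. -/
def rotGate (c s : ℝ) (h : c ^ 2 + s ^ 2 = 1) : Matrix.unitaryGroup (ZMod 2) ℂ :=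
  ⟨qmat c (-s) s c, by
    have h' : (c : ℂ) ^ 2 + (s : ℂ) ^ 2 = 1 := by exact_mod_cast h
    rw [Matrix.mem_unitaryGroup_iff, Matrix.star_eq_conjTranspose, qmat_conjTranspose, qmat_mul,
      qmat_one]
    simp only [star_neg, Complex.star_def, Complex.conj_ofReal]
    congr 1 <;> first | ring1 | linear_combination h'⟩

/-- The gate `exp(-i t X)`. -/
def expXGate (t : ℝ) : Matrix.unitaryGroup (ZMod 2) ℂ :=
  ⟨qmat (Real.cos t) (-Complex.I * Real.sin t) (-Complex.I * Real.sin t) (Real.cos t), by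
    have h' : (Real.cos t : ℂ) ^ 2 + (Real.sin t : ℂ) ^ 2 = 1 := by
      exact_mod_cast Real.cos_sq_add_sin_sq t
    have hI := Complex.I_mul_I
    rw [Matrix.mem_unitaryGroup_iff, Matrix.star_eq_conjTranspose, qmat_conjTranspose, qmat_mul,
      qmat_one]
    simp only [star_mul', star_neg, Complex.star_def, Complex.conj_ofReal, Complex.conj_I]
    congr 1
    · linear_combination h' - (Real.sin t : ℂ) ^ 2 * hI
    · ring
    · ring
    · linear_combination h' - (Real.sin t : ℂ) ^ 2 * hI⟩

lemma inv_sqrt_two_sq : (1 / Real.sqrt 2) ^ 2 + (1 / Real.sqrt 2) ^ 2 = 1 := by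
  rw [div_pow, Real.sq_sqrt (by norm_num)]; norm_num

lemma inv_sqrt_two_sq' : (1 / Real.sqrt 2) ^ 2 + (-(1 / Real.sqrt 2)) ^ 2 = 1 := by
  rw [neg_sq]; exact inv_sqrt_two_sq

/-- The rotation that sends `|0⟩` to `|+⟩`. -/
def plusGate : Matrix.unitaryGroup (ZMod 2) ℂ :=
  rotGate (1 / Real.sqrt 2) (1 / Real.sqrt 2) inv_sqrt_two_sq

/-- The rotation that sends `|+⟩` to `|0⟩`. -/
def unplusGate : Matrix.unitaryGroup (ZMod 2) ℂ :=
  rotGate (1 / Real.sqrt 2) (-(1 / Real.sqrt 2)) inv_sqrt_two_sq'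

/-! ### Fractional swaps -/

section swaps

variable {m k : ℕ}

/-- The permutation of the qubits that exchanges two registers along a list of positions. -/
def swapPerm (r₁ r₂ : Fin k ↪ Fin m) (l : List (Fin k)) : Equiv.Perm (Fin m) :=
  (l.map fun j => Equiv.swap (r₁ j) (r₂ j)).prod

lemma swapPerm_cons (r₁ r₂ : Fin k ↪ Fin m) (j : Fin k) (l : List (Fin k)) :
    swapPerm r₁ r₂ (j :: l) = Equiv.swap (r₁ j) (r₂ j) * swapPerm r₁ r₂ l := by
  simp [swapPerm]

lemma swapPerm_apply {r₁ r₂ : Fin k ↪ Fin m} (disj : ∀ i j, r₁ i ≠ r₂ j) (l : List (Fin k))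
    (hl : l.Nodup) (j : Fin k) :
    (swapPerm r₁ r₂ l (r₁ j) = if j ∈ l then r₂ j else r₁ j) ∧
    (swapPerm r₁ r₂ l (r₂ j) = if j ∈ l then r₁ j else r₂ j) := by
  induction l with
  | nil => simp [swapPerm]
  | cons a l ih =>
    obtain ⟨ih1, ih2⟩ := ih (List.nodup_cons.mp hl).2
    have ha := (List.nodup_cons.mp hl).1
    rw [swapPerm_cons, Equiv.Perm.mul_apply, Equiv.Perm.mul_apply, ih1, ih2]
    by_cases hja : j = a
    · subst hja
      simp [ha]
    · have h1 : r₁ j ≠ r₁ a := fun h => hja (r₁.injective h)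
      have h2 : r₂ j ≠ r₂ a := fun h => hja (r₂.injective h)
      by_cases hjl : j ∈ l
      · simp [hjl, Equiv.swap_apply_of_ne_of_ne, h1, h2, disj, (disj _ _).symm]
      · simp [hjl, hja, Equiv.swap_apply_of_ne_of_ne, h1, h2, disj, (disj _ _).symm]

lemma swapPerm_of_notMem {r₁ r₂ : Fin k ↪ Fin m} (l : List (Fin k)) {i : Fin m}
    (h₁ : ∀ j, i ≠ r₁ j) (h₂ : ∀ j, i ≠ r₂ j) : swapPerm r₁ r₂ l i = i := by
  induction l with
  | nil => simp [swapPerm]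
  | cons a l ih =>
    rw [swapPerm_cons, Equiv.Perm.mul_apply, ih, Equiv.swap_apply_of_ne_of_ne (h₁ a) (h₂ a)]

lemma swapPerm_left {r₁ r₂ : Fin k ↪ Fin m} (disj : ∀ i j, r₁ i ≠ r₂ j) (j : Fin k) :
    swapPerm r₁ r₂ (List.finRange k) (r₁ j) = r₂ j := by
  rw [(swapPerm_apply disj _ (List.nodup_finRange k) j).1, if_pos (List.mem_finRange j)]

lemma swapPerm_right {r₁ r₂ : Fin k ↪ Fin m} (disj : ∀ i j, r₁ i ≠ r₂ j) (j : Fin k) :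
    swapPerm r₁ r₂ (List.finRange k) (r₂ j) = r₁ j := by
  rw [(swapPerm_apply disj _ (List.nodup_finRange k) j).2, if_pos (List.mem_finRange j)]

lemma swapPerm_involutive {r₁ r₂ : Fin k ↪ Fin m} (disj : ∀ i j, r₁ i ≠ r₂ j) :
    Function.Involutive (swapPerm r₁ r₂ (List.finRange k)) := by
  intro i
  by_cases h₁ : ∃ j, i = r₁ j
  · obtain ⟨j, rfl⟩ := h₁
    rw [swapPerm_left disj, swapPerm_right disj]
  · by_cases h₂ : ∃ j, i = r₂ j
    · obtain ⟨j, rfl⟩ := h₂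
      rw [swapPerm_right disj, swapPerm_left disj]
    · push Not at h₁ h₂
      rw [swapPerm_of_notMem _ h₁ h₂, swapPerm_of_notMem _ h₁ h₂]

lemma regSwap_apply {r₁ r₂ : Fin k ↪ Fin m} (y x : Bits m) :
    regSwap r₁ r₂ y x = if y = x ∘ swapPerm r₁ r₂ (List.finRange k) then 1 else 0 := rfl

lemma eq_comp_swapPerm_comm {r₁ r₂ : Fin k ↪ Fin m} (disj : ∀ i j, r₁ i ≠ r₂ j) (y x : Bits m) :
    y = x ∘ swapPerm r₁ r₂ (List.finRange k) ↔ x = y ∘ swapPerm r₁ r₂ (List.finRange k) := by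
  constructor <;>
  · rintro rfl
    funext i
    simp [(swapPerm_involutive disj) i]

lemma mul_regSwap {r₁ r₂ : Fin k ↪ Fin m} (X : Op m m) (y x : Bits m) :
    (X * regSwap r₁ r₂) y x = X y (x ∘ swapPerm r₁ r₂ (List.finRange k)) := by
  simp [Matrix.mul_apply, regSwap_apply]

lemma regSwap_mul {r₁ r₂ : Fin k ↪ Fin m} (disj : ∀ i j, r₁ i ≠ r₂ j) (X : Op m m)
    (y x : Bits m) :
    (regSwap r₁ r₂ * X) y x = X (y ∘ swapPerm r₁ r₂ (List.finRange k)) x := by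
  simp [Matrix.mul_apply, regSwap_apply, eq_comp_swapPerm_comm disj y]

lemma regSwap_mul_self {r₁ r₂ : Fin k ↪ Fin m} (disj : ∀ i j, r₁ i ≠ r₂ j) :
    regSwap r₁ r₂ * regSwap r₁ r₂ = 1 := by
  ext y x
  rw [mul_regSwap, regSwap_apply, Matrix.one_apply]
  congr 1
  rw [Function.comp_assoc, (swapPerm_involutive disj).comp_self, Function.comp_id]

lemma regSwap_conjTranspose {r₁ r₂ : Fin k ↪ Fin m} (disj : ∀ i j, r₁ i ≠ r₂ j) :
    (regSwap r₁ r₂)ᴴ = regSwap r₁ r₂ := by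
  ext y x
  rw [Matrix.conjTranspose_apply, regSwap_apply, regSwap_apply]
  simp only [eq_comp_swapPerm_comm disj y x]
  split_ifs <;> simp

lemma fracSwap_conjTranspose {r₁ r₂ : Fin k ↪ Fin m} (disj : ∀ i j, r₁ i ≠ r₂ j) (t : ℝ) :
    (fracSwap t r₁ r₂)ᴴ = (Real.cos t : ℂ) • (1 : Op m m) +
      (Complex.I * (Real.sin t : ℂ)) • regSwap r₁ r₂ := by
  rw [fracSwap, Matrix.conjTranspose_sub, Matrix.conjTranspose_smul, Matrix.conjTranspose_smul,
    Matrix.conjTranspose_one, regSwap_conjTranspose disj]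
  simp only [star_mul', Complex.star_def, Complex.conj_ofReal, Complex.conj_I]
  module

lemma fracSwap_unitary {r₁ r₂ : Fin k ↪ Fin m} (disj : ∀ i j, r₁ i ≠ r₂ j) (t : ℝ) :
    (fracSwap t r₁ r₂)ᴴ * fracSwap t r₁ r₂ = 1 := by
  have h' : (Real.cos t : ℂ) ^ 2 + (Real.sin t : ℂ) ^ 2 = 1 := by
    exact_mod_cast Real.cos_sq_add_sin_sq t
  rw [fracSwap_conjTranspose disj, fracSwap]
  simp only [Matrix.add_mul, Matrix.mul_sub, Matrix.smul_mul, Matrix.mul_smul, Matrix.one_mul,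
    Matrix.mul_one, regSwap_mul_self disj]
  match_scalars
  · push_cast at h' ⊢
    linear_combination h' - (Complex.sin t) ^ 2 * Complex.I_mul_I
  · ring

lemma conjBy_fracSwap {r₁ r₂ : Fin k ↪ Fin m} (disj : ∀ i j, r₁ i ≠ r₂ j) (t : ℝ) (X : Op m m)
    (y x : Bits m) :
    conjBy (fracSwap t r₁ r₂) X y x =
      (Real.cos t : ℂ) ^ 2 * X y x + (Real.sin t : ℂ) ^ 2 *
        X (y ∘ swapPerm r₁ r₂ (List.finRange k)) (x ∘ swapPerm r₁ r₂ (List.finRange k)) +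
      Complex.I * Real.sin t * Real.cos t *
        (X y (x ∘ swapPerm r₁ r₂ (List.finRange k)) -
          X (y ∘ swapPerm r₁ r₂ (List.finRange k)) x) := by
  rw [conjBy_apply, fracSwap_conjTranspose disj, fracSwap]
  simp only [Matrix.sub_mul, Matrix.mul_add, Matrix.smul_mul, Matrix.mul_smul, Matrix.one_mul,
    Matrix.mul_one, Matrix.add_apply, Matrix.sub_apply, Matrix.smul_apply, smul_eq_mul,
    mul_regSwap, regSwap_mul disj]
  linear_combination (-(Real.sin t : ℂ) ^ 2 *
    X (y ∘ swapPerm r₁ r₂ (List.finRange k)) (x ∘ swapPerm r₁ r₂ (List.finRange k))) *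
    Complex.I_mul_I

/-- The controlled swaps of the qubits of two registers, controlled by the helper qubit. -/
def cswapList (r₁ r₂ : Fin k ↪ Fin m) (disj : ∀ i j, r₁ i ≠ r₂ j) (l : List (Fin k)) :
    List (Gate (m + 1)) :=
  l.map fun j => Gate.cswap 0 (r₁ j).succ (r₂ j).succ (Fin.succ_ne_zero _).symm
    (Fin.succ_ne_zero _).symm (fun h => disj j j (Fin.succ_injective _ h))

lemma circuitOp_append {m : ℕ} (L₁ L₂ : List (Gate m)) :
    circuitOp (L₁ ++ L₂) = circuitOp L₂ * circuitOp L₁ := by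
  induction L₁ with
  | nil => simp [circuitOp]
  | cons G L ih => simp [circuitOp, ih, Matrix.mul_assoc]

lemma cons_comp_swap (b : ZMod 2) (x : Bits m) (i j : Fin m) :
    (Fin.cons b x : Bits (m + 1)) ∘ Equiv.swap i.succ j.succ =
      (Fin.cons b (x ∘ Equiv.swap i j) : Bits (m + 1)) := by
  funext p
  refine Fin.cases ?_ (fun q => ?_) p
  · simp [Equiv.swap_apply_of_ne_of_ne, (Fin.succ_ne_zero _).symm]
  · simp only [Function.comp_apply, Fin.cons_succ]
    rw [(Fin.succ_injective m).swap_apply, Fin.cons_succ]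

lemma circuitOp_cswapList {r₁ r₂ : Fin k ↪ Fin m} (disj : ∀ i j, r₁ i ≠ r₂ j) (l : List (Fin k))
    (b : ZMod 2) (x : Bits m) (Y : Bits (m + 1)) :
    circuitOp (cswapList r₁ r₂ disj l) Y (Fin.cons b x : Bits (m + 1)) =
      if Y = (Fin.cons b (if b = 1 then x ∘ swapPerm r₁ r₂ l else x) : Bits (m + 1))
        then 1 else 0 := by
  induction l generalizing x with
  | nil => simp [cswapList, circuitOp, swapPerm, Matrix.one_apply]
  | cons a l ih =>
    have h : circuitOp (cswapList r₁ r₂ disj (a :: l)) Y (Fin.cons b x : Bits (m + 1)) =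
        circuitOp (cswapList r₁ r₂ disj l) Y
          (Fin.cons b (if b = 1 then x ∘ Equiv.swap (r₁ a) (r₂ a) else x) : Bits (m + 1)) := by
      rw [cswapList, List.map_cons, circuitOp, Matrix.mul_apply]
      simp only [Gate.toOp, Fin.cons_zero, mul_ite, mul_one, mul_zero, Finset.sum_ite_eq',
        Finset.mem_univ, if_true, cons_comp_swap]
      split_ifs <;> rfl
    rw [h, ih]
    split_ifs <;> simp_all [swapPerm_cons, Function.comp_assoc]

lemma circuitOp_cswapList_finRange {r₁ r₂ : Fin k ↪ Fin m} (disj : ∀ i j, r₁ i ≠ r₂ j) :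
    circuitOp (cswapList r₁ r₂ disj (List.finRange k)) =
      joint (proj 0) 1 + joint (proj 1) (regSwap r₁ r₂) := by
  ext Y X
  obtain ⟨b, x, rfl⟩ : ∃ b x, X = (Fin.cons b x : Bits (m + 1)) :=
    ⟨X 0, X ∘ Fin.succ, (Fin.cons_self_tail X).symm⟩
  obtain ⟨c, y, rfl⟩ : ∃ b x, Y = (Fin.cons b x : Bits (m + 1)) :=
    ⟨Y 0, Y ∘ Fin.succ, (Fin.cons_self_tail Y).symm⟩
  rw [circuitOp_cswapList, Matrix.add_apply, joint_cons, joint_cons, proj_apply, proj_apply,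
    regSwap_apply, Matrix.one_apply]
  simp only [Fin.cons_inj]
  rcases zmod_two_cases b with rfl | rfl <;> rcases zmod_two_cases c with rfl | rfl <;> simp

lemma onQubit_zero (U : Matrix (ZMod 2) (ZMod 2) ℂ) :
    onQubit (0 : Fin (m + 1)) U = joint U 1 := by
  ext Y X
  rw [onQubit, joint, Matrix.one_apply]
  have : (∀ j, j ≠ 0 → Y j = X j) ↔ Y ∘ Fin.succ = X ∘ Fin.succ := by
    constructor
    · intro h; funext j; exact h j.succ (Fin.succ_ne_zero j)
    · intro h j hj
      obtain ⟨i, rfl⟩ := Fin.exists_succ_eq.mpr hj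
      exact congrFun h i
  simp only [this]
  split_ifs <;> simp

/-- A circuit for the fractional swap of two registers. -/
def fracSwapCircuit (t : ℝ) (r₁ r₂ : Fin k ↪ Fin m) (disj : ∀ i j, r₁ i ≠ r₂ j) :
    List (Gate (m + 1)) :=
  [Gate.single 0 plusGate] ++ (cswapList r₁ r₂ disj (List.finRange k) ++
    ([Gate.single 0 (expXGate t)] ++ (cswapList r₁ r₂ disj (List.finRange k) ++
      [Gate.single 0 unplusGate])))

/-- Between two controlled swaps, `exp(-i t X)` on the helper becomes `cos t - i sin t X ⊗ 𝕊`. The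
helper is in `|+⟩`, where `X` acts as 1, so the memory undergoes the fractional swap and the helper
is left unentangled. -/
lemma fracSwapCircuit_implements (t : ℝ) {r₁ r₂ : Fin k ↪ Fin m} (disj : ∀ i j, r₁ i ≠ r₂ j) :
    Implements (fracSwapCircuit t r₁ r₂ disj) (fracSwap t r₁ r₂) := by
  intro y x b
  have hs : ∀ U : Matrix.unitaryGroup (ZMod 2) ℂ,
      circuitOp [Gate.single (0 : Fin (m + 1)) U] = joint U.1 1 := by
    intro U
    simp [circuitOp, Gate.toOp, onQubit_zero]
  have hh : ((1 / Real.sqrt 2 : ℝ) : ℂ) * ((1 / Real.sqrt 2 : ℝ) : ℂ) = 1 / 2 := by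
    rw [← Complex.ofReal_mul, div_mul_div_comm, Real.mul_self_sqrt (by norm_num)]
    norm_num
  rw [fracSwapCircuit]
  simp only [circuitOp_append, hs, circuitOp_cswapList_finRange]
  set h : ℂ := ((1 / Real.sqrt 2 : ℝ) : ℂ) with hdef
  simp only [Matrix.add_mul, Matrix.mul_add, joint_mul_joint, Matrix.one_mul, Matrix.mul_one,
    regSwap_mul_self disj, proj_zero, proj_one, plusGate, unplusGate, rotGate, expXGate, qmat_mul,
    Matrix.add_apply, joint_cons, fracSwap, Matrix.sub_apply, Matrix.smul_apply, smul_eq_mul]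
  rw [Complex.ofReal_neg, ← hdef]
  generalize (1 : Op m m) y x = e
  generalize regSwap r₁ r₂ y x = f
  rcases zmod_two_cases b with rfl | rfl
  · simp only [qmat_zero_zero, if_true]
    linear_combination (2 * Real.cos t * e - 2 * Complex.I * Real.sin t * f) * hh
  · simp only [qmat_one_zero, one_ne_zero, if_false]
    ring

lemma singles_fracSwapCircuit (t : ℝ) {r₁ r₂ : Fin k ↪ Fin m} (disj : ∀ i j, r₁ i ≠ r₂ j) :
    ((fracSwapCircuit t r₁ r₂ disj).map Gate.singles).sum = 3 := by
  simp [fracSwapCircuit, cswapList, Gate.singles, Function.comp_def]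

lemma cswaps_fracSwapCircuit (t : ℝ) {r₁ r₂ : Fin k ↪ Fin m} (disj : ∀ i j, r₁ i ≠ r₂ j) :
    ((fracSwapCircuit t r₁ r₂ disj).map Gate.cswaps).sum = 2 * k := by
  simp [fracSwapCircuit, cswapList, Gate.cswaps, Function.comp_def]
  ring

end swaps

/-! ### The effect of one fractional swap with a fresh program -/

lemma comp_swapPerm_regA (y : Bits (memSize n)) :
    (y ∘ swapPerm (regA n) (regB n) (List.finRange (n + 1))) ∘ regA n = y ∘ regB n := by
  funext j
  simp [swapPerm_left regA_ne_regB]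

lemma comp_swapPerm_regB (y : Bits (memSize n)) :
    (y ∘ swapPerm (regA n) (regB n) (List.finRange (n + 1))) ∘ regB n = y ∘ regA n := by
  funext j
  simp [swapPerm_right regA_ne_regB]

/-- Reloading the program and resetting the coin together discard the whole second register,
whatever its entanglement with the first. -/
lemma prep_load_apply (ρ : Op n n) (X : Op (memSize n) (memSize n)) (y x : Bits (memSize n)) :
    Instr.prepState (coinQ n) (Instr.loadState ρ (progR n) X) y x =
      joint (proj 0) ρ (y ∘ regB n) (x ∘ regB n) *
        ∑ w : Bits (n + 1), X (joinBits (y ∘ regA n) w) (joinBits (x ∘ regA n) w) := by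
  have hext : ∀ (v : Bits (memSize n)) (b : ZMod 2) (z : Bits n),
      Function.extend (progR n) z (Function.update v (coinQ n) b) =
        joinBits (v ∘ regA n) (Fin.cons b z : Bits (n + 1)) := by
    intro v b z
    refine bits_ext ?_ ?_
    · rw [extend_progR_regA, update_coinQ_regA, joinBits_regA]
    · rw [extend_progR_regB, joinBits_regB, Function.update_self]
  have hprog : ∀ (v : Bits (memSize n)) (b : ZMod 2),
      Function.update v (coinQ n) b ∘ progR n = v ∘ progR n := by
    intro v b
    have := congrArg (fun w => w ∘ Fin.succ) (update_coinQ_regB v b)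
    rw [cons_comp_succ] at this
    exact this
  simp only [Instr.prepState, Instr.loadState, hext, hprog]
  rw [joint_regB, proj_apply, sum_bits_succ]
  split_ifs with h
  · rw [one_mul, Finset.mul_sum]
    exact Finset.sum_congr rfl fun b _ => mul_comm _ _
  · simp

/-- The step of density matrix exponentiation: after the second register is traced out, the cross
terms of the swap form the commutator with `τ`, which is the generator of `exp(-i t τ)`. -/
lemma prep_load_fracSwap (ρ : Op n n) (t : ℝ) (ω τ : Op (n + 1) (n + 1)) :
    Instr.prepState (coinQ n) (Instr.loadState ρ (progR n)
      (conjBy (fracSwap t (regA n) (regB n)) (tens ω τ))) =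
    tens (((Real.cos t : ℂ) ^ 2 * τ.trace) • ω + ((Real.sin t : ℂ) ^ 2 * ω.trace) • τ +
      (Complex.I * Real.sin t * Real.cos t) • (ω * τ - τ * ω)) (joint (proj 0) ρ) := by
  ext y x
  rw [prep_load_apply]
  simp only [conjBy_fracSwap regA_ne_regB, tens, comp_swapPerm_regA, comp_swapPerm_regB,
    joinBits_regA, joinBits_regB, Finset.sum_add_distrib, ← Finset.mul_sum, Finset.sum_sub_distrib,
    ← Finset.sum_mul]
  have h1 : ∑ w : Bits (n + 1), ω (y ∘ regA n) w * τ w (x ∘ regA n) =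
      (ω * τ) (y ∘ regA n) (x ∘ regA n) := (Matrix.mul_apply).symm
  have h2 : ∑ w : Bits (n + 1), ω w (x ∘ regA n) * τ (y ∘ regA n) w =
      (τ * ω) (y ∘ regA n) (x ∘ regA n) := by
    rw [Matrix.mul_apply]
    exact Finset.sum_congr rfl fun w _ => mul_comm _ _
  rw [h1, h2]
  simp only [Matrix.add_apply, Matrix.smul_apply, Matrix.sub_apply, smul_eq_mul, Matrix.trace,
    Matrix.diag_apply]
  ring

end

noncomputable section

/-! ### The state of the control qubit along one eigenspace -/

/-- A Hermitian operator `|0⟩⟨0| a + |1⟩⟨1| d + |1⟩⟨0| o + |0⟩⟨1| ō` of the control qubit. -/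
structure Blk where
  /-- weight of `|0⟩` -/
  a : ℝ
  /-- weight of `|1⟩` -/
  d : ℝ
  /-- coherence -/
  o : ℂ

namespace Blk

/-- The operator of the control qubit. -/
def mat (r : Blk) : Matrix (ZMod 2) (ZMod 2) ℂ := qmat r.a (star r.o) r.o r.d

/-- The trace. -/
def tr (r : Blk) : ℝ := r.a + r.d

/-- Rescaling. -/
def scale (c : ℝ) (r : Blk) : Blk := ⟨c * r.a, c * r.d, c * r.o⟩

/-- The operator `p |+⟩⟨+|`. -/
def plus (p : ℝ) : Blk := ⟨p / 2, p / 2, ((p / 2 : ℝ) : ℂ)⟩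

/-- Probability of the outcome `|−⟩`. -/
def acc (r : Blk) : ℝ := (r.a + r.d) / 2 - r.o.re

/-- Probability of the outcome `|+⟩`. -/
def rej (r : Blk) : ℝ := (r.a + r.d) / 2 + r.o.re

/-- The effect of a fractional swap with a fresh program on an eigenspace with eigenvalue `x` and
weight `w`, if the total trace is `T`. -/
def upd (c s x w T : ℝ) (r : Blk) : Blk :=
  ⟨c ^ 2 * r.a, c ^ 2 * r.d + s ^ 2 * w * T, ((c ^ 2 : ℝ) - Complex.I * (s * c * x : ℝ)) * r.o⟩

/-- The positivity that the analysis needs. -/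
def Ok (r : Blk) : Prop := 0 ≤ r.a ∧ 0 ≤ r.d ∧ ‖r.o‖ ≤ (r.a + r.d) / 2

lemma Ok.tr_nonneg {r : Blk} (h : r.Ok) : 0 ≤ r.tr := add_nonneg h.1 h.2.1

lemma Ok.acc_nonneg {r : Blk} (h : r.Ok) : 0 ≤ r.acc := by
  have := (abs_le.mp (Complex.abs_re_le_norm r.o)).2
  have := h.2.2
  unfold acc; linarith

lemma Ok.rej_nonneg {r : Blk} (h : r.Ok) : 0 ≤ r.rej := by
  have := (abs_le.mp (Complex.abs_re_le_norm r.o)).1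
  have := h.2.2
  unfold rej; linarith

lemma acc_add_rej (r : Blk) : r.acc + r.rej = r.tr := by
  unfold acc rej tr; ring

lemma tr_scale (c : ℝ) (r : Blk) : (r.scale c).tr = c * r.tr := by
  simp [tr, scale, mul_add]

lemma Ok.scale {r : Blk} (h : r.Ok) {c : ℝ} (hc : 0 ≤ c) : (r.scale c).Ok := by
  refine ⟨mul_nonneg hc h.1, mul_nonneg hc h.2.1, ?_⟩
  simp only [Blk.scale, norm_mul, Complex.norm_real, Real.norm_eq_abs, abs_of_nonneg hc]
  have := mul_le_mul_of_nonneg_left h.2.2 hc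
  linarith

lemma ok_plus {p : ℝ} (hp : 0 ≤ p) : (plus p).Ok := by
  refine ⟨by simp only [plus]; linarith, by simp only [plus]; linarith, ?_⟩
  simp only [plus, Complex.norm_real, Real.norm_eq_abs]
  rw [abs_of_nonneg (by linarith)]
  linarith

lemma tr_upd (c s x w T : ℝ) (r : Blk) : (r.upd c s x w T).tr = c ^ 2 * r.tr + s ^ 2 * w * T := by
  simp only [tr, upd]; ring

lemma norm_upd_factor {c s x : ℝ} (hx : 0 ≤ x) (hx1 : x ≤ 1) :
    ‖((c ^ 2 : ℝ) : ℂ) - Complex.I * (s * c * x : ℝ)‖ ≤ c ^ 2 + s ^ 2 * x := by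
  have h0 : 0 ≤ c ^ 2 + s ^ 2 * x := by positivity
  rw [← abs_of_nonneg h0, ← abs_of_nonneg (norm_nonneg _), ← sq_le_sq, ← Complex.normSq_eq_norm_sq,
    Complex.normSq_apply]
  have hre : (((c ^ 2 : ℝ) : ℂ) - Complex.I * (s * c * x : ℝ)).re = c ^ 2 := by
    simp [-Complex.ofReal_pow, -Complex.ofReal_mul]
  have him : (((c ^ 2 : ℝ) : ℂ) - Complex.I * (s * c * x : ℝ)).im = -(s * c * x) := by
    simp [-Complex.ofReal_pow, -Complex.ofReal_mul]
  rw [hre, him]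
  have h1 : 0 ≤ c ^ 2 * s ^ 2 * (x * (2 - x)) :=
    mul_nonneg (by positivity) (mul_nonneg hx (by linarith))
  have h2 : 0 ≤ s ^ 4 * x ^ 2 := by positivity
  nlinarith

/-- The coherence may shrink more slowly than `c²`, by at most `s² x`. The weight `s² w T` swapped
in on the diagonal compensates for this, because `x ≤ w` and `r.tr ≤ T`. -/
lemma Ok.upd {r : Blk} (h : r.Ok) {c s x w T : ℝ} (hx : 0 ≤ x) (hx1 : x ≤ 1) (hxw : x ≤ w)
    (hT : r.tr ≤ T) : (r.upd c s x w T).Ok := by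
  have htr := h.tr_nonneg
  have hw : 0 ≤ w := hx.trans hxw
  have hT0 : 0 ≤ T := htr.trans hT
  have ha := h.1
  have hd := h.2.1
  refine ⟨by simp only [Blk.upd]; positivity, by simp only [Blk.upd]; positivity, ?_⟩
  simp only [Blk.upd, norm_mul]
  have h1 := mul_le_mul (norm_upd_factor (c := c) (s := s) hx hx1) h.2.2 (norm_nonneg _)
    (by positivity)
  have h2 : x * r.tr ≤ w * T := mul_le_mul hxw hT htr hw
  have h3 : s ^ 2 * (x * r.tr) ≤ s ^ 2 * (w * T) := mul_le_mul_of_nonneg_left h2 (sq_nonneg s)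
  unfold tr at h3
  linarith

end Blk

/-! ### One trial -/

/-- The parameters of a trial: contamination rate `η`, stopping probability `μ`, and cosine and sine
of the angle of the fractional swaps. -/
structure TrialParams (f η μ c s : ℝ) : Prop where
  hf : 0 < f
  hf1 : f ≤ 1
  hη : 0 < η
  hη1 : η ≤ 1 / 200
  cos_sq : (1 - μ) * c ^ 2 = 1 / (1 + η * f ^ 2)
  cos_sin : (1 - μ) * (s * c) = η * f / (1 + η * f ^ 2)
  sin_sq : (1 - μ) * s ^ 2 = (η * f) ^ 2 / (1 + η * f ^ 2)
  hμ : μ = η * f ^ 2 * (1 - η) / (1 + η * f ^ 2)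

/-- The factor by which the expected final coherence of a trial differs from the initial one. -/
def zeta (f η x : ℝ) : ℂ := ((1 - η : ℝ) : ℂ) / (1 + Complex.I * (x / f : ℝ))

lemma zeta_den_ne {f x : ℝ} : (1 + Complex.I * (x / f : ℝ) : ℂ) ≠ 0 := by
  intro h
  have := congrArg Complex.re h
  simp [-Complex.ofReal_div] at this

lemma normSq_zeta_den (y : ℝ) : Complex.normSq (1 + Complex.I * (y : ℂ)) = 1 + y ^ 2 := by
  rw [Complex.normSq_apply]; simp; ring

lemma zeta_re (f η x : ℝ) : (zeta f η x).re = (1 - η) / (1 + (x / f) ^ 2) := by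
  rw [zeta, Complex.div_re, normSq_zeta_den]
  simp [-Complex.ofReal_div, -Complex.ofReal_sub]

lemma norm_zeta_le {f η x : ℝ} (hη : η ≤ 1) : ‖zeta f η x‖ ≤ 1 - η := by
  rw [zeta, norm_div, Complex.norm_real, Real.norm_eq_abs, abs_of_nonneg (by linarith)]
  refine div_le_self (by linarith) ?_
  have h := Complex.abs_re_le_norm (1 + Complex.I * (x / f : ℝ))
  have hre : (1 + Complex.I * (x / f : ℝ) : ℂ).re = 1 := by simp [-Complex.ofReal_div]
  rw [hre, abs_one] at h
  exact h

namespace TrialParams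

variable {f η μ c s : ℝ} (h : TrialParams f η μ c s)
include h

lemma den_pos : 0 < 1 + η * f ^ 2 := by
  have := h.hf; have := h.hη; positivity

lemma mu_pos : 0 < μ := by
  rw [h.hμ]
  have := h.hf; have := h.hη; have := h.hη1
  have h1 : 0 < 1 - η := by linarith
  positivity

lemma mu_le_one : μ ≤ 1 := by
  rw [h.hμ, div_le_one h.den_pos]
  have := h.hf; have := h.hη; have := h.hη1
  have : 0 ≤ η * f ^ 2 := by positivity
  nlinarith

/-- Conditioning on the first coin: with probability `μ` the coherence stays as it is, otherwise one
swap multiplies it and the trial starts anew. `zeta` is the solution of this fixed-point equation,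
the sum of a geometric series. -/
lemma zeta_eq (x : ℝ) : (μ : ℂ) * 1 + (1 - μ : ℝ) * (zeta f η x *
    ((c ^ 2 : ℝ) - Complex.I * (s * c * x : ℝ))) = zeta f η x := by
  have hden := zeta_den_ne (f := f) (x := x)
  have hD := h.den_pos.ne'
  have hDc : ((1 + η * f ^ 2 : ℝ) : ℂ) ≠ 0 := by exact_mod_cast hD
  have hfc : (f : ℂ) ≠ 0 := by exact_mod_cast h.hf.ne'
  have h1 : ((1 - μ : ℝ) : ℂ) * ((c ^ 2 : ℝ) - Complex.I * (s * c * x : ℝ)) =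
      ((1 / (1 + η * f ^ 2) : ℝ) : ℂ) - Complex.I * (η * f / (1 + η * f ^ 2) * x : ℝ) := by
    rw [← h.cos_sq, ← h.cos_sin]
    push_cast
    ring
  have h2 : (μ : ℂ) * 1 + (1 - μ : ℝ) * (zeta f η x *
      ((c ^ 2 : ℝ) - Complex.I * (s * c * x : ℝ))) =
      (μ : ℂ) + zeta f η x * (((1 / (1 + η * f ^ 2) : ℝ) : ℂ) -
        Complex.I * (η * f / (1 + η * f ^ 2) * x : ℝ)) := by
    rw [← h1]; ring
  rw [h2, zeta, h.hμ]
  push_cast at hDc hden ⊢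
  have hden' : (f : ℂ) + Complex.I * x ≠ 0 := by
    intro h0
    apply hden
    field_simp
    rw [h0, mul_zero]
  field_simp
  ring

end TrialParams

/-- The final value of a trial that stops with the given control qubits, when the four outcomes have
values `u` and `d` (accepted and rejected, along the state) and `u'` and `d'` (accepted and
rejected, orthogonally to the state). -/
def stopValue (u d u' d' : ℝ) (r r' : Blk) : ℝ :=
  r.acc * u + r.rej * d + (r'.acc * u' + r'.rej * d')

/-- The expected final value of a trial, from the given control qubits. -/
def trialValue (f η F lam u d u' d' : ℝ) (r r' : Blk) : ℝ :=
  (1 - η) * ((u + d) / 2 * r.tr + (u' + d') / 2 * r'.tr) +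
    η * (r.tr + r'.tr) * (F * ((u + d) / 2) + (1 - F) * ((u' + d') / 2)) +
    (d - u) * (zeta f η F * r.o).re + (d' - u') * (zeta f η lam * r'.o).re

lemma stopValue_nonneg {u d u' d' : ℝ} (hu : 0 ≤ u) (hd : 0 ≤ d) (hu' : 0 ≤ u') (hd' : 0 ≤ d')
    {r r' : Blk} (hr : r.Ok) (hr' : r'.Ok) : 0 ≤ stopValue u d u' d' r r' := by
  have h1 := hr.acc_nonneg
  have h2 := hr.rej_nonneg
  have h3 := hr'.acc_nonneg
  have h4 := hr'.rej_nonneg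
  unfold stopValue
  positivity

/-- The coherence is at most half the trace and `zeta` shrinks it by `1 - η`, so the average of
nonnegative outcome values remains nonnegative. -/
lemma coherence_bound {f η x u d : ℝ} (hη : η ≤ 1) (hu : 0 ≤ u) (hd : 0 ≤ d) {r : Blk}
    (hr : r.Ok) : 0 ≤ (1 - η) * ((u + d) / 2 * r.tr) + (d - u) * (zeta f η x * r.o).re := by
  have h1 : |(zeta f η x * r.o).re| ≤ (1 - η) * (r.tr / 2) := by
    refine (Complex.abs_re_le_norm _).trans ?_
    rw [norm_mul]
    exact mul_le_mul (norm_zeta_le hη) hr.2.2 (norm_nonneg _) (by linarith)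
  have h2 : |d - u| ≤ d + u := abs_sub_le_iff.mpr ⟨by linarith, by linarith⟩
  have h3 : |(d - u) * (zeta f η x * r.o).re| ≤ (d + u) * ((1 - η) * (r.tr / 2)) := by
    rw [abs_mul]
    exact mul_le_mul h2 h1 (abs_nonneg _) (by linarith)
  have h4 := (abs_le.mp h3).1
  linarith

lemma trialValue_nonneg {f η F lam u d u' d' : ℝ} (hη : 0 ≤ η) (hη1 : η ≤ 1) (hF : 0 ≤ F)
    (hF1 : F ≤ 1) (hu : 0 ≤ u) (hd : 0 ≤ d) (hu' : 0 ≤ u') (hd' : 0 ≤ d')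
    {r r' : Blk} (hr : r.Ok) (hr' : r'.Ok) : 0 ≤ trialValue f η F lam u d u' d' r r' := by
  have h1 := coherence_bound (f := f) (x := F) hη1 hu hd hr
  have h2 := coherence_bound (f := f) (x := lam) hη1 hu' hd' hr'
  have h3 : 0 ≤ η * (r.tr + r'.tr) * (F * ((u + d) / 2) + (1 - F) * ((u' + d') / 2)) := by
    have := hr.tr_nonneg
    have := hr'.tr_nonneg
    have : 0 ≤ 1 - F := by linarith
    positivity
  unfold trialValue
  linarith

/-- The Bellman equation of a trial: stop now, or make one swap and continue. Coherences balance by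
`zeta_eq`, the weight that is never replaced by `k1`, and the replaced weight by `k2`. Replaced
weight has a control in `|1⟩`, without coherence, hence a fair final outcome. -/
lemma TrialParams.trialValue_step {f η μ c s : ℝ} (h : TrialParams f η μ c s)
    (F lam u d u' d' : ℝ) (r r' : Blk) :
    stopValue u d u' d' (r.scale μ) (r'.scale μ) +
      trialValue f η F lam u d u' d'
        ((r.scale (1 - μ)).upd c s F F ((r.scale (1 - μ)).tr + (r'.scale (1 - μ)).tr))
        ((r'.scale (1 - μ)).upd c s lam (1 - F) ((r.scale (1 - μ)).tr + (r'.scale (1 - μ)).tr)) =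
      trialValue f η F lam u d u' d' r r' := by
  have hz : ∀ (x : ℝ) (o : ℂ), (zeta f η x * o).re = μ * o.re + (zeta f η x *
      ((((c ^ 2 : ℝ) : ℂ) - Complex.I * (s * c * x : ℝ)) * (((1 - μ : ℝ) : ℂ) * o))).re := by
    intro x o
    conv_lhs => rw [← h.zeta_eq x]
    rw [← Complex.re_ofReal_mul, ← Complex.add_re]
    congr 1
    ring
  have hD := h.den_pos.ne'
  have e1 := h.cos_sq
  have e2 : (1 - μ) * s ^ 2 = (η * f) ^ 2 / (1 + η * f ^ 2) := h.sin_sq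
  have hμ := h.hμ
  have k1 : μ + (1 - η) * ((1 - μ) * c ^ 2) = 1 - η := by
    rw [e1, hμ]; field_simp; ring
  have k2 : (1 - η) * ((1 - μ) * s ^ 2) + η * ((1 - μ) * c ^ 2 + (1 - μ) * s ^ 2) = η := by
    rw [e1, e2]; field_simp; ring
  unfold trialValue stopValue
  rw [Blk.tr_upd, Blk.tr_upd]
  simp only [Blk.upd, Blk.scale, Blk.acc, Blk.rej, Complex.re_ofReal_mul]
  rw [hz F r.o, hz lam r'.o]
  simp only [Blk.tr]
  linear_combination ((u + d) / 2 * (r.a + r.d) + (u' + d') / 2 * (r'.a + r'.d)) * k1 +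
    ((r.a + r.d + (r'.a + r'.d)) * (F * ((u + d) / 2) + (1 - F) * ((u' + d') / 2))) * k2

/-- From `|+⟩` the acceptance probability without contamination is `(1 - 1/(1 + (x/f)²)) / 2` on the
eigenvalue `x`: at least `1/4` for `x ≥ f`, at most `1/34` for `0 ≤ x ≤ f/4`. -/
lemma trialValue_plus (f η F lam u d u' d' p q : ℝ) :
    trialValue f η F lam u d u' d' (Blk.plus p) (Blk.plus q) =
      p * ((1 - η) * ((1 - 1 / (1 + (F / f) ^ 2)) / 2 * u + (1 - (1 - 1 / (1 + (F / f) ^ 2)) / 2) * d)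
        + η * (F * ((u + d) / 2) + (1 - F) * ((u' + d') / 2))) +
      q * ((1 - η) * ((1 - 1 / (1 + (lam / f) ^ 2)) / 2 * u' +
        (1 - (1 - 1 / (1 + (lam / f) ^ 2)) / 2) * d')
        + η * (F * ((u + d) / 2) + (1 - F) * ((u' + d') / 2))) := by
  have hre : ∀ x y : ℝ, (zeta f η x * ((y : ℝ) : ℂ)).re = (1 - η) / (1 + (x / f) ^ 2) * y := by
    intro x y
    rw [Complex.re_mul_ofReal, zeta_re]
  unfold trialValue
  simp only [Blk.plus, Blk.tr, hre]
  ring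

/-! ### The random walk of the trials -/

/-- The drift inequality along the state. -/
lemma trial_state_le {x η C Y G M F L a u d u' d' : ℝ} (hx : 0 < x) (hη : η = 1 / (200 * x))
    (hη1 : η ≤ 1) (hG : 13 / 10 * x ≤ G) (ha : 1 / 4 ≤ a) (ha1 : a ≤ 1 / 2) (hF : 0 ≤ F)
    (hF1 : F ≤ 1) (hC : 0 ≤ C) (hY : 0 ≤ Y)
    (hu : u = C / ((11 / 10) ^ 9 * x) + Y * (G - (11 / 10) ^ 8 * x)) (huC : u ≤ C)
    (hd : d ≤ C / x + Y * (G - x / (11 / 10))) (hdC : d ≤ C)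
    (hu' : u' ≤ C + M) (hd' : d' ≤ C + M) (hL : L + η * ((1 - F) * M) ≤ 1 / 5 * Y * x) :
    L + ((1 - η) * (a * u + (1 - a) * d) +
      η * (F * ((u + d) / 2) + (1 - F) * ((u' + d') / 2))) ≤
      C / (11 / 10 * x) + Y * (G - x) := by
  have hη0 : 0 < η := by rw [hη]; positivity
  obtain ⟨c0, hc0⟩ : ∃ c0, c0 = C / x := ⟨_, rfl⟩
  have hc0n : 0 ≤ c0 := by rw [hc0]; positivity
  have hCx : C = c0 * x := by rw [hc0]; field_simp
  have e1 : C / ((11 / 10) ^ 9 * x) = c0 / (11 / 10) ^ 9 := by rw [hCx]; field_simp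
  have e2 : C / (11 / 10 * x) = c0 / (11 / 10) := by rw [hCx]; field_simp
  have e3 : η * C = c0 / 200 := by rw [hη, hCx]; field_simp
  -- After contamination the data is a fresh copy: value at most `C` along the state, and at most
  -- `M` more with probability `1 - F`.
  have hmix : F * ((u + d) / 2) + (1 - F) * ((u' + d') / 2) ≤ C + (1 - F) * M := by
    have h1 : F * ((u + d) / 2) ≤ F * C := mul_le_mul_of_nonneg_left (by linarith) hF
    have h2 : (1 - F) * ((u' + d') / 2) ≤ (1 - F) * (C + M) :=
      mul_le_mul_of_nonneg_left (by linarith) (by linarith)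
    linarith
  have hmix' := mul_le_mul_of_nonneg_left hmix hη0.le
  rw [mul_add η C, e3] at hmix'
  have hYx : 0 ≤ Y * x := by positivity
  -- The worst case is `a = 1/4`: `1/4 · 1.1⁻⁹ + 3/4 < 0.857`, and `1/4 · 1.1⁸ + 3/4 · 1.1⁻¹ >
  -- 1.217`. The margins to `1/1.1` and to 1 pay for contamination and cost.
  have hav : a * u + (1 - a) * d ≤ 857 / 1000 * c0 + Y * G - 1217 / 1000 * (Y * x) := by
    have h1 : a * u + (1 - a) * d ≤ a * (c0 / (11 / 10) ^ 9 + Y * (G - (11 / 10) ^ 8 * x)) +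
        (1 - a) * (c0 + Y * (G - x / (11 / 10))) := by
      have := mul_le_mul_of_nonneg_left hd (show 0 ≤ 1 - a by linarith)
      rw [hu, e1]
      rw [← hc0] at this
      linarith
    have h2 : 0 ≤ (a - 1 / 4) * c0 := mul_nonneg (by linarith) hc0n
    have h3 : 0 ≤ (a - 1 / 4) * (Y * x) := mul_nonneg (by linarith) hYx
    have h4 : a * (c0 / (11 / 10) ^ 9 + Y * (G - (11 / 10) ^ 8 * x)) +
        (1 - a) * (c0 + Y * (G - x / (11 / 10))) =
        c0 * (1 / 4 * (1 / (11 / 10) ^ 9) + 3 / 4) - (a - 1 / 4) * c0 * (1 - 1 / (11 / 10) ^ 9) +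
        Y * G - Y * x * (1 / 4 * (11 / 10) ^ 8 + 3 / 4 * (10 / 11)) -
        (a - 1 / 4) * (Y * x) * ((11 / 10) ^ 8 - 10 / 11) := by ring
    rw [h4] at h1
    norm_num at h1
    norm_num
    linarith
  -- The bound is nonnegative because `G ≥ 1.3 x`, so the factor `1 - η` may be dropped.
  have hB : 0 ≤ 857 / 1000 * c0 + Y * G - 1217 / 1000 * (Y * x) := by
    have := mul_le_mul_of_nonneg_left hG hY
    linarith
  have hav' : (1 - η) * (a * u + (1 - a) * d) ≤
      857 / 1000 * c0 + Y * G - 1217 / 1000 * (Y * x) := by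
    have h1 := mul_le_mul_of_nonneg_left hav (show 0 ≤ 1 - η by linarith)
    have h2 := mul_nonneg hη0.le hB
    linarith
  rw [e2]
  norm_num
  linarith

/-- The drift inequality orthogonally to the state. -/
lemma trial_perp_le {x η C X₁ X₂ F L b u d u' d' : ℝ} (hx : 0 < x) (hη0 : 0 ≤ η)
    (hη1 : η ≤ 1 / 200) (hb1 : b ≤ 1 / 34) (hF : 0 ≤ F)
    (hF1 : F ≤ 1) (hX₁ : 0 ≤ X₁) (hX₂ : 0 ≤ X₂)
    (huC : u ≤ C) (hdC : d ≤ C)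
    (hu' : u' = C + X₁ * ((11 / 10) ^ 8 * x) + X₂ * ((11 / 10) ^ 8 * x) ^ 2)
    (hd' : d' ≤ C + X₁ * (x / (11 / 10)) + X₂ * (x / (11 / 10)) ^ 2)
    (hL : L ≤ X₁ * x / 25) :
    L + ((1 - η) * (b * u' + (1 - b) * d') +
      η * (F * ((u + d) / 2) + (1 - F) * ((u' + d') / 2))) ≤ C + X₁ * x + X₂ * x ^ 2 := by
  obtain ⟨y, hy⟩ : ∃ y, y = X₁ * x := ⟨_, rfl⟩
  obtain ⟨z, hz⟩ : ∃ z, z = X₂ * x ^ 2 := ⟨_, rfl⟩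
  have hy0 : 0 ≤ y := by rw [hy]; positivity
  have hz0 : 0 ≤ z := by rw [hz]; positivity
  have eu : u' = C + (11 / 10) ^ 8 * y + (11 / 10) ^ 16 * z := by rw [hu', hy, hz]; ring
  have ed : d' ≤ C + 10 / 11 * y + (10 / 11) ^ 2 * z := by
    refine hd'.trans (le_of_eq ?_); rw [hy, hz]; ring
  obtain ⟨M, hM⟩ : ∃ M, M = (11 / 10) ^ 8 * y + (11 / 10) ^ 16 * z := ⟨_, rfl⟩
  have hM0 : 0 ≤ M := by rw [hM]; positivity
  have hd'M : d' ≤ C + M := by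
    refine ed.trans ?_
    rw [hM]; norm_num; linarith
  have hmix : F * ((u + d) / 2) + (1 - F) * ((u' + d') / 2) ≤ C + M := by
    have h1 : F * ((u + d) / 2) ≤ F * C := mul_le_mul_of_nonneg_left (by linarith) hF
    have h2 : (1 - F) * ((u' + d') / 2) ≤ (1 - F) * (C + M) :=
      mul_le_mul_of_nonneg_left (by linarith) (by linarith)
    have h3 : 0 ≤ F * M := by positivity
    linarith
  have hmix' := mul_le_mul_of_nonneg_left hmix hη0
  have hηM : η * M ≤ 1 / 200 * M := mul_le_mul_of_nonneg_right hη1 hM0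
  -- The worst case is `b = 1/34`: `1/34 · 1.1⁸ + 33/34 · 1.1⁻¹ < 0.946` for the linear term, and
  -- the same with doubled exponents `< 0.938` for the quadratic one.
  have hav : b * u' + (1 - b) * d' ≤ C + 946 / 1000 * y + 938 / 1000 * z := by
    have h1 := mul_le_mul_of_nonneg_left ed (show 0 ≤ 1 - b by linarith)
    have h2 : 0 ≤ (1 / 34 - b) * y := mul_nonneg (by linarith) hy0
    have h3 : 0 ≤ (1 / 34 - b) * z := mul_nonneg (by linarith) hz0
    rw [eu]
    have h4 : b * (C + (11 / 10) ^ 8 * y + (11 / 10) ^ 16 * z) +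
        (1 - b) * (C + 10 / 11 * y + (10 / 11) ^ 2 * z) =
        C + y * (1 / 34 * (11 / 10) ^ 8 + 33 / 34 * (10 / 11)) +
        z * (1 / 34 * (11 / 10) ^ 16 + 33 / 34 * (10 / 11) ^ 2) -
        (1 / 34 - b) * y * ((11 / 10) ^ 8 - 10 / 11) -
        (1 / 34 - b) * z * ((11 / 10) ^ 16 - (10 / 11) ^ 2) := by ring
    have h5 : b * (C + (11 / 10) ^ 8 * y + (11 / 10) ^ 16 * z) + (1 - b) * d' ≤
        b * (C + (11 / 10) ^ 8 * y + (11 / 10) ^ 16 * z) +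
        (1 - b) * (C + 10 / 11 * y + (10 / 11) ^ 2 * z) := by linarith
    rw [h4] at h5
    norm_num at h5 ⊢
    linarith
  have hav' := mul_le_mul_of_nonneg_left hav (show 0 ≤ 1 - η by linarith)
  have h6 : 0 ≤ η * (946 / 1000 * y + 938 / 1000 * z) := by positivity
  rw [← hy, ← hz]
  rw [← hy] at hL
  rw [hM] at hηM hmix'
  rw [mul_add η C] at hmix'
  have h7 : (1 - η) * (C + 946 / 1000 * y + 938 / 1000 * z) =
    C - η * C + 946 / 1000 * y + 938 / 1000 * z - η * (946 / 1000 * y + 938 / 1000 * z) := by ring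
  rw [h7] at hav'
  norm_num at hηM hmix' ⊢
  linarith

end

noncomputable section

/-! ### Simulation of a protocol by a transition system -/

namespace Protocol

variable {n : ℕ} {P : Protocol n} {ρ : Op n n} {X : Type} {ctrl : X → P.Ctrl}
  {mem : X → Op P.mem P.mem} {step : X → List X} {Good : X → Prop}

/-- The transition system `step` on `X` describes the runs of `P` on copies of `ρ`. -/
structure Simulates (P : Protocol n) (ρ : Op n n) (ctrl : X → P.Ctrl)
    (mem : X → Op P.mem P.mem) (step : X → List X) (Good : X → Prop) : Prop where
  branches_eq : ∀ x, Good x →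
    (P.instr (ctrl x)).branches ρ (mem x) = (step x).map fun y => (ctrl y, mem y)
  good_step : ∀ x, Good x → ∀ y ∈ step x, Good y

/-! ### Bounds on runs from functions on the transition system -/

namespace Simulates

variable (h : Simulates P ρ ctrl mem step Good)
include h

lemma outputFrom_succ {x : X} (hx : Good x) (T : ℕ) :
    P.outputFrom ρ (T + 1) (ctrl x) (mem x) = (P.instr (ctrl x)).output (mem x) +
      ((step x).map fun y => P.outputFrom ρ T (ctrl y) (mem y)).sum := by
  rw [outputFrom, h.branches_eq x hx, List.map_map]
  rfl

lemma expectedFrom_succ (w : Instr n P.mem P.Ctrl → ℕ) {x : X} (hx : Good x) (T : ℕ) :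
    P.expectedFrom ρ w (T + 1) (ctrl x) (mem x) =
      w (P.instr (ctrl x)) * (Matrix.trace (mem x)).re +
      ((step x).map fun y => P.expectedFrom ρ w T (ctrl y) (mem y)).sum := by
  rw [expectedFrom, h.branches_eq x hx, List.map_map]
  rfl

/-- A nonnegative function that decreases on average by at least the running cost bounds the
expected total cost at every horizon. -/
lemma expectedFrom_le (w : Instr n P.mem P.Ctrl → ℕ) (Φ : X → ℝ) (h0 : ∀ x, Good x → 0 ≤ Φ x)
    (hΦ : ∀ x, Good x → w (P.instr (ctrl x)) * (Matrix.trace (mem x)).re +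
      ((step x).map Φ).sum ≤ Φ x) (T : ℕ) :
    ∀ x, Good x → P.expectedFrom ρ w T (ctrl x) (mem x) ≤ Φ x := by
  induction T with
  | zero => exact fun x hx => h0 x hx
  | succ T ih =>
    intro x hx
    rw [h.expectedFrom_succ w hx]
    refine le_trans ?_ (hΦ x hx)
    gcongr
    exact List.sum_le_sum fun y hy => ih y (h.good_step x hx y hy)

lemma output_le (φ : Op n n →+ ℝ) (Φ : X → ℝ) (h0 : ∀ x, Good x → 0 ≤ Φ x)
    (hΦ : ∀ x, Good x → φ ((P.instr (ctrl x)).output (mem x)) + ((step x).map Φ).sum ≤ Φ x)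
    (T : ℕ) : ∀ x, Good x → φ (P.outputFrom ρ T (ctrl x) (mem x)) ≤ Φ x := by
  induction T with
  | zero =>
    intro x hx
    rw [outputFrom, map_zero]
    exact h0 x hx
  | succ T ih =>
    intro x hx
    rw [h.outputFrom_succ hx, map_add, map_list_sum, List.map_map]
    refine le_trans ?_ (hΦ x hx)
    gcongr
    exact List.sum_le_sum fun y hy => ih y (h.good_step x hx y hy)

/-- Allowing one more step only adds outputs. With `S` a cone of positive operators this makes the
truncated outputs monotone, hence convergent. -/
lemma output_diff_mem (S : AddSubmonoid (Op n n))
    (hS : ∀ x, Good x → (P.instr (ctrl x)).output (mem x) ∈ S) (T : ℕ) :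
    ∀ x, Good x → ∃ D ∈ S, P.outputFrom ρ (T + 1) (ctrl x) (mem x) =
      P.outputFrom ρ T (ctrl x) (mem x) + D := by
  induction T with
  | zero =>
    intro x hx
    refine ⟨_, hS x hx, ?_⟩
    rw [h.outputFrom_succ hx]
    simp [outputFrom]
  | succ T ih =>
    intro x hx
    have hlist : ∀ l : List X, (∀ y ∈ l, Good y) → ∃ D ∈ S,
        (l.map fun y => P.outputFrom ρ (T + 1) (ctrl y) (mem y)).sum =
          (l.map fun y => P.outputFrom ρ T (ctrl y) (mem y)).sum + D := by
      intro l
      induction l with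
      | nil => exact fun _ => ⟨0, S.zero_mem, by simp⟩
      | cons y l ihl =>
        intro hl
        obtain ⟨D, hD, hDe⟩ := ihl fun z hz => hl z (List.mem_cons_of_mem _ hz)
        obtain ⟨D', hD', hDe'⟩ := ih y (hl y List.mem_cons_self)
        refine ⟨D' + D, S.add_mem hD' hD, ?_⟩
        rw [List.map_cons, List.sum_cons, List.map_cons, List.sum_cons, hDe, hDe']
        abel
    obtain ⟨D, hD, hDe⟩ := hlist (step x) (h.good_step x hx)
    refine ⟨D, hD, ?_⟩
    rw [h.outputFrom_succ hx, h.outputFrom_succ hx, hDe]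
    abel

/-- Markov's inequality for the running time: a run that has not halted within `T` steps has
executed `T` instructions. -/
lemma residual_le (hmass : ∀ x, Good x → (Matrix.trace (mem x)).re =
      (Matrix.trace ((P.instr (ctrl x)).output (mem x))).re +
        ((step x).map fun y => (Matrix.trace (mem y)).re).sum)
    (hpos : ∀ T x, Good x → 0 ≤ (Matrix.trace (P.outputFrom ρ T (ctrl x) (mem x))).re) (T : ℕ) :
    ∀ x, Good x → (T : ℝ) * ((Matrix.trace (mem x)).re -
      (Matrix.trace (P.outputFrom ρ T (ctrl x) (mem x))).re) ≤
      P.expectedFrom ρ (fun _ => 1) T (ctrl x) (mem x) := by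
  induction T with
  | zero =>
    intro x _
    simp [expectedFrom]
  | succ T ih =>
    intro x hx
    have hlist : ∀ l : List X, (∀ y ∈ l, Good y) →
        (T : ℝ) * ((l.map fun y => (Matrix.trace (mem y)).re).sum -
          (Matrix.trace (l.map fun y => P.outputFrom ρ T (ctrl y) (mem y)).sum).re) ≤
          (l.map fun y => P.expectedFrom ρ (fun _ => 1) T (ctrl y) (mem y)).sum := by
      intro l
      induction l with
      | nil => exact fun _ => by simp
      | cons y l ihl =>
        intro hl
        have h1 := ihl fun z hz => hl z (List.mem_cons_of_mem _ hz)
        have h2 := ih y (hl y List.mem_cons_self)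
        simp only [List.map_cons, List.sum_cons, Matrix.trace_add, Complex.add_re]
        linarith
    have h1 := hlist (step x) (h.good_step x hx)
    have h2 := hpos (T + 1) x hx
    have h3 := hmass x hx
    rw [h.expectedFrom_succ _ hx]
    rw [h.outputFrom_succ hx, Matrix.trace_add, Complex.add_re] at h2 ⊢
    rw [h3]
    push_cast
    linear_combination h1 + h2

end Simulates

end Protocol

/-! ### The protocol -/

/-- Contamination rate of the trials at level `k`. -/
def levelRate (k : ℕ) : ℝ := 1 / (200 * (11 / 10) ^ k)

/-- Stopping probability of the trials at level `k`. -/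
def stopProb (f : ℝ) (k : ℕ) : ℝ :=
  levelRate k * f ^ 2 * (1 - levelRate k) / (1 + levelRate k * f ^ 2)

/-- Angle of the fractional swaps at level `k`. -/
def swapAngle (f : ℝ) (k : ℕ) : ℝ := Real.arctan (levelRate k * f)

open Classical in
/-- The gate that prepares a coin with probability `μ` of the outcome `0`. -/
def coinGate (μ : ℝ) : Matrix.unitaryGroup (ZMod 2) ℂ :=
  if h : 0 ≤ μ ∧ μ ≤ 1 then rotGate (Real.sqrt μ) (Real.sqrt (1 - μ))
    (by rw [Real.sq_sqrt h.1, Real.sq_sqrt (by linarith [h.2])]; ring)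
  -- Arbitrary default; stopping probabilities lie in `[0, 1]`.
  else 1

/-- The control states of the distillation protocol. -/
inductive Stage : Type
  | start
  | reload
  | prepC (k : ℕ)
  | plusC (k : ℕ)
  | loadP (k : ℕ)
  | prepQ (k : ℕ)
  | coin (k : ℕ)
  | measQ (k : ℕ)
  | fswap (k : ℕ)
  | unplus (k : ℕ)
  | measC (k : ℕ)
  | done

/-- The control state after a rejected trial. -/
def Stage.down : ℕ → Stage
  | 0 => .reload
  | k + 1 => .prepC k

/-- The control state after an accepted trial. -/
def Stage.up (H k : ℕ) : Stage := if H ≤ k + 8 then .done else .prepC (k + 8)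

/-- The instructions of the distillation protocol. -/
def distillInstr (n : ℕ) (f : ℝ) (H : ℕ) : Stage → Instr n (memSize n) Stage
  -- Fills the program register once, so that every trial begins with the second register in `|0⟩⟨0|
  -- ⊗ ρ`.
  | .start => .load (progR n) .reload
  | .reload => .load (dataR n) (.prepC 0)
  | .prepC k => .prep (ctrlQ n) (.plusC k)
  | .plusC k => .gate (ctrlQ n) plusGate (.loadP k)
  | .loadP k => .load (progR n) (.prepQ k)
  | .prepQ k => .prep (coinQ n) (.coin k)
  | .coin k => .gate (coinQ n) (coinGate (stopProb f k)) (.measQ k)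
  | .measQ k => .measure (coinQ n) fun b => if b = 0 then .unplus k else .fswap k
  | .fswap k => .fswap (swapAngle f k) (n + 1) (regA n) (regB n) regA_ne_regB
      (fracSwapCircuit (swapAngle f k) (regA n) (regB n) regA_ne_regB)
      (fracSwapCircuit_implements _ regA_ne_regB) (.loadP k)
  | .unplus k => .gate (ctrlQ n) unplusGate (.measC k)
  | .measC k => .measure (ctrlQ n) fun b => if b = 0 then Stage.down k else Stage.up H k
  | .done => .halt (dataR n)

/-- The distillation protocol: a random walk over the levels `0, …, H`, driven by trials that detect
whether the data register is along the principal eigenvector of the unknown state. -/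
def distillProtocol (n : ℕ) (f : ℝ) (H : ℕ) : Protocol n where
  mem := memSize n
  Ctrl := Stage
  start := .start
  instr := distillInstr n f H

/-! ### The states of the memory -/

/-- The unknown state has two eigenspaces, with normalized projections `P₁` and `P₂`. -/
structure SpectralPair {n : ℕ} (P₁ P₂ ρ : Op n n) (F lam : ℝ) : Prop where
  tr_left : P₁.trace = 1
  tr_right : P₂.trace = 1
  eq : ρ = (F : ℂ) • P₁ + ((1 - F : ℝ) : ℂ) • P₂
  left_mul : P₁ * ρ = (F : ℂ) • P₁
  mul_left : ρ * P₁ = (F : ℂ) • P₁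
  right_mul : P₂ * ρ = (lam : ℂ) • P₂
  mul_right : ρ * P₂ = (lam : ℂ) • P₂
  F_nonneg : 0 ≤ F
  F_le_one : F ≤ 1
  lam_nonneg : 0 ≤ lam
  lam_le : lam ≤ 1 - F

/-- Configurations of a run. -/
inductive Conf (n : ℕ) : Type
  | start
  | reload (χ : Op n n) (t : ℝ)
  | prepC (k : ℕ) (b : ZMod 2) (p q : ℝ)
  | plusC (k : ℕ) (p q : ℝ)
  | loadA (k : ℕ) (r r' : Blk)
  | prepA (k : ℕ) (r r' : Blk)
  | coin (k : ℕ) (r r' : Blk)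
  | measQ (k : ℕ) (r r' : Blk)
  | fswap (k : ℕ) (r r' : Blk)
  | loadB (k : ℕ) (r r' : Blk)
  | prepB (k : ℕ) (r r' : Blk)
  | unplus (k : ℕ) (r r' : Blk)
  | measC (k : ℕ) (r r' : Blk)
  | done (p q : ℝ)

section conf

variable {n : ℕ} (P₁ P₂ ρ : Op n n) (f F lam : ℝ) (H : ℕ)

/-- The data register with weight `p` along the state and weight `q` orthogonally. -/
def dataOp (p q : ℝ) : Op n n := (p : ℂ) • P₁ + (q : ℂ) • P₂

/-- The first register, for given states of the control qubit along the eigenspaces. -/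
def blkOp (R R' : Matrix (ZMod 2) (ZMod 2) ℂ) : Op (n + 1) (n + 1) := joint R P₁ + joint R' P₂

/-- The control state of a configuration. -/
def Conf.ctrl : Conf n → Stage
  | .start => .start
  | .reload _ _ => .reload
  | .prepC k _ _ _ => .prepC k
  | .plusC k _ _ => .plusC k
  | .loadA k _ _ => .loadP k
  | .prepA k _ _ => .prepQ k
  | .coin k _ _ => .coin k
  | .measQ k _ _ => .measQ k
  | .fswap k _ _ => .fswap k
  | .loadB k _ _ => .loadP k
  | .prepB k _ _ => .prepQ k
  | .unplus k _ _ => .unplus k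
  | .measC k _ _ => .measC k
  | .done _ _ => .done

/-- The memory of a configuration. -/
def Conf.mem : Conf n → Op (memSize n) (memSize n)
  | .start => Protocol.zeroState (memSize n)
  | .reload χ _ => tens (joint (proj 0) χ) (joint (proj 0) ρ)
  | .prepC _ b p q => tens (joint (proj b) (dataOp P₁ P₂ p q)) (joint (proj 0) ρ)
  | .plusC _ p q => tens (joint (proj 0) (dataOp P₁ P₂ p q)) (joint (proj 0) ρ)
  | .loadA _ r r' => tens (blkOp P₁ P₂ r.mat r'.mat) (joint (proj 0) ρ)
  | .prepA _ r r' => tens (blkOp P₁ P₂ r.mat r'.mat) (joint (proj 0) ρ)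
  | .coin _ r r' => tens (blkOp P₁ P₂ r.mat r'.mat) (joint (proj 0) ρ)
  | .measQ k r r' => tens (blkOp P₁ P₂ r.mat r'.mat)
      (joint ((coinGate (stopProb f k)).1 * proj 0 * ((coinGate (stopProb f k)).1)ᴴ) ρ)
  | .fswap _ r r' => tens (blkOp P₁ P₂ r.mat r'.mat) (joint (proj 1) ρ)
  -- The swap entangles the registers; the memory is a product again only after both the program is
  -- reloaded and the coin is reset. Until then it is left unevaluated.
  | .loadB k r r' => conjBy (fracSwap (swapAngle f k) (regA n) (regB n))
      (tens (blkOp P₁ P₂ r.mat r'.mat) (joint (proj 1) ρ))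
  | .prepB k r r' => Instr.loadState ρ (progR n)
      (conjBy (fracSwap (swapAngle f k) (regA n) (regB n))
        (tens (blkOp P₁ P₂ r.mat r'.mat) (joint (proj 1) ρ)))
  | .unplus _ r r' => tens (blkOp P₁ P₂ r.mat r'.mat) (joint (proj 0) ρ)
  | .measC _ r r' => tens (blkOp P₁ P₂ (unplusGate.1 * r.mat * (unplusGate.1)ᴴ)
      (unplusGate.1 * r'.mat * (unplusGate.1)ᴴ)) (joint (proj 0) ρ)
  | .done p q => tens (joint (proj 1) (dataOp P₁ P₂ p q)) (joint (proj 0) ρ)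

/-- The configuration after a rejected trial. -/
def Conf.down (p q : ℝ) : ℕ → Conf n
  | 0 => .reload (dataOp P₁ P₂ p q) (p + q)
  | k + 1 => .prepC k 0 p q

/-- The configuration after an accepted trial. -/
def Conf.up (p q : ℝ) (k : ℕ) : Conf n :=
  if H ≤ k + 8 then .done p q else .prepC (k + 8) 1 p q

/-- The control qubit after one fractional swap at level `k`, along an eigenspace. -/
def swapBlk (k : ℕ) (x w : ℝ) (T : ℝ) (r : Blk) : Blk :=
  r.upd (Real.cos (swapAngle f k)) (Real.sin (swapAngle f k)) x w T

/-- The configurations that may follow. -/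
def Conf.step : Conf n → List (Conf n)
  | .start => [.reload (Protocol.zeroState n) 1]
  | .reload _ t => [.prepC 0 0 (t * F) (t * (1 - F))]
  | .prepC k _ p q => [.plusC k p q]
  | .plusC k p q => [.loadA k (Blk.plus p) (Blk.plus q)]
  | .loadA k r r' => [.prepA k r r']
  | .prepA k r r' => [.coin k r r']
  | .coin k r r' => [.measQ k r r']
  | .measQ k r r' => [.unplus k (r.scale (stopProb f k)) (r'.scale (stopProb f k)),
      .fswap k (r.scale (1 - stopProb f k)) (r'.scale (1 - stopProb f k))]
  | .fswap k r r' => [.loadB k r r']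
  | .loadB k r r' => [.prepB k r r']
  | .prepB k r r' => [.coin k (swapBlk f k F F (r.tr + r'.tr) r)
      (swapBlk f k lam (1 - F) (r.tr + r'.tr) r')]
  | .unplus k r r' => [.measC k r r']
  | .measC k r r' => [Conf.down P₁ P₂ r.rej r'.rej k, Conf.up H r.acc r'.acc k]
  | .done _ _ => []

/-- The configurations with nonnegative weights. -/
def Conf.Good : Conf n → Prop
  | .start => True
  | .reload χ t => χ.trace = (t : ℂ) ∧ 0 ≤ t
  | .prepC _ _ p q => 0 ≤ p ∧ 0 ≤ q
  | .plusC _ p q => 0 ≤ p ∧ 0 ≤ q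
  | .loadA _ r r' => r.Ok ∧ r'.Ok
  | .prepA _ r r' => r.Ok ∧ r'.Ok
  | .coin _ r r' => r.Ok ∧ r'.Ok
  | .measQ _ r r' => r.Ok ∧ r'.Ok
  | .fswap _ r r' => r.Ok ∧ r'.Ok
  | .loadB _ r r' => r.Ok ∧ r'.Ok
  | .prepB _ r r' => r.Ok ∧ r'.Ok
  | .unplus _ r r' => r.Ok ∧ r'.Ok
  | .measC _ r r' => r.Ok ∧ r'.Ok
  | .done p q => 0 ≤ p ∧ 0 ≤ q

/-- The trace of the memory of a configuration. -/
def Conf.mass : Conf n → ℝ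
  | .start => 1
  | .reload _ t => t
  | .prepC _ _ p q => p + q
  | .plusC _ p q => p + q
  | .loadA _ r r' => r.tr + r'.tr
  | .prepA _ r r' => r.tr + r'.tr
  | .coin _ r r' => r.tr + r'.tr
  | .measQ _ r r' => r.tr + r'.tr
  | .fswap _ r r' => r.tr + r'.tr
  | .loadB _ r r' => r.tr + r'.tr
  | .prepB _ r r' => r.tr + r'.tr
  | .unplus _ r r' => r.tr + r'.tr
  | .measC _ r r' => r.tr + r'.tr
  | .done p q => p + q

end conf

/-! ### Parameters of a trial, and its effect on the control qubit and the coin -/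

section lemmas

variable {n : ℕ} {P₁ P₂ ρ : Op n n} {f F lam : ℝ}

lemma levelRate_pos (k : ℕ) : 0 < levelRate k := by unfold levelRate; positivity

lemma levelRate_le (k : ℕ) : levelRate k ≤ 1 / 200 := by
  unfold levelRate
  have : (1 : ℝ) ≤ (11 / 10) ^ k := one_le_pow₀ (by norm_num)
  exact one_div_le_one_div_of_le (by norm_num) (by linarith)

lemma trialParams (hf : 0 < f) (hf1 : f ≤ 1) (k : ℕ) :
    TrialParams f (levelRate k) (stopProb f k) (Real.cos (swapAngle f k))
      (Real.sin (swapAngle f k)) := by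
  have hη := levelRate_pos k
  have hη1 := levelRate_le k
  have hμ : stopProb f k = levelRate k * f ^ 2 * (1 - levelRate k) / (1 + levelRate k * f ^ 2) := rfl
  set η := levelRate k with hηdef
  have hD : 0 < 1 + η * f ^ 2 := by positivity
  have hD' : 0 < 1 + (η * f) ^ 2 := by positivity
  -- The stopping probability is chosen so that this numerator cancels `cos² t = 1 / (1 + (η f)²)`.
  have h1 : 1 - stopProb f k = (1 + (η * f) ^ 2) / (1 + η * f ^ 2) := by
    rw [hμ]; field_simp; ring
  have hc : Real.cos (swapAngle f k) ^ 2 = 1 / (1 + (η * f) ^ 2) := Real.cos_sq_arctan _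
  have hs : Real.sin (swapAngle f k) = η * f * Real.cos (swapAngle f k) := by
    have h2 : Real.tan (swapAngle f k) = η * f := Real.tan_arctan _
    have h3 : Real.cos (swapAngle f k) ≠ 0 := (Real.cos_arctan_pos _).ne'
    rw [← h2, Real.tan_eq_sin_div_cos, div_mul_cancel₀ _ h3]
  refine ⟨hf, hf1, hη, hη1, ?_, ?_, ?_, hμ⟩
  · rw [h1, hc]; field_simp
  · rw [h1, hs, mul_assoc, ← sq, hc]; field_simp
  · rw [h1, hs, mul_pow _ (Real.cos _), hc]; field_simp

lemma zeroState_eq_tens : Protocol.zeroState (memSize n) =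
    tens (joint (proj 0) (Protocol.zeroState n)) (joint (proj 0) (Protocol.zeroState n)) := by
  have hz : ∀ y : Bits (memSize n), y = 0 ↔ (y (ctrlQ n) = 0 ∧ y ∘ dataR n = 0) ∧
      (y (coinQ n) = 0 ∧ y ∘ progR n = 0) := by
    intro y
    constructor
    · rintro rfl; exact ⟨⟨rfl, rfl⟩, rfl, rfl⟩
    · rintro ⟨⟨h1, h2⟩, h3, h4⟩
      refine bits_ext ?_ ?_
      · funext j
        exact Fin.cases h1 (fun i => congrFun h2 i) j
      · funext j
        exact Fin.cases h3 (fun i => congrFun h4 i) j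
  ext y x
  rw [tens, joint_regA, joint_regB, proj_apply, proj_apply, Protocol.zeroState, Protocol.zeroState,
    Protocol.zeroState]
  simp only [← ite_and, mul_ite, mul_one, mul_zero]
  congr 1
  rw [hz y, hz x]
  apply propext
  tauto

lemma trace_zeroState (m : ℕ) : (Protocol.zeroState m).trace = 1 := by
  simp [Matrix.trace, Protocol.zeroState]

lemma trace_dataOp (h1 : P₁.trace = 1) (h2 : P₂.trace = 1) (p q : ℝ) :
    (dataOp P₁ P₂ p q).trace = ((p + q : ℝ) : ℂ) := by
  rw [dataOp, Matrix.trace_add, Matrix.trace_smul, Matrix.trace_smul, h1, h2]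
  simp

lemma trace_blkOp (h1 : P₁.trace = 1) (h2 : P₂.trace = 1) (R R' : Matrix (ZMod 2) (ZMod 2) ℂ) :
    (blkOp P₁ P₂ R R').trace = R.trace + R'.trace := by
  rw [blkOp, Matrix.trace_add, trace_joint, trace_joint, h1, h2, mul_one, mul_one]

lemma Blk.trace_mat (r : Blk) : r.mat.trace = (r.tr : ℂ) := by
  rw [Blk.mat, trace_qmat, Blk.tr]; push_cast; rfl

lemma Blk.mat_scale (c : ℝ) (r : Blk) : (r.scale c).mat = (c : ℂ) • r.mat := by
  apply qmat_ext <;> simp [Blk.mat, Blk.scale]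

lemma blkOp_smul (c : ℂ) (R R' : Matrix (ZMod 2) (ZMod 2) ℂ) :
    blkOp P₁ P₂ (c • R) (c • R') = c • blkOp P₁ P₂ R R' := by
  rw [blkOp, blkOp, joint_smul_left, joint_smul_left, smul_add]

lemma joint_dataOp (A : Matrix (ZMod 2) (ZMod 2) ℂ) (p q : ℝ) :
    joint A (dataOp P₁ P₂ p q) = blkOp P₁ P₂ ((p : ℂ) • A) ((q : ℂ) • A) := by
  rw [dataOp, blkOp, joint_add_right, joint_smul_right, joint_smul_right, joint_smul_left,
    joint_smul_left]

lemma inv_sqrt_two_mul_self :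
    ((1 / Real.sqrt 2 : ℝ) : ℂ) * ((1 / Real.sqrt 2 : ℝ) : ℂ) = 1 / 2 := by
  rw [← Complex.ofReal_mul, div_mul_div_comm, Real.mul_self_sqrt (by norm_num)]
  norm_num

lemma Blk.mat_plus (p : ℝ) :
    (Blk.plus p).mat = (p : ℂ) • (plusGate.1 * proj 0 * (plusGate.1)ᴴ) := by
  have hh := inv_sqrt_two_mul_self
  rw [plusGate, rotGate, proj_zero, qmat_conjTranspose, qmat_mul, qmat_mul]
  simp only [star_neg, Complex.star_def, Complex.conj_ofReal]
  generalize ((1 / Real.sqrt 2 : ℝ) : ℂ) = h at hh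
  apply qmat_ext <;> simp [Blk.mat, Blk.plus] <;> linear_combination (-(p : ℂ)) * hh

lemma unplus_apply_zero (r : Blk) :
    (unplusGate.1 * r.mat * (unplusGate.1)ᴴ) 0 0 = (r.rej : ℂ) := by
  have hh := inv_sqrt_two_mul_self
  have hre : r.o + star r.o = ((2 * r.o.re : ℝ) : ℂ) := Complex.add_conj r.o
  rw [unplusGate, rotGate, Blk.mat, qmat_conjTranspose, qmat_mul, qmat_mul, qmat_zero_zero,
    Complex.ofReal_neg]
  simp only [star_neg, Complex.star_def, Complex.conj_ofReal] at hre ⊢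
  generalize ((1 / Real.sqrt 2 : ℝ) : ℂ) = h at hh ⊢
  rw [Blk.rej]
  push_cast at hre ⊢
  linear_combination ((r.a : ℂ) + r.d + (r.o + (starRingEnd ℂ) r.o)) * hh + 1 / 2 * hre

lemma unplus_apply_one (r : Blk) :
    (unplusGate.1 * r.mat * (unplusGate.1)ᴴ) 1 1 = (r.acc : ℂ) := by
  have hh := inv_sqrt_two_mul_self
  have hre : r.o + star r.o = ((2 * r.o.re : ℝ) : ℂ) := Complex.add_conj r.o
  rw [unplusGate, rotGate, Blk.mat, qmat_conjTranspose, qmat_mul, qmat_mul, qmat_one_one,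
    Complex.ofReal_neg]
  simp only [star_neg, Complex.star_def, Complex.conj_ofReal] at hre ⊢
  generalize ((1 / Real.sqrt 2 : ℝ) : ℂ) = h at hh ⊢
  rw [Blk.acc]
  push_cast at hre ⊢
  linear_combination ((r.a : ℂ) + r.d - (r.o + (starRingEnd ℂ) r.o)) * hh - 1 / 2 * hre

lemma coinGate_eq {μ : ℝ} (h0 : 0 ≤ μ) (h1 : μ ≤ 1) : (coinGate μ).1 =
    qmat (Real.sqrt μ) (-(Real.sqrt (1 - μ) : ℝ)) (Real.sqrt (1 - μ)) (Real.sqrt μ) := by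
  rw [coinGate, dif_pos ⟨h0, h1⟩, rotGate]

lemma coin_apply_zero {μ : ℝ} (h0 : 0 ≤ μ) (h1 : μ ≤ 1) :
    ((coinGate μ).1 * proj 0 * ((coinGate μ).1)ᴴ) 0 0 = (μ : ℂ) := by
  rw [coinGate_eq h0 h1, proj_zero, qmat_conjTranspose, qmat_mul, qmat_mul, qmat_zero_zero]
  simp only [Complex.star_def, Complex.conj_ofReal, mul_one, mul_zero, zero_mul, add_zero]
  rw [← Complex.ofReal_mul, Real.mul_self_sqrt h0]

lemma coin_apply_one {μ : ℝ} (h0 : 0 ≤ μ) (h1 : μ ≤ 1) :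
    ((coinGate μ).1 * proj 0 * ((coinGate μ).1)ᴴ) 1 1 = ((1 - μ : ℝ) : ℂ) := by
  rw [coinGate_eq h0 h1, proj_zero, qmat_conjTranspose, qmat_mul, qmat_mul, qmat_one_one]
  simp only [Complex.star_def, Complex.conj_ofReal, mul_one, mul_zero, zero_mul, add_zero]
  rw [← Complex.ofReal_mul, Real.mul_self_sqrt (by linarith)]

lemma trace_unitary_conj (U : Matrix.unitaryGroup (ZMod 2) ℂ) (A : Matrix (ZMod 2) (ZMod 2) ℂ) :
    (U.1 * A * (U.1)ᴴ).trace = A.trace := by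
  rw [Matrix.mul_assoc, Matrix.trace_mul_comm, Matrix.mul_assoc]
  have : (U.1)ᴴ * U.1 = 1 := Matrix.mem_unitaryGroup_iff'.mp U.2
  rw [this, Matrix.mul_one]

/-- `ρ` is scalar on each eigenspace, so the commutator with `|1⟩⟨1| ⊗ ρ` acts on the control alone,
as `x` times the commutator with `|1⟩⟨1|`. The swapped-in copy spreads over the eigenspaces with
weights `F` and `1 - F`. -/
lemma swap_blkOp (hsp : SpectralPair P₁ P₂ ρ F lam) (k : ℕ) (r r' : Blk) :
    ((Real.cos (swapAngle f k) : ℂ) ^ 2 * (joint (proj 1) ρ).trace) • blkOp P₁ P₂ r.mat r'.mat +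
      ((Real.sin (swapAngle f k) : ℂ) ^ 2 * (blkOp P₁ P₂ r.mat r'.mat).trace) • joint (proj 1) ρ +
      (Complex.I * Real.sin (swapAngle f k) * Real.cos (swapAngle f k)) •
        (blkOp P₁ P₂ r.mat r'.mat * joint (proj 1) ρ - joint (proj 1) ρ * blkOp P₁ P₂ r.mat r'.mat) =
    blkOp P₁ P₂ (swapBlk f k F F (r.tr + r'.tr) r).mat
      (swapBlk f k lam (1 - F) (r.tr + r'.tr) r').mat := by
  have htρ : ρ.trace = 1 := by
    have := trace_dataOp hsp.tr_left hsp.tr_right F (1 - F)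
    rw [dataOp, ← hsp.eq] at this
    rw [this]; norm_num
  have hjρ : joint (proj 1) ρ =
      joint (((F : ℂ)) • proj 1) P₁ + joint (((1 - F : ℝ) : ℂ) • proj 1) P₂ := by
    conv_lhs => rw [hsp.eq]
    rw [joint_add_right, joint_smul_right, joint_smul_right, joint_smul_left, joint_smul_left]
  have hcomm : blkOp P₁ P₂ r.mat r'.mat * joint (proj 1) ρ -
      joint (proj 1) ρ * blkOp P₁ P₂ r.mat r'.mat =
      joint ((F : ℂ) • (r.mat * proj 1 - proj 1 * r.mat)) P₁ +
      joint ((lam : ℂ) • (r'.mat * proj 1 - proj 1 * r'.mat)) P₂ := by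
    rw [blkOp, Matrix.add_mul, Matrix.mul_add, joint_mul_joint, joint_mul_joint, joint_mul_joint,
      joint_mul_joint, hsp.left_mul, hsp.right_mul, hsp.mul_left, hsp.mul_right]
    simp only [joint_smul_right, sub_eq_add_neg, smul_add, joint_add_left, joint_smul_left]
    rw [show -(proj 1 * r.mat) = (-1 : ℂ) • (proj 1 * r.mat) by simp,
      show -(proj 1 * r'.mat) = (-1 : ℂ) • (proj 1 * r'.mat) by simp, joint_smul_left,
      joint_smul_left]
    module
  have key : ∀ (z : Blk) (x w : ℝ), (swapBlk f k x w (r.tr + r'.tr) z).mat =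
      ((Real.cos (swapAngle f k) : ℂ) ^ 2) • z.mat +
      ((Real.sin (swapAngle f k) : ℂ) ^ 2 * ((r.tr : ℂ) + r'.tr)) • ((w : ℂ) • proj 1) +
      (Complex.I * Real.sin (swapAngle f k) * Real.cos (swapAngle f k)) •
        ((x : ℂ) • (z.mat * proj 1 - proj 1 * z.mat)) := by
    intro z x w
    rw [swapBlk, Blk.upd, Blk.mat, Blk.mat, proj_one, qmat_mul, qmat_mul]
    apply qmat_ext
    · simp [-Complex.ofReal_cos, -Complex.ofReal_sin]
    · simp [-Complex.ofReal_cos, -Complex.ofReal_sin]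
      ring
    · simp [-Complex.ofReal_cos, -Complex.ofReal_sin]
      ring
    · simp [-Complex.ofReal_cos, -Complex.ofReal_sin]
      ring
  rw [trace_blkOp hsp.tr_left hsp.tr_right, Blk.trace_mat, Blk.trace_mat, trace_joint, trace_proj,
    htρ, hcomm, key, key, hjρ]
  simp only [blkOp, joint_add_left, joint_smul_left]
  module

end lemmas

end

noncomputable section

/-! ### The protocol is described by its configurations -/

section simulation

variable {n : ℕ} {P₁ P₂ ρ : Op n n} {f F lam : ℝ} {H : ℕ}

lemma SpectralPair.eq_dataOp (hsp : SpectralPair P₁ P₂ ρ F lam) :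
    ρ = dataOp P₁ P₂ F (1 - F) := hsp.eq

lemma SpectralPair.trace_eq_one (hsp : SpectralPair P₁ P₂ ρ F lam) : ρ.trace = 1 := by
  rw [hsp.eq_dataOp, trace_dataOp hsp.tr_left hsp.tr_right]
  norm_num

lemma dataOp_smul (t p q : ℝ) : dataOp P₁ P₂ (t * p) (t * q) = (t : ℂ) • dataOp P₁ P₂ p q := by
  rw [dataOp, dataOp, smul_add, smul_smul, smul_smul, Complex.ofReal_mul, Complex.ofReal_mul]

lemma conjBy_ctrlQ_blkOp (U : Matrix (ZMod 2) (ZMod 2) ℂ) (R R' : Matrix (ZMod 2) (ZMod 2) ℂ)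
    (τ : Op (n + 1) (n + 1)) :
    conjBy (onQubit (ctrlQ n) U) (tens (blkOp P₁ P₂ R R') τ) =
      tens (blkOp P₁ P₂ (U * R * Uᴴ) (U * R' * Uᴴ)) τ := by
  rw [blkOp, blkOp, tens_add_left, map_add, conjBy_onQubit_ctrlQ, conjBy_onQubit_ctrlQ,
    tens_add_left]

lemma measState_ctrlQ_blkOp {b : ZMod 2} {R R' : Matrix (ZMod 2) (ZMod 2) ℂ} {p q : ℝ}
    (hp : R b b = (p : ℂ)) (hq : R' b b = (q : ℂ)) (τ : Op (n + 1) (n + 1)) :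
    Instr.measState (ctrlQ n) b (tens (blkOp P₁ P₂ R R') τ) =
      tens (joint (proj b) (dataOp P₁ P₂ p q)) τ := by
  rw [blkOp, dataOp, tens_add_left, measState_add, measState_ctrlQ, measState_ctrlQ, hp, hq,
    joint_add_right, joint_smul_right, joint_smul_right, tens_add_left, tens_smul_left,
    tens_smul_left]

lemma measState_coinQ_blkOp {b : ZMod 2} {B : Matrix (ZMod 2) (ZMod 2) ℂ} {c : ℝ}
    (hB : B b b = (c : ℂ)) (r r' : Blk) :
    Instr.measState (coinQ n) b (tens (blkOp P₁ P₂ r.mat r'.mat) (joint B ρ)) =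
      tens (blkOp P₁ P₂ (r.scale c).mat (r'.scale c).mat) (joint (proj b) ρ) := by
  rw [measState_coinQ, hB, Blk.mat_scale, Blk.mat_scale, blkOp_smul, tens_smul_left]

lemma Conf.ctrl_down (p q : ℝ) (k : ℕ) :
    (Conf.down P₁ P₂ p q k).ctrl = Stage.down k := by
  cases k <;> rfl

lemma Conf.mem_down (p q : ℝ) (k : ℕ) : (Conf.down P₁ P₂ p q k).mem P₁ P₂ ρ f =
    tens (joint (proj 0) (dataOp P₁ P₂ p q)) (joint (proj 0) ρ) := by
  cases k <;> rfl

lemma Conf.ctrl_up (p q : ℝ) (k : ℕ) : (Conf.up H p q k : Conf n).ctrl = Stage.up H k := by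
  unfold Conf.up Stage.up
  split_ifs <;> rfl

lemma Conf.mem_up (p q : ℝ) (k : ℕ) : (Conf.up H p q k).mem P₁ P₂ ρ f =
    tens (joint (proj 1) (dataOp P₁ P₂ p q)) (joint (proj 0) ρ) := by
  unfold Conf.up
  split_ifs <;> rfl

lemma Conf.good_down (hsp : SpectralPair P₁ P₂ ρ F lam) {p q : ℝ} (hp : 0 ≤ p) (hq : 0 ≤ q)
    (k : ℕ) : (Conf.down P₁ P₂ p q k).Good := by
  cases k
  · exact ⟨trace_dataOp hsp.tr_left hsp.tr_right p q, add_nonneg hp hq⟩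
  · exact ⟨hp, hq⟩

lemma Conf.good_up {p q : ℝ} (hp : 0 ≤ p) (hq : 0 ≤ q) (k : ℕ) :
    (Conf.up H p q k : Conf n).Good := by
  unfold Conf.up
  split_ifs <;> exact ⟨hp, hq⟩

/-- Every instruction preserves the form of the memory, so the quantum evolution reduces without
error to an evolution of a few real and complex parameters. -/
lemma Conf.branches_eq (hsp : SpectralPair P₁ P₂ ρ F lam) (hf : 0 < f) (hf1 : f ≤ 1) (x : Conf n)
    (hx : x.Good) : (distillInstr n f H x.ctrl).branches ρ (x.mem P₁ P₂ ρ f) =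
      (x.step P₁ P₂ f F lam H).map fun y => (y.ctrl, y.mem P₁ P₂ ρ f) := by
  have hρ := hsp.trace_eq_one
  have hμ := fun k => (trialParams hf hf1 k).mu_pos.le
  have hμ1 := fun k => (trialParams hf hf1 k).mu_le_one
  have single : ∀ {s : Stage} {M M' : Op (memSize n) (memSize n)}, M = M' →
    [(s, M)] = [(s, M')] := fun h => by rw [h]
  have pair : ∀ {s s' t t' : Stage} {M M' N N' : Op (memSize n) (memSize n)}, s = s' → t = t' →
    M = M' → N = N' → [(s, M), (t, N)] = [(s', M'), (t', N')] := fun h1 h2 h3 h4 => by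
      rw [h1, h2, h3, h4]
  cases x with
  | start =>
    refine single ?_
    show Instr.loadState ρ (progR n) (Protocol.zeroState (memSize n)) = _
    rw [zeroState_eq_tens, loadState_progR, trace_zeroState, one_smul]
    rfl
  | reload χ t =>
    refine single ?_
    show Instr.loadState ρ (dataR n) (tens (joint (proj 0) χ) (joint (proj 0) ρ)) =
      tens (joint (proj 0) (dataOp P₁ P₂ (t * F) (t * (1 - F)))) (joint (proj 0) ρ)
    rw [loadState_dataR, hx.1, dataOp_smul, ← hsp.eq_dataOp, joint_smul_right, tens_smul_left]
  | prepC k b p q =>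
    refine single ?_
    show Instr.prepState (ctrlQ n) (tens (joint (proj b) (dataOp P₁ P₂ p q)) (joint (proj 0) ρ)) = _
    rw [prepState_ctrlQ, trace_proj, one_smul]
    rfl
  | plusC k p q =>
    refine single ?_
    show conjBy (onQubit (ctrlQ n) plusGate.1)
      (tens (joint (proj 0) (dataOp P₁ P₂ p q)) (joint (proj 0) ρ)) =
      tens (blkOp P₁ P₂ (Blk.plus p).mat (Blk.plus q).mat) (joint (proj 0) ρ)
    rw [joint_dataOp, conjBy_ctrlQ_blkOp, Blk.mat_plus, Blk.mat_plus]
    simp only [Matrix.mul_smul, Matrix.smul_mul]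
  | loadA k r r' =>
    refine single ?_
    show Instr.loadState ρ (progR n) (tens (blkOp P₁ P₂ r.mat r'.mat) (joint (proj 0) ρ)) = _
    rw [loadState_progR, hρ, one_smul]
    rfl
  | prepA k r r' =>
    refine single ?_
    show Instr.prepState (coinQ n) (tens (blkOp P₁ P₂ r.mat r'.mat) (joint (proj 0) ρ)) = _
    rw [prepState_coinQ, trace_proj, one_smul]
    rfl
  | coin k r r' =>
    refine single ?_
    show conjBy (onQubit (coinQ n) (coinGate (stopProb f k)).1)
      (tens (blkOp P₁ P₂ r.mat r'.mat) (joint (proj 0) ρ)) = _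
    rw [conjBy_onQubit_coinQ]
    rfl
  | measQ k r r' =>
    exact pair rfl rfl
      (measState_coinQ_blkOp (coin_apply_zero (hμ k) (hμ1 k)) r r')
      (measState_coinQ_blkOp (coin_apply_one (hμ k) (hμ1 k)) r r')
  | fswap k r r' => rfl
  | loadB k r r' => rfl
  | prepB k r r' =>
    refine single ?_
    show Instr.prepState (coinQ n) (Instr.loadState ρ (progR n)
      (conjBy (fracSwap (swapAngle f k) (regA n) (regB n))
        (tens (blkOp P₁ P₂ r.mat r'.mat) (joint (proj 1) ρ)))) = _
    rw [prep_load_fracSwap, swap_blkOp hsp]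
    rfl
  | unplus k r r' =>
    refine single ?_
    exact conjBy_ctrlQ_blkOp _ _ _ _
  | measC k r r' =>
    refine pair (Conf.ctrl_down _ _ k).symm (Conf.ctrl_up _ _ k).symm ?_ ?_
    · rw [Conf.mem_down]
      exact measState_ctrlQ_blkOp (unplus_apply_zero r) (unplus_apply_zero r') _
    · rw [Conf.mem_up]
      exact measState_ctrlQ_blkOp (unplus_apply_one r) (unplus_apply_one r') _
  | done p q => rfl

lemma Conf.good_step (hsp : SpectralPair P₁ P₂ ρ F lam) (hf : 0 < f) (hf1 : f ≤ 1) (x : Conf n)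
    (hx : x.Good) : ∀ y ∈ x.step P₁ P₂ f F lam H, y.Good := by
  have hμ := fun k => (trialParams hf hf1 k).mu_pos.le
  have hμ1 := fun k => sub_nonneg.mpr (trialParams hf hf1 k).mu_le_one
  have hF := hsp.F_nonneg
  have hF1 := hsp.F_le_one
  cases x <;> simp only [Conf.step, List.mem_cons, List.not_mem_nil, or_false, forall_eq,
    forall_eq_or_imp, IsEmpty.forall_iff, implies_true]
  case start => exact ⟨by rw [trace_zeroState]; simp, zero_le_one⟩
  case reload χ t => exact ⟨mul_nonneg hx.2 hF, mul_nonneg hx.2 (by linarith)⟩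
  case prepC => exact hx
  case plusC => exact ⟨Blk.ok_plus hx.1, Blk.ok_plus hx.2⟩
  case loadA => exact hx
  case prepA => exact hx
  case coin => exact hx
  case measQ k r r' =>
    exact ⟨⟨hx.1.scale (hμ k), hx.2.scale (hμ k)⟩, hx.1.scale (hμ1 k), hx.2.scale (hμ1 k)⟩
  case fswap => exact hx
  case loadB => exact hx
  case prepB k r r' =>
    have h1 := hx.1.tr_nonneg
    have h2 := hx.2.tr_nonneg
    exact ⟨hx.1.upd hF hF1 le_rfl (by linarith), hx.2.upd hsp.lam_nonneg
      (by linarith [hsp.lam_le]) hsp.lam_le (by linarith)⟩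
  case unplus => exact hx
  case measC k r r' =>
    exact ⟨Conf.good_down hsp hx.1.rej_nonneg hx.2.rej_nonneg k,
      Conf.good_up hx.1.acc_nonneg hx.2.acc_nonneg k⟩

lemma Conf.output_eq_zero (x : Conf n) (σ : Op (memSize n) (memSize n))
    (hx : x.ctrl ≠ .done) : (distillInstr n f H x.ctrl).output σ = 0 := by
  cases x <;> first | rfl | exact absurd rfl hx

lemma Conf.output_done (hsp : SpectralPair P₁ P₂ ρ F lam) (p q : ℝ) :
    (distillInstr n f H (Conf.done p q : Conf n).ctrl).output
      ((Conf.done p q).mem P₁ P₂ ρ f) = dataOp P₁ P₂ p q := by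
  show Instr.reducedState (dataR n)
    (tens (joint (proj 1) (dataOp P₁ P₂ p q)) (joint (proj 0) ρ)) = _
  rw [reducedState_dataR, trace_joint, trace_proj, trace_proj, hsp.trace_eq_one]
  simp

end simulation

end

noncomputable section

/-! ### Conservation of probability -/

section mass

variable {n : ℕ} {P₁ P₂ ρ : Op n n} {f F lam : ℝ} {H : ℕ}

lemma trace_loadState_progR (ρ : Op n n) (σ : Op (memSize n) (memSize n)) :
    (Instr.loadState ρ (progR n) σ).trace = ρ.trace * σ.trace := by
  have hext : ∀ (a : Bits (n + 1)) (b : ZMod 2) (w z : Bits n),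
      Function.extend (progR n) z (joinBits a (Fin.cons b w : Bits (n + 1))) =
        joinBits a (Fin.cons b z : Bits (n + 1)) := by
    intro a b w z
    refine bits_ext ?_ ?_
    · rw [extend_progR_regA, joinBits_regA, joinBits_regA]
    · rw [extend_progR_regB, joinBits_regB, coinQ]
      congr 1
      exact congrFun (joinBits_regB a (Fin.cons b w : Bits (n + 1))) 0
  have hprog : ∀ (a : Bits (n + 1)) (b : ZMod 2) (w : Bits n),
      joinBits a (Fin.cons b w : Bits (n + 1)) ∘ progR n = w := by
    intro a b w
    have := congrArg (fun v => v ∘ Fin.succ) (joinBits_regB a (Fin.cons b w : Bits (n + 1)))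
    rw [cons_comp_succ] at this
    exact this
  simp only [Matrix.trace, Matrix.diag_apply, Instr.loadState]
  rw [sum_bits_mem, sum_bits_mem, Finset.mul_sum]
  refine Finset.sum_congr rfl fun a _ => ?_
  rw [sum_bits_succ, sum_bits_succ, Finset.mul_sum]
  refine Finset.sum_congr rfl fun b _ => ?_
  simp only [hext, hprog]
  rw [← Finset.mul_sum, mul_comm]

lemma trace_tens_blkOp (hsp : SpectralPair P₁ P₂ ρ F lam) {R R' B : Matrix (ZMod 2) (ZMod 2) ℂ}
    {r r' : Blk} (hR : R.trace = r.mat.trace) (hR' : R'.trace = r'.mat.trace) (hB : B.trace = 1) :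
    (tens (blkOp P₁ P₂ R R') (joint B ρ)).trace = ((r.tr + r'.tr : ℝ) : ℂ) := by
  rw [trace_tens, trace_blkOp hsp.tr_left hsp.tr_right, hR, hR', Blk.trace_mat, Blk.trace_mat,
    trace_joint, hB, hsp.trace_eq_one]
  push_cast
  ring

lemma Conf.trace_mem (hsp : SpectralPair P₁ P₂ ρ F lam) (x : Conf n) (hx : x.Good) :
    (x.mem P₁ P₂ ρ f).trace = (x.mass : ℂ) := by
  have hρ := hsp.trace_eq_one
  have hd : ∀ (b : ZMod 2) (p q : ℝ), (tens (joint (proj b) (dataOp P₁ P₂ p q))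
      (joint (proj 0) ρ)).trace = ((p + q : ℝ) : ℂ) := by
    intro b p q
    rw [trace_tens, trace_joint, trace_joint, trace_proj, trace_proj, hρ,
      trace_dataOp hsp.tr_left hsp.tr_right]
    simp
  have hU : ∀ k, (fracSwap (swapAngle f k) (regA n) (regB n))ᴴ *
    fracSwap (swapAngle f k) (regA n) (regB n) = 1 := fun k => fracSwap_unitary regA_ne_regB _
  cases x with
  | start => exact (trace_zeroState _).trans (by simp [Conf.mass])
  | reload χ t =>
    show (tens (joint (proj 0) χ) (joint (proj 0) ρ)).trace = (t : ℂ)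
    rw [trace_tens, trace_joint, trace_joint, trace_proj, hρ, hx.1]
    simp
  | prepC k b p q => exact hd b p q
  | plusC k p q => exact hd 0 p q
  | loadA k r r' => exact trace_tens_blkOp hsp rfl rfl (trace_proj 0)
  | prepA k r r' => exact trace_tens_blkOp hsp rfl rfl (trace_proj 0)
  | coin k r r' => exact trace_tens_blkOp hsp rfl rfl (trace_proj 0)
  | measQ k r r' =>
    exact trace_tens_blkOp hsp rfl rfl ((trace_unitary_conj _ _).trans (trace_proj 0))
  | fswap k r r' => exact trace_tens_blkOp hsp rfl rfl (trace_proj 1)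
  | loadB k r r' =>
    exact (trace_conjBy (hU k) _).trans (trace_tens_blkOp hsp rfl rfl (trace_proj 1))
  | prepB k r r' =>
    refine (trace_loadState_progR _ _).trans ?_
    rw [hρ, one_mul]
    exact (trace_conjBy (hU k) _).trans (trace_tens_blkOp hsp rfl rfl (trace_proj 1))
  | unplus k r r' => exact trace_tens_blkOp hsp rfl rfl (trace_proj 0)
  | measC k r r' =>
    exact trace_tens_blkOp hsp (trace_unitary_conj _ _) (trace_unitary_conj _ _) (trace_proj 0)
  | done p q => exact hd 1 p q

lemma Conf.mass_nonneg (x : Conf n) (hx : x.Good) : 0 ≤ x.mass := by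
  cases x
  case start => exact zero_le_one
  case reload => exact hx.2
  case prepC => exact add_nonneg hx.1 hx.2
  case plusC => exact add_nonneg hx.1 hx.2
  case done => exact add_nonneg hx.1 hx.2
  all_goals exact add_nonneg hx.1.tr_nonneg hx.2.tr_nonneg

lemma Conf.mass_down (p q : ℝ) (k : ℕ) : (Conf.down P₁ P₂ p q k).mass = p + q := by
  cases k <;> rfl

lemma Conf.mass_up (p q : ℝ) (k : ℕ) : (Conf.up H p q k : Conf n).mass = p + q := by
  unfold Conf.up
  split_ifs <;> rfl

lemma tr_swapBlk_add (k : ℕ) (r r' : Blk) :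
    (swapBlk f k F F (r.tr + r'.tr) r).tr + (swapBlk f k lam (1 - F) (r.tr + r'.tr) r').tr =
      r.tr + r'.tr := by
  rw [swapBlk, swapBlk, Blk.tr_upd, Blk.tr_upd]
  linear_combination (r.tr + r'.tr) * Real.cos_sq_add_sin_sq (swapAngle f k)

/-- The weights of the output along the state and orthogonally to it. -/
def Conf.out : Conf n → ℝ × ℝ
  | .done p q => (p, q)
  | _ => 0

lemma Conf.output_eq (hsp : SpectralPair P₁ P₂ ρ F lam) (x : Conf n) :
    (distillInstr n f H x.ctrl).output (x.mem P₁ P₂ ρ f) = dataOp P₁ P₂ x.out.1 x.out.2 := by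
  cases x
  case done p q => exact Conf.output_done hsp p q
  all_goals
    refine (Conf.output_eq_zero _ _ ?_).trans (by simp [Conf.out, dataOp])
    simp [Conf.ctrl]

lemma Conf.out_nonneg (x : Conf n) (hx : x.Good) : 0 ≤ x.out.1 ∧ 0 ≤ x.out.2 := by
  cases x
  case done => exact hx
  all_goals exact ⟨le_rfl, le_rfl⟩

lemma Conf.mass_step (x : Conf n) :
    x.mass = x.out.1 + x.out.2 + ((x.step P₁ P₂ f F lam H).map Conf.mass).sum := by
  cases x
  case plusC k p q =>
    simp only [Conf.step, Conf.out, Conf.mass, List.map_cons, List.map_nil, List.sum_cons,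
      List.sum_nil, Blk.tr, Blk.plus, Prod.fst_zero, Prod.snd_zero]
    ring
  case prepB k r r' =>
    simp only [Conf.step, Conf.out, Conf.mass, List.map_cons, List.map_nil, List.sum_cons,
      List.sum_nil, tr_swapBlk_add, Prod.fst_zero, Prod.snd_zero]
    ring
  case measC k r r' =>
    simp only [Conf.step, Conf.out, List.map_cons, List.map_nil, List.sum_cons,
      List.sum_nil, Conf.mass_down, Conf.mass_up, Prod.fst_zero, Prod.snd_zero]
    rw [Conf.mass, ← Blk.acc_add_rej, ← Blk.acc_add_rej]
    ring
  all_goals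
    simp only [Conf.step, Conf.out, Conf.mass, List.map_cons, List.map_nil, List.sum_cons,
      List.sum_nil, Blk.tr_scale, Prod.fst_zero, Prod.snd_zero]
    ring

end mass

end

noncomputable section

/-! ### Potentials of the random walk -/

/-- The coefficients of a potential: `w` is the cost of a step and `e` the cost of an output
orthogonal to the state. -/
structure Pot where
  /-- value of a restart -/
  C : ℝ
  /-- linear coefficient orthogonally to the state -/
  X₁ : ℝ
  /-- quadratic coefficient orthogonally to the state -/
  X₂ : ℝ
  /-- linear coefficient along the state -/
  Y : ℝ
  /-- bound on the scale -/
  G : ℝ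
  /-- cost of a step -/
  w : ℝ
  /-- cost of an output orthogonal to the state -/
  e : ℝ

/-- The scale of level `k`. -/
def scaleAt (k : ℕ) : ℝ := (11 / 10) ^ k

lemma scaleAt_pos (k : ℕ) : 0 < scaleAt k := by unfold scaleAt; positivity

lemma one_le_scaleAt (k : ℕ) : 1 ≤ scaleAt k := one_le_pow₀ (by norm_num)

lemma scaleAt_mono {k l : ℕ} (h : k ≤ l) : scaleAt k ≤ scaleAt l :=
  pow_le_pow_right₀ (by norm_num) h

lemma scaleAt_add (k l : ℕ) : scaleAt (k + l) = (11 / 10) ^ l * scaleAt k := by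
  rw [scaleAt, pow_add, mul_comm]; rfl

lemma levelRate_eq (k : ℕ) : levelRate k = 1 / (200 * scaleAt k) := rfl

namespace Pot

/-- The value of the state at level `k`. -/
def state (W : Pot) (k : ℕ) : ℝ := W.C / (11 / 10 * scaleAt k) + W.Y * (W.G - scaleAt k)

/-- The value of an orthogonal state at level `k`. -/
def perp (W : Pot) (k : ℕ) : ℝ := W.C + W.X₁ * scaleAt k + W.X₂ * scaleAt k ^ 2

/-- The value of the state after a rejected trial. -/
def downState (W : Pot) : ℕ → ℝ
  | 0 => W.C
  | k + 1 => W.state k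

/-- The value of an orthogonal state after a rejected trial. -/
def downPerp (W : Pot) : ℕ → ℝ
  | 0 => W.C
  | k + 1 => W.perp k

/-- The conditions under which the potential decreases along the walk. -/
structure Valid (W : Pot) (f F : ℝ) (H : ℕ) : Prop where
  C_nonneg : 0 ≤ W.C
  X₁_nonneg : 0 ≤ W.X₁
  X₂_nonneg : 0 ≤ W.X₂
  Y_nonneg : 0 ≤ W.Y
  w_nonneg : 0 ≤ W.w
  e_nonneg : 0 ≤ W.e
  -- A trial at a level below `H` leads at most to level `H + 7`, which leaves a factor `11/10` to
  -- spare below `G`.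
  G_eq : W.G = scaleAt (H + 8)
  YG_le : W.Y * W.G ≤ W.C / 11
  -- The cost of a trial at scale `x` is at most `2000 w x / f²`; it must fit into the margins `X₁ x
  -- / 25` and `Y x / 5` of the drift inequalities. Along the state, contamination has to fit as
  -- well.
  trial_perp : 2000 * W.w / f ^ 2 ≤ W.X₁ / 25
  trial_state : 2000 * W.w / f ^ 2 +
    (1 - F) * (W.X₁ * (11 / 10) ^ 8 + W.X₂ * (11 / 10) ^ 16) / 200 ≤ W.Y / 5
  restart : W.w + F * W.state 0 + (1 - F) * W.perp 0 ≤ W.C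
  done_state : W.w ≤ W.C / W.G
  done_perp : W.w + W.e ≤ W.C + W.X₂ * scaleAt H ^ 2

/-- The potential at the start of a round of the inner loop of a trial. -/
def trial (W : Pot) (f F lam : ℝ) (k : ℕ) (r r' : Blk) : ℝ :=
  5 * W.w / stopProb f k * (r.tr + r'.tr) + trialValue f (levelRate k) F lam (W.state (k + 8))
    (W.downState k) (W.perp (k + 8)) (W.downPerp k) r r'

/-- The potential at the end of a trial. -/
def endValue (W : Pot) (k : ℕ) (r r' : Blk) : ℝ :=
  stopValue (W.state (k + 8)) (W.downState k) (W.perp (k + 8)) (W.downPerp k) r r'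

/-- The potential of a configuration. -/
def value {n : ℕ} (W : Pot) (f F lam : ℝ) : Conf n → ℝ
  | .start => W.w + W.C
  | .reload _ t => t * W.C
  | .prepC k _ p q => p * W.state k + q * W.perp k
  | .plusC k p q => 3 * W.w * (p + q) + W.trial f F lam k (Blk.plus p) (Blk.plus q)
  | .loadA k r r' => 2 * W.w * (r.tr + r'.tr) + W.trial f F lam k r r'
  | .prepA k r r' => W.w * (r.tr + r'.tr) + W.trial f F lam k r r'
  | .coin k r r' => W.trial f F lam k r r'
  | .measQ k r r' => 4 * W.w * (r.tr + r'.tr) +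
      W.endValue k (r.scale (stopProb f k)) (r'.scale (stopProb f k)) +
      W.trial f F lam k
        (swapBlk f k F F ((r.scale (1 - stopProb f k)).tr + (r'.scale (1 - stopProb f k)).tr)
          (r.scale (1 - stopProb f k)))
        (swapBlk f k lam (1 - F)
          ((r.scale (1 - stopProb f k)).tr + (r'.scale (1 - stopProb f k)).tr)
          (r'.scale (1 - stopProb f k)))
  | .fswap k r r' => 3 * W.w * (r.tr + r'.tr) + W.trial f F lam k
      (swapBlk f k F F (r.tr + r'.tr) r) (swapBlk f k lam (1 - F) (r.tr + r'.tr) r')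
  | .loadB k r r' => 2 * W.w * (r.tr + r'.tr) + W.trial f F lam k
      (swapBlk f k F F (r.tr + r'.tr) r) (swapBlk f k lam (1 - F) (r.tr + r'.tr) r')
  | .prepB k r r' => W.w * (r.tr + r'.tr) + W.trial f F lam k
      (swapBlk f k F F (r.tr + r'.tr) r) (swapBlk f k lam (1 - F) (r.tr + r'.tr) r')
  | .unplus k r r' => 2 * W.w * (r.tr + r'.tr) + W.endValue k r r'
  | .measC k r r' => W.w * (r.tr + r'.tr) + W.endValue k r r'
  | .done p q => W.w * (p + q) + W.e * q

end Pot

/-- The level of a configuration. -/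
def Conf.level {n : ℕ} : Conf n → ℕ
  | .start => 0
  | .reload _ _ => 0
  | .prepC k _ _ _ => k
  | .plusC k _ _ => k
  | .loadA k _ _ => k
  | .prepA k _ _ => k
  | .coin k _ _ => k
  | .measQ k _ _ => k
  | .fswap k _ _ => k
  | .loadB k _ _ => k
  | .prepB k _ _ => k
  | .unplus k _ _ => k
  | .measC k _ _ => k
  | .done _ _ => 0

section level

variable {n : ℕ} {P₁ P₂ : Op n n} {f F lam : ℝ} {H : ℕ}

lemma Conf.level_down (p q : ℝ) (k : ℕ) : (Conf.down P₁ P₂ p q k).level ≤ k := by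
  cases k with
  | zero => exact le_rfl
  | succ k => exact Nat.le_succ k

lemma Conf.level_up (hH : 0 < H) (p q : ℝ) (k : ℕ) : (Conf.up H p q k : Conf n).level < H := by
  unfold Conf.up
  split_ifs with h
  · exact hH
  · exact not_le.mp h

lemma Conf.level_step (hH : 0 < H) (x : Conf n) (hx : x.level < H) :
    ∀ y ∈ x.step P₁ P₂ f F lam H, y.level < H := by
  cases x <;> simp only [Conf.step, List.mem_cons, List.not_mem_nil, or_false, forall_eq,
    forall_eq_or_imp, IsEmpty.forall_iff, implies_true]
  case measQ => exact ⟨hx, hx⟩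
  case measC k r r' => exact ⟨(Conf.level_down _ _ k).trans_lt hx, Conf.level_up hH _ _ k⟩
  all_goals exact hx

end level

lemma Pot.value_down {n : ℕ} {P₁ P₂ : Op n n} (W : Pot) (f F lam : ℝ) (p q : ℝ) (k : ℕ) :
    W.value f F lam (Conf.down P₁ P₂ p q k) = p * W.downState k + q * W.downPerp k := by
  cases k with
  | zero => exact add_mul p q W.C
  | succ k => rfl

/-! ### The potentials are nonnegative supermartingales -/

namespace Pot.Valid

variable {W : Pot} {f F lam : ℝ} {H : ℕ} (h : W.Valid f F H)
include h

lemma G_pos : 0 < W.G := h.G_eq ▸ scaleAt_pos _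

lemma state_nonneg {k : ℕ} (hk : k ≤ H + 8) : 0 ≤ W.state k := by
  have h1 := scaleAt_pos k
  have h2 : scaleAt k ≤ W.G := h.G_eq ▸ scaleAt_mono hk
  have h3 := h.C_nonneg
  have h4 := mul_nonneg h.Y_nonneg (sub_nonneg.mpr h2)
  unfold Pot.state
  positivity

/-- The first term of `state` is at most `10 C / 11`, and `YG_le` leaves `C / 11` for the second. -/
lemma state_le (k : ℕ) : W.state k ≤ W.C := by
  have h1 := one_le_scaleAt k
  have h2 : W.C / (11 / 10 * scaleAt k) ≤ W.C / (11 / 10) :=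
    div_le_div_of_nonneg_left h.C_nonneg (by norm_num) (by linarith)
  have h3 := mul_nonneg h.Y_nonneg (scaleAt_pos k).le
  have h4 := h.YG_le
  unfold Pot.state
  rw [mul_sub]
  linarith

lemma le_perp (k : ℕ) : W.C ≤ W.perp k := by
  have h1 := mul_nonneg h.X₁_nonneg (scaleAt_pos k).le
  have h2 := mul_nonneg h.X₂_nonneg (sq_nonneg (scaleAt k))
  unfold Pot.perp
  linarith

lemma perp_nonneg (k : ℕ) : 0 ≤ W.perp k := h.C_nonneg.trans (h.le_perp k)

lemma downState_nonneg {k : ℕ} (hk : k ≤ H) : 0 ≤ W.downState k := by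
  cases k with
  | zero => exact h.C_nonneg
  | succ k => exact h.state_nonneg (by omega)

lemma downState_le (k : ℕ) : W.downState k ≤ W.C := by
  cases k with
  | zero => exact le_rfl
  | succ k => exact h.state_le k

lemma downPerp_nonneg (k : ℕ) : 0 ≤ W.downPerp k := by
  cases k with
  | zero => exact h.C_nonneg
  | succ k => exact h.perp_nonneg k

/-- A rejection at level 0 restarts; the value `C` of the restart is below the formula for `state`
continued to level `-1`, so the bottom needs no separate drift inequality. -/
lemma downState_le' {k : ℕ} (hk : k ≤ H) : W.downState k ≤
    W.C / scaleAt k + W.Y * (W.G - scaleAt k / (11 / 10)) := by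
  cases k with
  | zero =>
    have h1 : 1 ≤ W.G := h.G_eq ▸ one_le_scaleAt _
    have h2 : 0 ≤ W.Y * (W.G - 1 / (11 / 10)) := mul_nonneg h.Y_nonneg (by norm_num; linarith)
    show W.C ≤ _
    rw [show scaleAt 0 = 1 from pow_zero _, div_one]
    linarith
  | succ k =>
    show W.state k ≤ _
    rw [scaleAt_add, pow_one, Pot.state, mul_div_cancel_left₀ _ (by norm_num)]

lemma downPerp_le (k : ℕ) : W.downPerp k ≤
    W.C + W.X₁ * (scaleAt k / (11 / 10)) + W.X₂ * (scaleAt k / (11 / 10)) ^ 2 := by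
  cases k with
  | zero =>
    have h0 := scaleAt_pos 0
    have h1 := mul_nonneg h.X₁_nonneg (div_pos h0 (show (0 : ℝ) < 11 / 10 by norm_num)).le
    have h2 := mul_nonneg h.X₂_nonneg (sq_nonneg (scaleAt 0 / (11 / 10)))
    show W.C ≤ _
    linarith
  | succ k =>
    show W.perp k ≤ _
    rw [scaleAt_add, pow_one, Pot.perp, mul_div_cancel_left₀ _ (by norm_num)]

lemma trial_nonneg (hf : 0 < f) (hf1 : f ≤ 1) (hF : 0 ≤ F) (hF1 : F ≤ 1) {k : ℕ} (hk : k < H)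
    {r r' : Blk} (hr : r.Ok) (hr' : r'.Ok) : 0 ≤ W.trial f F lam k r r' := by
  have hμ := (trialParams hf hf1 k).mu_pos
  have h1 := trialValue_nonneg (f := f) (lam := lam) (levelRate_pos k).le
    ((levelRate_le k).trans (by norm_num)) hF hF1 (h.state_nonneg (k := k + 8) (by omega))
    (h.downState_nonneg hk.le) (h.perp_nonneg (k + 8)) (h.downPerp_nonneg k) hr hr'
  have h2 := hr.tr_nonneg
  have h3 := hr'.tr_nonneg
  have h4 := h.w_nonneg
  unfold Pot.trial
  positivity

lemma endValue_nonneg {k : ℕ} (hk : k < H) {r r' : Blk} (hr : r.Ok) (hr' : r'.Ok) :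
    0 ≤ W.endValue k r r' :=
  stopValue_nonneg (h.state_nonneg (k := k + 8) (by omega))
    (h.downState_nonneg hk.le) (h.perp_nonneg (k + 8)) (h.downPerp_nonneg k) hr hr'

/-- Four instructions open a trial and each round takes five, with `1 / μ` rounds on average. Since
`1 ≤ 1/μ ≤ 204 x / f²`, the total is at most `9 · 204 x / f²`. -/
lemma step_cost_le (hf : 0 < f) (hf1 : f ≤ 1) (k : ℕ) :
    4 * W.w + 5 * W.w / stopProb f k ≤ 2000 * W.w / f ^ 2 * scaleAt k := by
  have hη := levelRate_pos k
  have hη1 := levelRate_le k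
  have hx := scaleAt_pos k
  have hμ := (trialParams hf hf1 k).mu_pos
  have hμ1 := (trialParams hf hf1 k).mu_le_one
  have hμlow : f ^ 2 / (204 * scaleAt k) ≤ stopProb f k := by
    have hf2 : f ^ 2 ≤ 1 := pow_le_one₀ hf.le hf1
    have h1 : levelRate k * f ^ 2 ≤ 1 / 200 :=
      (mul_le_mul hη1 hf2 (sq_nonneg f) (by norm_num)).trans (by norm_num)
    have h2 : f ^ 2 / (204 * scaleAt k) = levelRate k * f ^ 2 * (200 / 204) := by
      rw [levelRate_eq]; field_simp
    rw [h2, stopProb, le_div_iff₀ (by positivity), mul_assoc]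
    refine mul_le_mul_of_nonneg_left ?_ (by positivity)
    linarith
  have h3 : 1 / stopProb f k ≤ 204 * scaleAt k / f ^ 2 := by
    rw [one_div, inv_le_comm₀ hμ (by positivity), inv_div]
    exact hμlow
  have h4 : 1 ≤ 1 / stopProb f k := by rw [le_div_iff₀ hμ]; linarith
  have h5 : 4 + 5 * (1 / stopProb f k) ≤ 2000 * (scaleAt k / f ^ 2) := by
    have : 204 * scaleAt k / f ^ 2 = 204 * (scaleAt k / f ^ 2) := by ring
    have : 0 < scaleAt k / f ^ 2 := by positivity
    linarith
  have h6 := mul_le_mul_of_nonneg_left h5 h.w_nonneg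
  calc _ = W.w * (4 + 5 * (1 / stopProb f k)) := by ring
    _ ≤ _ := h6
    _ = _ := by ring

/-- One whole trial, as a step of the walk: `trial_state_le` and `trial_perp_le` weighted by `p` and
`q`. -/
lemma prepC_le (hf : 0 < f) (hfF : f ≤ F) (hF1 : F ≤ 1) (hl : 0 ≤ lam) (hlf : lam ≤ f / 4)
    {k : ℕ} (hk : k < H) {p q : ℝ} (hp : 0 ≤ p) (hq : 0 ≤ q) :
    4 * W.w * (p + q) + W.trial f F lam k (Blk.plus p) (Blk.plus q) ≤
      p * W.state k + q * W.perp k := by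
  have hf1 : f ≤ 1 := hfF.trans hF1
  have hF0 : 0 ≤ F := hf.le.trans hfF
  have hη := levelRate_pos k
  have hη1 := levelRate_le k
  have hx := scaleAt_pos k
  have hx1 := one_le_scaleAt k
  have hcost := h.step_cost_le hf hf1 k
  have hX₁ := h.X₁_nonneg
  have hX₂ := h.X₂_nonneg
  obtain ⟨M, hM⟩ : ∃ M, M = W.X₁ * ((11 / 10) ^ 8 * scaleAt k) +
    W.X₂ * ((11 / 10) ^ 8 * scaleAt k) ^ 2 := ⟨_, rfl⟩
  have hup : W.perp (k + 8) = W.C + W.X₁ * ((11 / 10) ^ 8 * scaleAt k) +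
      W.X₂ * ((11 / 10) ^ 8 * scaleAt k) ^ 2 := by rw [Pot.perp, scaleAt_add]
  have hd' : W.downPerp k ≤ W.C + M := by
    refine (h.downPerp_le k).trans ?_
    have h1 : scaleAt k / (11 / 10) ≤ (11 / 10) ^ 8 * scaleAt k := by
      norm_num; linarith
    have h2 : 0 ≤ scaleAt k / (11 / 10) := by positivity
    have h3 := mul_le_mul_of_nonneg_left h1 hX₁
    have h4 := mul_le_mul_of_nonneg_left (pow_le_pow_left₀ h2 h1 2) hX₂
    rw [hM]
    linarith
  have hst := trial_state_le (x := scaleAt k) (η := levelRate k) (C := W.C) (Y := W.Y) (G := W.G)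
    (M := M) (F := F) (L := 4 * W.w + 5 * W.w / stopProb f k)
    (a := (1 - 1 / (1 + (F / f) ^ 2)) / 2) (u := W.state (k + 8)) (d := W.downState k)
    (u' := W.perp (k + 8)) (d' := W.downPerp k) hx (levelRate_eq k)
    (hη1.trans (by norm_num))
    (by
      have h1 : scaleAt (k + 9) ≤ W.G := h.G_eq ▸ scaleAt_mono (by omega)
      rw [scaleAt_add] at h1
      refine le_trans ?_ h1
      norm_num
      linarith)
    -- Eigenvalue `F ≥ f`: acceptance at least `1/4`.
    (by
      have h1 : 1 ≤ F / f := by rw [le_div_iff₀ hf]; linarith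
      have h2 : 1 ≤ (F / f) ^ 2 := one_le_pow₀ h1
      have h3 : 1 / (1 + (F / f) ^ 2) ≤ 1 / 2 :=
        one_div_le_one_div_of_le (by norm_num) (by linarith)
      linarith)
    (by
      have : 0 ≤ 1 / (1 + (F / f) ^ 2) := by positivity
      linarith)
    hF0 hF1 h.C_nonneg h.Y_nonneg
    (by rw [Pot.state, scaleAt_add]; ring_nf) (h.state_le _) (h.downState_le' hk.le)
    (h.downState_le k) (by rw [hup, hM]; linarith) hd'
    (by
      have h1 := mul_le_mul_of_nonneg_right h.trial_state hx.le
      have h2 : levelRate k * ((1 - F) * M) = (1 - F) * (W.X₁ * (11 / 10) ^ 8 +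
          W.X₂ * (11 / 10) ^ 16 * scaleAt k) / 200 := by
        rw [levelRate_eq, hM]; field_simp
      have h3 : (1 - F) * (W.X₁ * (11 / 10) ^ 8 + W.X₂ * (11 / 10) ^ 16 * scaleAt k) / 200 ≤
          (1 - F) * (W.X₁ * (11 / 10) ^ 8 + W.X₂ * (11 / 10) ^ 16) / 200 * scaleAt k := by
        have h4 : 0 ≤ (1 - F) * (W.X₁ * (11 / 10) ^ 8) / 200 * (scaleAt k - 1) := by
          have : 0 ≤ 1 - F := by linarith
          have : 0 ≤ scaleAt k - 1 := by linarith
          positivity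
        linarith
      rw [h2]
      linarith)
  have hpe := trial_perp_le (x := scaleAt k) (η := levelRate k) (C := W.C) (X₁ := W.X₁)
    (X₂ := W.X₂) (F := F) (L := 4 * W.w + 5 * W.w / stopProb f k)
    (b := (1 - 1 / (1 + (lam / f) ^ 2)) / 2) (u := W.state (k + 8)) (d := W.downState k)
    (u' := W.perp (k + 8)) (d' := W.downPerp k) hx hη.le hη1
    -- Eigenvalue `lam ≤ f/4`: acceptance at most `(1 - 16/17) / 2 = 1/34`.
    (by
      have h1 : lam / f ≤ 1 / 4 := by rw [div_le_iff₀ hf]; linarith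
      have h2 : (lam / f) ^ 2 ≤ (1 / 4) ^ 2 := pow_le_pow_left₀ (by positivity) h1 2
      have h3 : 1 / (1 + (1 / 4) ^ 2) ≤ 1 / (1 + (lam / f) ^ 2) :=
        one_div_le_one_div_of_le (by positivity) (by linarith)
      norm_num at h3 ⊢
      linarith)
    hF0 hF1 hX₁ hX₂ (h.state_le _) (h.downState_le k) hup (h.downPerp_le k)
    (by
      have h1 := mul_le_mul_of_nonneg_right h.trial_perp hx.le
      linarith)
  have h1 := mul_le_mul_of_nonneg_left hst hp
  have h2 := mul_le_mul_of_nonneg_left hpe hq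
  have htr : (Blk.plus p).tr + (Blk.plus q).tr = p + q := by
    simp only [Blk.tr, Blk.plus]; ring
  rw [Pot.trial, trialValue_plus, htr]
  rw [show W.C + W.X₁ * scaleAt k + W.X₂ * scaleAt k ^ 2 = W.perp k from rfl] at h2
  rw [show W.C / (11 / 10 * scaleAt k) + W.Y * (W.G - scaleAt k) = W.state k from rfl] at h1
  linarith

/-- Halting costs no more than the formulas at level `k + 8`, so the top needs no separate drift
inequality either. -/
lemma value_up {n : ℕ} {k : ℕ} (hk : k < H) {p q : ℝ} (hp : 0 ≤ p) (hq : 0 ≤ q) :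
    W.value f F lam (Conf.up H p q k : Conf n) ≤ p * W.state (k + 8) + q * W.perp (k + 8) := by
  unfold Conf.up
  split_ifs with hkH
  · have h1 : W.w ≤ W.state (k + 8) := by
      have hG := h.G_pos
      have h2 : scaleAt (k + 8) ≤ W.G := h.G_eq ▸ scaleAt_mono (by omega)
      have h3 : scaleAt (k + 8 + 1) ≤ W.G := h.G_eq ▸ scaleAt_mono (by omega)
      rw [scaleAt_add _ 1, pow_one] at h3
      have h4 : W.C / W.G ≤ W.C / (11 / 10 * scaleAt (k + 8)) :=
        div_le_div_of_nonneg_left h.C_nonneg (mul_pos (by norm_num) (scaleAt_pos _)) h3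
      have h5 := mul_nonneg h.Y_nonneg (sub_nonneg.mpr h2)
      have h6 := h.done_state
      unfold Pot.state
      linarith
    have h2 : W.w + W.e ≤ W.perp (k + 8) := by
      have h3 := pow_le_pow_left₀ (scaleAt_pos H).le (scaleAt_mono hkH) 2
      have h4 := mul_le_mul_of_nonneg_left h3 h.X₂_nonneg
      have h5 := mul_nonneg h.X₁_nonneg (scaleAt_pos (k + 8)).le
      have h6 := h.done_perp
      unfold Pot.perp
      linarith
    have h3 := mul_le_mul_of_nonneg_left h1 hp
    have h4 := mul_le_mul_of_nonneg_left h2 hq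
    show W.w * (p + q) + W.e * q ≤ _
    linarith
  · exact le_rfl

lemma value_nonneg {n : ℕ} (hf : 0 < f) (hf1 : f ≤ 1) (hF : 0 ≤ F) (hF1 : F ≤ 1) (hl : 0 ≤ lam)
    (hlF : lam ≤ 1 - F) (x : Conf n) (hx : x.Good) (hxl : x.level < H) :
    0 ≤ W.value f F lam x := by
  have hw := h.w_nonneg
  have hμ := fun k => (trialParams hf hf1 k).mu_pos.le
  have hμ1 := fun k => sub_nonneg.mpr (trialParams hf hf1 k).mu_le_one
  have hsw : ∀ {k : ℕ} {r r' : Blk}, k < H → r.Ok → r'.Ok → 0 ≤ W.trial f F lam k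
      (swapBlk f k F F (r.tr + r'.tr) r) (swapBlk f k lam (1 - F) (r.tr + r'.tr) r') := by
    intro k r r' hk hr hr'
    have h1 := hr.tr_nonneg
    have h2 := hr'.tr_nonneg
    exact h.trial_nonneg hf hf1 hF hF1 hk (hr.upd hF hF1 le_rfl (by linarith))
      (hr'.upd hl (by linarith) hlF (by linarith))
  have hT : ∀ {r r' : Blk}, r.Ok → r'.Ok → ∀ {c : ℝ}, 0 ≤ c → 0 ≤ c * W.w * (r.tr + r'.tr) :=
    fun hr hr' _ hc => mul_nonneg (mul_nonneg hc hw) (add_nonneg hr.tr_nonneg hr'.tr_nonneg)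
  cases x with
  | start => exact add_nonneg hw h.C_nonneg
  | reload χ t => exact mul_nonneg hx.2 h.C_nonneg
  | prepC k b p q =>
    exact add_nonneg (mul_nonneg hx.1 (h.state_nonneg (hxl.le.trans (Nat.le_add_right _ _))))
      (mul_nonneg hx.2 (h.perp_nonneg k))
  | plusC k p q =>
    exact add_nonneg (mul_nonneg (by positivity) (add_nonneg hx.1 hx.2))
      (h.trial_nonneg hf hf1 hF hF1 hxl (Blk.ok_plus hx.1) (Blk.ok_plus hx.2))
  | loadA k r r' =>
    exact add_nonneg (hT hx.1 hx.2 (by norm_num)) (h.trial_nonneg hf hf1 hF hF1 hxl hx.1 hx.2)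
  | prepA k r r' =>
    exact add_nonneg (mul_nonneg hw (add_nonneg hx.1.tr_nonneg hx.2.tr_nonneg))
      (h.trial_nonneg hf hf1 hF hF1 hxl hx.1 hx.2)
  | coin k r r' => exact h.trial_nonneg hf hf1 hF hF1 hxl hx.1 hx.2
  | measQ k r r' =>
    exact add_nonneg (add_nonneg (hT hx.1 hx.2 (by norm_num))
      (h.endValue_nonneg hxl (hx.1.scale (hμ k)) (hx.2.scale (hμ k))))
      (hsw hxl (hx.1.scale (hμ1 k)) (hx.2.scale (hμ1 k)))
  | fswap k r r' => exact add_nonneg (hT hx.1 hx.2 (by norm_num)) (hsw hxl hx.1 hx.2)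
  | loadB k r r' => exact add_nonneg (hT hx.1 hx.2 (by norm_num)) (hsw hxl hx.1 hx.2)
  | prepB k r r' =>
    exact add_nonneg (mul_nonneg hw (add_nonneg hx.1.tr_nonneg hx.2.tr_nonneg))
      (hsw hxl hx.1 hx.2)
  | unplus k r r' =>
    exact add_nonneg (hT hx.1 hx.2 (by norm_num)) (h.endValue_nonneg hxl hx.1 hx.2)
  | measC k r r' =>
    exact add_nonneg (mul_nonneg hw (add_nonneg hx.1.tr_nonneg hx.2.tr_nonneg))
      (h.endValue_nonneg hxl hx.1 hx.2)
  | done p q =>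
    exact add_nonneg (mul_nonneg hw (add_nonneg hx.1 hx.2)) (mul_nonneg h.e_nonneg hx.2)

/-- The supermartingale property at every instruction. Within a trial it is bookkeeping around
`trialValue_step`; the inequalities with content are `restart`, `prepC_le` and `value_up`. -/
lemma value_step {n : ℕ} {P₁ P₂ : Op n n} (hf : 0 < f) (hfF : f ≤ F) (hF1 : F ≤ 1)
    (hl : 0 ≤ lam) (hlf : lam ≤ f / 4) (x : Conf n) (hx : x.Good) (hxl : x.level < H) :
    W.w * x.mass + W.e * x.out.2 + ((x.step P₁ P₂ f F lam H).map (W.value f F lam)).sum ≤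
      W.value f F lam x := by
  have hf1 : f ≤ 1 := hfF.trans hF1
  cases x <;> simp only [Conf.step, Conf.out, List.map_cons, List.map_nil, List.sum_cons,
      List.sum_nil, Conf.mass, Prod.snd_zero, mul_zero, add_zero]
  case start => simp only [Pot.value]; linarith
  case reload χ t =>
    have h1 := mul_le_mul_of_nonneg_left h.restart hx.2
    simp only [Pot.value]
    linarith
  case prepC k b p q =>
    have h1 := h.prepC_le (k := k) hf hfF hF1 hl hlf hxl hx.1 hx.2
    simp only [Pot.value]
    linarith
  case plusC k p q =>
    have htr : (Blk.plus p).tr + (Blk.plus q).tr = p + q := by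
      simp only [Blk.tr, Blk.plus]; ring
    simp only [Pot.value, htr]
    linarith
  case loadA => simp only [Pot.value]; linarith
  case prepA => simp only [Pot.value]; linarith
  case coin k r r' =>
    have h1 := (trialParams hf hf1 k).trialValue_step F lam (W.state (k + 8)) (W.downState k)
      (W.perp (k + 8)) (W.downPerp k) r r'
    have hμ := (trialParams hf hf1 k).mu_pos.ne'
    simp only [Pot.value, Pot.trial, Pot.endValue, tr_swapBlk_add]
    have h2 : ∀ (x w : ℝ) (T : ℝ) (b : Blk), swapBlk f k x w T b =
      b.upd (Real.cos (swapAngle f k)) (Real.sin (swapAngle f k)) x w T := fun _ _ _ _ => rfl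
    -- The mean cost of a geometric number of rounds: one round, then the same again with
    -- probability `1 - μ`.
    have h3 : 5 * W.w / stopProb f k * (r.tr + r'.tr) = 5 * W.w * (r.tr + r'.tr) +
        5 * W.w / stopProb f k * ((1 - stopProb f k) * r.tr + (1 - stopProb f k) * r'.tr) := by
      field_simp
      ring
    rw [h3, ← h1, ← h2, ← h2]
    simp only [Blk.tr_scale]
    linarith
  case measQ k r r' =>
    simp only [Pot.value, Blk.tr_scale]
    have h1 := mul_nonneg (mul_nonneg h.w_nonneg (trialParams hf hf1 k).mu_pos.le)
      (add_nonneg hx.1.tr_nonneg hx.2.tr_nonneg)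
    linarith
  case fswap => simp only [Pot.value]; linarith
  case loadB => simp only [Pot.value]; linarith
  case prepB => simp only [Pot.value]; linarith
  case unplus => simp only [Pot.value]; linarith
  case measC k r r' =>
    have h1 := h.value_up (n := n) (f := f) (F := F) (lam := lam) (k := k) hxl
      hx.1.acc_nonneg hx.2.acc_nonneg
    rw [W.value_down]
    show _ ≤ W.w * (r.tr + r'.tr) + W.endValue k r r'
    simp only [Pot.endValue, stopValue]
    linarith
  case done p q => simp only [Pot.value]; linarith

end Pot.Valid

end

noncomputable section

/-! ### The two potentials -/

/-- The potential that bounds the expected number of steps. -/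
def costPot (f : ℝ) (H : ℕ) : Pot where
  C := 11 * (1 / f + 7 * (2000 / f ^ 2) * scaleAt (H + 8) + 25 * (2000 / f ^ 2) * ((1 - f) / f))
  X₁ := 25 * (2000 / f ^ 2)
  X₂ := 0
  Y := 7 * (2000 / f ^ 2)
  G := scaleAt (H + 8)
  w := 1
  e := 0

/-- The potential that bounds the error of the output. -/
def errorPot (F ε : ℝ) (H : ℕ) : Pot where
  C := ε
  X₁ := 0
  X₂ := 1 / scaleAt H ^ 2
  Y := 12 / 100 * (1 - F) / scaleAt H ^ 2
  G := scaleAt (H + 8)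
  w := 0
  e := 1

/-- `X₁` and `Y` are the least multiples that absorb the cost of a trial, up to rounding. A restart
reaches the state with weight `F`, where the value drops by `C / 11`; the three terms of `C` pay
respectively for the step, for `Y G` and for `X₁` in case the copy is orthogonal. -/
lemma costPot_valid {f F : ℝ} (hf : 0 < f) (hfF : f ≤ F) (hF1 : F ≤ 1) (H : ℕ) :
    (costPot f H).Valid f F H := by
  have hf1 : f ≤ 1 := hfF.trans hF1
  have hG := one_le_scaleAt (H + 8)
  have hf2 : f ^ 2 ≤ 1 := pow_le_one₀ hf.le hf1
  have h1f : 0 ≤ (1 - f) / f := div_nonneg (by linarith) hf.le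
  obtain ⟨D, hD⟩ : ∃ D, D = 2000 / f ^ 2 := ⟨_, rfl⟩
  have hD1 : 2000 ≤ D := by
    rw [hD, le_div_iff₀ (by positivity)]; linarith
  have hD0 : 0 ≤ D := by linarith
  have hDG : D ≤ D * scaleAt (H + 8) := le_mul_of_one_le_right hD0 hG
  have hDG' : scaleAt (H + 8) ≤ D * scaleAt (H + 8) :=
    le_mul_of_one_le_left (by linarith) (by linarith)
  have hDf : 0 ≤ D * ((1 - f) / f) := by positivity
  have hfi : 0 < 1 / f := by positivity
  have hC : (costPot f H).C = 11 * (1 / f + 7 * D * scaleAt (H + 8) + 25 * D * ((1 - f) / f)) := by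
    rw [hD]; rfl
  have hX₁ : (costPot f H).X₁ = 25 * D := by rw [hD]; rfl
  have hY : (costPot f H).Y = 7 * D := by rw [hD]; rfl
  have hX₂ : (costPot f H).X₂ = 0 := rfl
  have hw : (costPot f H).w = 1 := rfl
  have he : (costPot f H).e = 0 := rfl
  have hGe : (costPot f H).G = scaleAt (H + 8) := rfl
  refine ⟨?_, ?_, ?_, ?_, ?_, ?_, hGe, ?_, ?_, ?_, ?_, ?_, ?_⟩
  · rw [hC]; linarith
  · rw [hX₁]; linarith
  · rw [hX₂]
  · rw [hY]; linarith
  · rw [hw]; norm_num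
  · rw [he]
  · rw [hY, hGe, hC]; linarith
  · rw [hw, hX₁, mul_one, ← hD]; linarith
  · rw [hw, hX₁, hX₂, hY, mul_one, ← hD]
    have : 0 ≤ F * D := mul_nonneg (hf.le.trans hfF) hD0
    norm_num
    linarith
  -- The inequality reduces to `1 + F · 7 D G + (1 - F) · 25 D ≤ F C / 11`, which holds term by
  -- term.
  · have h1 : 1 ≤ F * (1 / f) := by rw [mul_one_div, le_div_iff₀ hf]; linarith
    have h2 : 1 - F ≤ F * ((1 - f) / f) := by
      have h3 := mul_le_mul_of_nonneg_right hfF h1f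
      rw [mul_div_cancel₀ _ hf.ne'] at h3
      linarith
    have h4 := mul_le_mul_of_nonneg_left h2 hD0
    have h5 : 0 ≤ F * D := mul_nonneg (hf.le.trans hfF) hD0
    have h0 : scaleAt 0 = 1 := pow_zero _
    rw [Pot.state, Pot.perp, h0, hw, hX₁, hX₂, hY, hGe, hC]
    generalize (1 - f) / f = v at h4
    generalize 1 / f = u at h1
    have hi : ∀ z : ℝ, z / (11 / 10 * 1) = 10 / 11 * z := fun z => by ring
    rw [hi]
    linarith
  · rw [hw, hC, hGe, le_div_iff₀ (by linarith)]; linarith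
  · rw [hw, he, hX₂, hC]; linarith

/-- An orthogonal state has value at least 1 from level `H` on, so `X₂ = 1 / scaleAt H ^ 2`, and a
restart has value `ε`. The coefficient `12/100` of `Y` covers contamination: `1.1¹⁶ / 200 < 0.12 /
5`. A fresh orthogonal copy adds at most `(1 - F) X₂`, a product of `(1 - F) / scaleAt H ≤ ε / 10`
and `1 / scaleAt H ≤ F / 10`; this is why `H` involves both `(1 - f) / ε` and `1 / f`. -/
lemma errorPot_valid {f F ε : ℝ} {H : ℕ} (hf : 0 < f) (hfF : f ≤ F) (hF1 : F ≤ 1) (hε : 0 < ε)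
    (hH : 10 * ((1 - f) / ε + 1 / f) ≤ scaleAt H) : (errorPot F ε H).Valid f F H := by
  have hs := scaleAt_pos H
  have hF0 : 0 ≤ F := hf.le.trans hfF
  have hf1 : 0 ≤ (1 - f) / ε := div_nonneg (by linarith) hε.le
  have h1 : (1 - F) / scaleAt H ≤ ε / 10 := by
    rw [div_le_iff₀ hs]
    have h2 : (1 - f) / ε ≤ scaleAt H / 10 := by
      have : 0 < 1 / f := by positivity
      linarith
    rw [div_le_iff₀ hε] at h2
    linarith
  have h2 : 1 / scaleAt H ≤ F / 10 := by
    have h3 : 1 / f ≤ scaleAt H / 10 := by linarith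
    rw [div_le_iff₀ hf] at h3
    rw [div_le_iff₀ hs]
    have := mul_le_mul_of_nonneg_left hfF hs.le
    linarith
  have h3 : (1 - F) * (1 / scaleAt H ^ 2) ≤ ε / 10 * (F / 10) := by
    have h4 := mul_le_mul h1 h2 (by positivity) (by positivity)
    refine le_trans (le_of_eq ?_) h4
    field_simp
  have hYG : 12 / 100 * (1 - F) / scaleAt H ^ 2 * scaleAt (H + 8) ≤ 26 / 1000 * ε := by
    rw [show scaleAt (H + 8) = (11 / 10) ^ 8 * scaleAt H from scaleAt_add H 8]
    have h4 : 12 / 100 * (1 - F) / scaleAt H ^ 2 * ((11 / 10) ^ 8 * scaleAt H) =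
        12 / 100 * (11 / 10) ^ 8 * ((1 - F) / scaleAt H) := by field_simp
    rw [h4]
    norm_num
    linarith
  have hY : 0 ≤ 12 / 100 * (1 - F) / scaleAt H ^ 2 :=
    div_nonneg (mul_nonneg (by norm_num) (by linarith)) (by positivity)
  refine ⟨hε.le, le_rfl, by show 0 ≤ 1 / scaleAt H ^ 2; positivity, hY, le_rfl, zero_le_one, rfl,
    ?_, ?_, ?_, ?_, ?_, ?_⟩
  · show _ * scaleAt (H + 8) ≤ ε / 11
    refine hYG.trans ?_
    linarith
  · show 2000 * 0 / f ^ 2 ≤ (0 : ℝ) / 25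
    simp
  · show 2000 * 0 / f ^ 2 + (1 - F) * (0 * (11 / 10) ^ 8 + 1 / scaleAt H ^ 2 * (11 / 10) ^ 16) /
      200 ≤ 12 / 100 * (1 - F) / scaleAt H ^ 2 / 5
    have h4 : 0 ≤ (1 - F) * (1 / scaleAt H ^ 2) := mul_nonneg (by linarith) (by positivity)
    have h5 : 12 / 100 * (1 - F) / scaleAt H ^ 2 = 12 / 100 * ((1 - F) * (1 / scaleAt H ^ 2)) := by
      ring
    rw [h5]
    norm_num at h4 ⊢
    linarith
  · have h0 : scaleAt 0 = 1 := pow_zero _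
    rw [Pot.state, Pot.perp, h0]
    show 0 + F * (ε / (11 / 10 * 1) + 12 / 100 * (1 - F) / scaleAt H ^ 2 * (scaleAt (H + 8) - 1)) +
      (1 - F) * (ε + 0 * 1 + 1 / scaleAt H ^ 2 * 1 ^ 2) ≤ ε
    have h4 := mul_le_mul_of_nonneg_left hYG hF0
    have h5 := mul_nonneg hF0 hY
    have h6 : 0 ≤ F * ε := mul_nonneg hF0 hε.le
    generalize 12 / 100 * (1 - F) / scaleAt H ^ 2 = y at h4 h5
    generalize 1 / scaleAt H ^ 2 = r at h3
    have hi : ∀ z : ℝ, z / (11 / 10 * 1) = 10 / 11 * z := fun z => by ring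
    rw [hi]
    linarith
  · exact div_nonneg hε.le (scaleAt_pos _).le
  · show (0 : ℝ) + 1 ≤ ε + 1 / scaleAt H ^ 2 * scaleAt H ^ 2
    rw [one_div_mul_cancel (by positivity)]
    linarith

/-! ### The output of the protocol -/

section output

variable {n : ℕ} {P₁ P₂ ρ : Op n n} {f F lam : ℝ} {H : ℕ}

lemma distill_simulates_level (hsp : SpectralPair P₁ P₂ ρ F lam) (hf : 0 < f) (hf1 : f ≤ 1)
    (hH : 0 < H) : Protocol.Simulates (distillProtocol n f H) ρ Conf.ctrl (Conf.mem P₁ P₂ ρ f)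
      (Conf.step P₁ P₂ f F lam H) fun x => x.Good ∧ x.level < H where
  branches_eq x hx := Conf.branches_eq hsp hf hf1 x hx.1
  good_step x hx y hy := ⟨Conf.good_step hsp hf hf1 x hx.1 y hy, Conf.level_step hH x hx.2 y hy⟩

/-- `costPot` charges 1 for every instruction, hence bounds at once the copies, the fractional swaps
and the running time. -/
lemma distill_expected_le (hsp : SpectralPair P₁ P₂ ρ F lam) (hf : 0 < f) (hfF : f ≤ F)
    (hlf : lam ≤ f / 4) (hH : 0 < H) (w : Instr n (memSize n) Stage → ℕ) (hw : ∀ i, w i ≤ 1)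
    (T : ℕ) : (distillProtocol n f H).expectedFrom ρ w T Stage.start
      (Protocol.zeroState (memSize n)) ≤ 1 + (costPot f H).C := by
  have hF1 := hsp.F_le_one
  have hf1 : f ≤ 1 := hfF.trans hF1
  have hv := costPot_valid hf hfF hF1 H
  refine (distill_simulates_level hsp hf hf1 hH).expectedFrom_le w
    ((costPot f H).value f F lam)
    (fun x hx => hv.value_nonneg hf hf1 hsp.F_nonneg hF1 hsp.lam_nonneg hsp.lam_le x hx.1 hx.2)
    (fun x hx => ?_) T Conf.start ⟨trivial, hH⟩
  have h1 := hv.value_step (P₁ := P₁) (P₂ := P₂) hf hfF hF1 hsp.lam_nonneg hlf x hx.1 hx.2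
  have h2 : (costPot f H).w * x.mass + (costPot f H).e * x.out.2 = x.mass := by
    show 1 * x.mass + 0 * x.out.2 = x.mass
    ring
  have h3 : ((w (distillInstr n f H x.ctrl) : ℕ) : ℝ) * ((x.mem P₁ P₂ ρ f).trace).re ≤ x.mass := by
    rw [Conf.trace_mem hsp x hx.1, Complex.ofReal_re]
    exact mul_le_of_le_one_left (x.mass_nonneg hx.1) (by exact_mod_cast hw _)
  rw [h2] at h1
  exact (add_le_add h3 le_rfl).trans h1

/-- The weight orthogonal to the range of `P₁`. -/
def orthWeight (P₁ : Op n n) : Op n n →+ ℝ where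
  toFun M := M.trace.re - (P₁ * M).trace.re
  map_zero' := by simp
  map_add' M N := by simp only [Matrix.mul_add, Matrix.trace_add, Complex.add_re]; ring

lemma orthWeight_dataOp (hsp : SpectralPair P₁ P₂ ρ F lam) (h11 : P₁ * P₁ = P₁)
    (h12 : P₁ * P₂ = 0) (p q : ℝ) : orthWeight P₁ (dataOp P₁ P₂ p q) = q := by
  show (dataOp P₁ P₂ p q).trace.re - (P₁ * dataOp P₁ P₂ p q).trace.re = q
  rw [trace_dataOp hsp.tr_left hsp.tr_right, dataOp, Matrix.mul_add, Matrix.mul_smul,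
    Matrix.mul_smul, h11, h12, smul_zero, add_zero, Matrix.trace_smul, hsp.tr_left]
  simp

/-- The operators with nonnegative weights on the two eigenspaces. -/
def dataCone (P₁ P₂ : Op n n) : AddSubmonoid (Op n n) where
  carrier := {M | ∃ p q : ℝ, 0 ≤ p ∧ 0 ≤ q ∧ M = dataOp P₁ P₂ p q}
  zero_mem' := ⟨0, 0, le_rfl, le_rfl, by simp [dataOp]⟩
  add_mem' := by
    rintro _ _ ⟨p, q, hp, hq, rfl⟩ ⟨p', q', hp', hq', rfl⟩
    refine ⟨p + p', q + q', add_nonneg hp hp', add_nonneg hq hq', ?_⟩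
    simp only [dataOp, Complex.ofReal_add, add_smul]
    abel

lemma tendsto_dataOp {p q : ℕ → ℝ} {a b : ℝ} (hp : Filter.Tendsto p Filter.atTop (𝓝 a))
    (hq : Filter.Tendsto q Filter.atTop (𝓝 b)) :
    Filter.Tendsto (fun T => dataOp P₁ P₂ (p T) (q T)) Filter.atTop (𝓝 (dataOp P₁ P₂ a b)) := by
  unfold dataOp
  exact (((Complex.continuous_ofReal.tendsto a).comp hp).smul_const P₁).add
    (((Complex.continuous_ofReal.tendsto b).comp hq).smul_const P₂)

/-- The truncated outputs are `dataOp` of two increasing bounded sequences. The error potential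
bounds the orthogonal one by its restart value `ε`; the bound on the running time makes the total
weight tend to 1. -/
lemma distill_outputs (hsp : SpectralPair P₁ P₂ ρ F lam) (h11 : P₁ * P₁ = P₁)
    (h12 : P₁ * P₂ = 0) (hf : 0 < f) (hfF : f ≤ F)
    (hlf : lam ≤ f / 4) (hH : 0 < H) {ε : ℝ} (hε : 0 < ε)
    (hHε : 10 * ((1 - f) / ε + 1 / f) ≤ scaleAt H) :
    ∃ a b : ℝ, a + b = 1 ∧ 0 ≤ b ∧ b ≤ ε ∧
      (distillProtocol n f H).Outputs ρ (dataOp P₁ P₂ a b) := by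
  have hF1 := hsp.F_le_one
  have hf1 : f ≤ 1 := hfF.trans hF1
  have hsim := distill_simulates_level (f := f) hsp hf hf1 hH
  have hout : ∀ x : Conf n, ((distillProtocol n f H).instr x.ctrl).output (x.mem P₁ P₂ ρ f) =
    dataOp P₁ P₂ x.out.1 x.out.2 := Conf.output_eq hsp
  have hstart : (Conf.start : Conf n).Good ∧ (Conf.start : Conf n).level < H := ⟨trivial, hH⟩
  have hstep : ∀ T, ∃ p q : ℝ, 0 ≤ p ∧ 0 ≤ q ∧ (distillProtocol n f H).outputWithin ρ (T + 1) =
      (distillProtocol n f H).outputWithin ρ T + dataOp P₁ P₂ p q := by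
    intro T
    obtain ⟨D, ⟨p, q, hp, hq, rfl⟩, hD⟩ := hsim.output_diff_mem (dataCone P₁ P₂)
      (fun x hx => ⟨_, _, (x.out_nonneg hx.1).1, (x.out_nonneg hx.1).2, hout x⟩) T _ hstart
    exact ⟨p, q, hp, hq, hD⟩
  choose p q hp hq hpq using hstep
  obtain ⟨a, ha⟩ : ∃ a : ℕ → ℝ, ∀ T, a T = ∑ i ∈ Finset.range T, p i := ⟨_, fun _ => rfl⟩
  obtain ⟨b, hb⟩ : ∃ b : ℕ → ℝ, ∀ T, b T = ∑ i ∈ Finset.range T, q i := ⟨_, fun _ => rfl⟩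
  have hM : ∀ T, (distillProtocol n f H).outputWithin ρ T = dataOp P₁ P₂ (a T) (b T) := by
    intro T
    induction T with
    | zero => rw [ha, hb]; simp [dataOp, Protocol.outputWithin, Protocol.outputFrom]
    | succ T ih =>
      rw [hpq, ih, ha (T + 1), hb (T + 1), Finset.sum_range_succ, Finset.sum_range_succ, ← ha, ← hb]
      simp only [dataOp, Complex.ofReal_add, add_smul]
      abel
  have ha0 : ∀ T, 0 ≤ a T := fun T => ha T ▸ Finset.sum_nonneg fun i _ => hp i
  have hb0 : ∀ T, 0 ≤ b T := fun T => hb T ▸ Finset.sum_nonneg fun i _ => hq i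
  have hamono : Monotone a := monotone_nat_of_le_succ fun T => by
    rw [ha, ha, Finset.sum_range_succ]; linarith [hp T]
  have hbmono : Monotone b := monotone_nat_of_le_succ fun T => by
    rw [hb, hb, Finset.sum_range_succ]; linarith [hq T]
  have htr : ∀ T, ((distillProtocol n f H).outputWithin ρ T).trace.re = a T + b T := by
    intro T
    rw [hM, trace_dataOp hsp.tr_left hsp.tr_right, Complex.ofReal_re]
  have hmass : ∀ x : Conf n, x.Good ∧ x.level < H → ((x.mem P₁ P₂ ρ f).trace).re =
      (((distillProtocol n f H).instr x.ctrl).output (x.mem P₁ P₂ ρ f)).trace.re +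
      ((x.step P₁ P₂ f F lam H).map fun y => ((y.mem P₁ P₂ ρ f).trace).re).sum := by
    intro x hx
    rw [hout, trace_dataOp hsp.tr_left hsp.tr_right, Conf.trace_mem hsp x hx.1, Complex.ofReal_re,
      Complex.ofReal_re, x.mass_step (P₁ := P₁) (P₂ := P₂) (f := f) (F := F) (lam := lam) (H := H)]
    congr 2
    refine List.map_congr_left fun y hy => ?_
    rw [Conf.trace_mem hsp y (Conf.good_step hsp hf hf1 x hx.1 y hy), Complex.ofReal_re]
  have hle1 : ∀ T, a T + b T ≤ 1 := by
    intro T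
    rw [← htr]
    refine (hsim.output_le
      (Complex.reAddGroupHom.comp (Matrix.traceAddMonoidHom (Bits n) ℂ))
      (fun x => ((x.mem P₁ P₂ ρ f).trace).re) (fun x hx => ?_) (fun x hx => (hmass x hx).ge) T _
      hstart).trans ?_
    · rw [Conf.trace_mem hsp x hx.1, Complex.ofReal_re]
      exact x.mass_nonneg hx.1
    · rw [Conf.trace_mem hsp _ hstart.1, Complex.ofReal_re]
      exact le_rfl
  have hbε : ∀ T, b T ≤ ε := by
    intro T
    have hv := errorPot_valid hf hfF hF1 hε hHε
    have h1 := hsim.output_le (orthWeight P₁) ((errorPot F ε H).value f F lam)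
      (fun x hx => hv.value_nonneg hf hf1 hsp.F_nonneg hF1 hsp.lam_nonneg hsp.lam_le x hx.1 hx.2)
      (fun x hx => by
        have h2 := hv.value_step (P₁ := P₁) (P₂ := P₂) hf hfF hF1 hsp.lam_nonneg hlf x hx.1 hx.2
        have h3 : (errorPot F ε H).w * x.mass + (errorPot F ε H).e * x.out.2 = x.out.2 := by
          show 0 * x.mass + 1 * x.out.2 = x.out.2
          ring
        rw [h3] at h2
        exact (add_le_add ((congrArg (orthWeight P₁) (hout x)).trans
          (orthWeight_dataOp hsp h11 h12 _ _)).le le_rfl).trans h2) T _ hstart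
    have h4 : orthWeight P₁ ((distillProtocol n f H).outputWithin ρ T) ≤ 0 + ε := h1
    rw [hM, orthWeight_dataOp hsp h11 h12, zero_add] at h4
    exact h4
  -- The probability of still running after `T` steps is `O(1/T)`.
  have hres : ∀ T : ℕ, (T : ℝ) * (1 - (a T + b T)) ≤ 1 + (costPot f H).C := by
    intro T
    have h1 := hsim.residual_le hmass (fun T x hx => by
      have h2 := hsim.output_le
        (-(Complex.reAddGroupHom.comp (Matrix.traceAddMonoidHom (Bits n) ℂ)))
        (fun _ => 0) (fun _ _ => le_rfl) (fun x hx => by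
          have h3 := x.out_nonneg hx.1
          refine (add_le_add (congrArg (fun M : Op n n => -M.trace.re) (hout x)).le le_rfl).trans ?_
          rw [trace_dataOp hsp.tr_left hsp.tr_right, Complex.ofReal_re, List.sum_map_zero]
          linarith) T x hx
      exact neg_nonpos.mp h2) T _ hstart
    have h2 : (((Conf.start : Conf n).mem P₁ P₂ ρ f).trace).re = 1 := by
      rw [Conf.trace_mem hsp _ hstart.1, Complex.ofReal_re]
      rfl
    have h3 : (T : ℝ) * ((((Conf.start : Conf n).mem P₁ P₂ ρ f).trace).re -
      ((distillProtocol n f H).outputWithin ρ T).trace.re) ≤ _ := h1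
    rw [h2, htr] at h3
    exact h3.trans (distill_expected_le hsp hf hfF hlf hH _ (fun _ => le_rfl) T)
  obtain ⟨A, hA⟩ : ∃ A, Filter.Tendsto a Filter.atTop (𝓝 A) :=
    ⟨_, tendsto_atTop_ciSup hamono ⟨1, by rintro _ ⟨T, rfl⟩; linarith [hle1 T, hb0 T]⟩⟩
  obtain ⟨B, hB⟩ : ∃ B, Filter.Tendsto b Filter.atTop (𝓝 B) :=
    ⟨_, tendsto_atTop_ciSup hbmono ⟨ε, by rintro _ ⟨T, rfl⟩; exact hbε T⟩⟩
  have hAB : A + B = 1 := by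
    have h1 : Filter.Tendsto (fun T => a T + b T) Filter.atTop (𝓝 1) := by
      have h2 : Filter.Tendsto (fun T : ℕ => 1 - (1 + (costPot f H).C) / (T : ℝ)) Filter.atTop
          (𝓝 1) := by
        simpa using tendsto_const_nhds.sub (tendsto_const_div_atTop_nhds_zero_nat (1 + (costPot f H).C))
      refine tendsto_of_tendsto_of_tendsto_of_le_of_le' h2 tendsto_const_nhds ?_
        (Filter.Eventually.of_forall hle1)
      filter_upwards [Filter.eventually_gt_atTop 0] with T hT
      have hT' : (0 : ℝ) < T := by exact_mod_cast hT
      have h3 : 1 - (a T + b T) ≤ (1 + (costPot f H).C) / T := by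
        rw [le_div_iff₀ hT']
        linarith [hres T]
      linarith
    exact tendsto_nhds_unique (hA.add hB) h1
  refine ⟨A, B, hAB, ge_of_tendsto' hB hb0, le_of_tendsto' hB hbε, ?_, ?_⟩
  · refine (tendsto_dataOp hA hB).congr fun T => (hM T).symm
  · rw [trace_dataOp hsp.tr_left hsp.tr_right, hAB, Complex.ofReal_one]

end output

end

noncomputable section

/-! ### Operation counts -/

section counts

variable {n : ℕ} {f : ℝ} {H : ℕ}

/-- A bound on single-qubit operations since the last amortized copy. -/
def Stage.singlesDebt : Stage → ℕ
  | .plusC _ => 1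
  | .prepC _ => 2
  | .measC _ => 3
  | .unplus _ => 4
  | .fswap _ => 3
  | .measQ _ => 5
  | .coin _ => 6
  | .prepQ _ => 7
  | _ => 0

/-- Controlled swaps that are still paid for by the last copy. -/
def Stage.cswapsDebt (n : ℕ) : Stage → ℕ
  | .fswap _ => 2 * (n + 1)
  | .measQ _ => 2 * (n + 1)
  | .coin _ => 2 * (n + 1)
  | .prepQ _ => 2 * (n + 1)
  | _ => 0

lemma Stage.debt_down (k : ℕ) :
    (Stage.down k).singlesDebt ≤ 2 ∧ (Stage.down k).cswapsDebt n = 0 := by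
  cases k <;> exact ⟨by simp [Stage.down, Stage.singlesDebt], rfl⟩

lemma Stage.debt_up (k : ℕ) :
    (Stage.up H k).singlesDebt ≤ 2 ∧ (Stage.up H k).cswapsDebt n = 0 := by
  unfold Stage.up
  split_ifs <;> exact ⟨by simp [Stage.singlesDebt], rfl⟩

/-- Amortization: each copy brings credit for the longest stretch before the next load. For
single-qubit operations this is 7: reset, turn and measure the coin, turn and measure the control,
then reset and turn it again. For controlled swaps it is one fractional swap of `n + 1` qubits. -/
lemma distillInstr_debt (s s' : Stage) (hs : s' ∈ (distillInstr n f H s).succ) :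
    (distillInstr n f H s).singles + s'.singlesDebt ≤
        s.singlesDebt + 7 * (distillInstr n f H s).copies ∧
      (distillInstr n f H s).cswaps + s'.cswapsDebt n ≤
        s.cswapsDebt n + 2 * (n + 1) * (distillInstr n f H s).copies := by
  cases s
  case fswap k =>
    simp only [distillInstr, Instr.succ, List.mem_singleton] at hs
    subst hs
    simp only [distillInstr, Instr.singles, Instr.cswaps, Instr.copies, singles_fracSwapCircuit,
      cswaps_fracSwapCircuit, Stage.singlesDebt, Stage.cswapsDebt]
    omega
  case measC k =>
    have h1 := Stage.debt_down (n := n) k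
    have h2 := Stage.debt_up (n := n) (H := H) k
    simp only [distillInstr, Instr.succ, if_true, one_ne_zero, if_false, List.mem_cons,
      List.not_mem_nil, or_false] at hs
    simp only [distillInstr, Instr.singles, Instr.cswaps, Instr.copies]
    rcases hs with rfl | rfl
    · rw [h1.2]
      exact ⟨Nat.add_le_add_left h1.1 1, Nat.zero_le _⟩
    · rw [h2.2]
      exact ⟨Nat.add_le_add_left h2.1 1, Nat.zero_le _⟩
  case measQ k =>
    simp only [distillInstr, Instr.succ, if_true, one_ne_zero, if_false, List.mem_cons,
      List.not_mem_nil, or_false] at hs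
    rcases hs with rfl | rfl <;> simp [distillInstr, Instr.singles, Instr.cswaps, Instr.copies,
      Stage.singlesDebt, Stage.cswapsDebt]
  case done => simp [distillInstr, Instr.succ] at hs
  all_goals
    simp only [distillInstr, Instr.succ, List.mem_singleton] at hs
    subst hs
    simp [distillInstr, Instr.singles, Instr.cswaps, Instr.copies, Stage.singlesDebt,
      Stage.cswapsDebt]

lemma distillProtocol_reaches {s : (distillProtocol n f H).Ctrl} {a b c : ℕ}
    (h : (distillProtocol n f H).Reaches s a b c) :
    b + Stage.singlesDebt s ≤ 7 * a ∧ c + Stage.cswapsDebt n s ≤ 2 * (n + 1) * a := by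
  induction h with
  | start => exact ⟨le_rfl, Nat.zero_le _⟩
  | @step s s' a b c _ hs ih =>
    have h1 := distillInstr_debt (n := n) (f := f) (H := H) s s' hs
    have key : ∀ {b' d d' m a' q A : ℕ}, m + d' ≤ d + q * a' → b' + d ≤ q * A →
        b' + m + d' ≤ q * (A + a') := by
      intro b' d d' m a' q A h1 h2
      rw [Nat.mul_add]
      omega
    exact ⟨key h1.1 ih.1, key h1.2 ih.2⟩

end counts

/-! ### The protocol for large error -/

/-- The control states of the protocol that outputs one copy. -/
inductive CopyStage : Type
  | start
  | done

/-- The protocol that outputs one copy. -/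
abbrev copyProtocol (n : ℕ) : Protocol n where
  mem := n
  Ctrl := CopyStage
  start := .start
  instr
    | .start => .load (Function.Embedding.refl _) .done
    | .done => .halt (Function.Embedding.refl _)

section copy

variable {n : ℕ} (ρ : Op n n)

lemma loadState_refl (σ : Op n n) :
    Instr.loadState ρ (Function.Embedding.refl _) σ = σ.trace • ρ := by
  ext y x
  have h : ∀ z y : Bits n, Function.extend (Function.Embedding.refl (Fin n)) z y = z := by
    intro z y
    funext j
    exact (Function.Embedding.refl (Fin n)).injective.extend_apply z y j
  simp only [Instr.loadState, h]
  rfl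

lemma reducedState_refl (σ : Op n n) :
    Instr.reducedState (Function.Embedding.refl _) σ = σ := by
  ext a b
  have h : ∀ z y : Bits n, Function.extend (Function.Embedding.refl (Fin n)) z y = z := by
    intro z y
    funext j
    exact (Function.Embedding.refl (Fin n)).injective.extend_apply z y j
  simp only [Instr.reducedState, h]
  exact (Finset.sum_eq_single_of_mem a (Finset.mem_univ _) fun y _ hy => if_neg hy).trans
    (if_pos rfl)

lemma copyProtocol_outputWithin (T : ℕ) : (copyProtocol n).outputWithin ρ (T + 2) = ρ := by
  have h0 : ∀ T, (copyProtocol n).outputFrom ρ (T + 1) CopyStage.done ρ = ρ := by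
    intro T
    show Instr.reducedState (Function.Embedding.refl _) ρ + 0 = ρ
    rw [reducedState_refl, add_zero]
  show (0 : Op n n) + ((copyProtocol n).outputFrom ρ (T + 1) CopyStage.done
    (Instr.loadState ρ (Function.Embedding.refl _) (Protocol.zeroState n)) + 0) = ρ
  rw [loadState_refl, trace_zeroState, one_smul, zero_add, add_zero]
  exact h0 T

lemma copyProtocol_outputs (hρ : ρ.trace = 1) : (copyProtocol n).Outputs ρ ρ :=
  ⟨(Filter.tendsto_add_atTop_iff_nat 2).mp
    (by simp only [copyProtocol_outputWithin]; exact tendsto_const_nhds), hρ⟩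

lemma copyProtocol_expectedFrom_done (w : Instr n n CopyStage → ℕ)
    (hw : w ((copyProtocol n).instr .done) = 0) (T : ℕ) (σ : Op n n) :
    (copyProtocol n).expectedFrom ρ w T CopyStage.done σ = 0 := by
  cases T with
  | zero => rfl
  | succ T =>
    show (w ((copyProtocol n).instr .done) : ℝ) * _ + 0 = 0
    rw [hw]
    simp

lemma copyProtocol_expectedCopies_le (T : ℕ) : (copyProtocol n).expectedCopies ρ T ≤ 1 := by
  cases T with
  | zero => exact zero_le_one
  | succ T =>
    show ((1 : ℕ) : ℝ) * (Matrix.trace (Protocol.zeroState n)).re +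
      ((copyProtocol n).expectedFrom ρ Instr.copies T CopyStage.done _ + 0) ≤ 1
    rw [copyProtocol_expectedFrom_done ρ _ rfl, trace_zeroState]
    simp

lemma copyProtocol_expectedFracSwaps (T : ℕ) : (copyProtocol n).expectedFracSwaps ρ T = 0 := by
  cases T with
  | zero => rfl
  | succ T =>
    show ((0 : ℕ) : ℝ) * (Matrix.trace (Protocol.zeroState n)).re +
      ((copyProtocol n).expectedFrom ρ Instr.fswaps T CopyStage.done _ + 0) = 0
    rw [copyProtocol_expectedFrom_done ρ _ rfl]
    simp

lemma copyProtocol_reaches {s : (copyProtocol n).Ctrl} {a b c : ℕ} (h : (copyProtocol n).Reaches s a b c) :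
    b = 0 ∧ c = 0 := by
  induction h with
  | start => exact ⟨rfl, rfl⟩
  | @step s s' a b c _ hs ih =>
    rw [ih.1, ih.2]
    cases s <;> exact ⟨rfl, rfl⟩

end copy

end

noncomputable section

/-! ### Main theorem -/

section final

variable {n : ℕ}

/-- An isotropic state has two eigenspaces. -/
lemma spectralPair_isotropic {ψ : Bits n → ℂ} (hψ : star ψ ⬝ᵥ ψ = 1) (hn : (1 : ℝ) ≤ 2 ^ n - 1)
    {F lam : ℝ} (hF : 0 ≤ F) (hlam : 0 ≤ lam) (h : F + (2 ^ n - 1) * lam = 1) :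
    SpectralPair (ketbra ψ) (isotropic ψ 0 (1 / (2 ^ n - 1))) (isotropic ψ F lam) F lam := by
  have hn0 : (2 ^ n - 1 : ℝ) ≠ 0 := by linarith
  have hlF : (2 ^ n - 1) * lam = 1 - F := by linarith
  have hll : lam ≤ (2 ^ n - 1) * lam := le_mul_of_one_le_left hlam hn
  have hz := ketbra_mul_self hψ
  refine ⟨?_, ?_, ?_, ?_, ?_, ?_, ?_, hF, ?_, hlam, ?_⟩
  · rw [trace_ketbra, hψ]
  · rw [trace_isotropic hψ, mul_one_div_cancel hn0]; simp
  · have h1 : lam = (1 - F) * (1 / (2 ^ n - 1)) := by rw [← hlF]; field_simp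
    conv_lhs => rw [h1]
    rw [isotropic, isotropic, Complex.ofReal_mul, Complex.ofReal_zero, zero_smul, zero_add,
      smul_smul]
  · rw [isotropic, Matrix.mul_add, Matrix.mul_smul, Matrix.mul_smul, Matrix.mul_sub, hz,
      Matrix.mul_one, sub_self, smul_zero, add_zero]
  · rw [isotropic, Matrix.add_mul, Matrix.smul_mul, Matrix.smul_mul, Matrix.sub_mul, hz,
      Matrix.one_mul, sub_self, smul_zero, add_zero]
  · simp only [isotropic, Complex.ofReal_zero, zero_smul, zero_add, Matrix.mul_add, Matrix.mul_smul,
      Matrix.smul_mul, Matrix.mul_sub, Matrix.sub_mul, hz, Matrix.mul_one, Matrix.one_mul, sub_self,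
      smul_zero, sub_zero]
  · simp only [isotropic, Complex.ofReal_zero, zero_smul, zero_add, Matrix.add_mul, Matrix.mul_smul,
      Matrix.smul_mul, Matrix.mul_sub, Matrix.sub_mul, hz, Matrix.mul_one, Matrix.one_mul, sub_self,
      smul_zero, add_zero, add_sub_cancel_left, smul_comm (lam : ℂ)]
  · linarith
  · linarith

lemma ketbra_mul_isotropic_zero {ψ : Bits n → ℂ} (hψ : star ψ ⬝ᵥ ψ = 1) (lam : ℝ) :
    ketbra ψ * isotropic ψ 0 lam = 0 := by
  rw [isotropic, Complex.ofReal_zero, zero_smul, zero_add, Matrix.mul_smul, Matrix.mul_sub,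
    ketbra_mul_self hψ, Matrix.mul_one, sub_self, smul_zero]

lemma dataOp_isotropic (ψ : Bits n → ℂ) (a b lam : ℝ) :
    dataOp (ketbra ψ) (isotropic ψ 0 lam) a b = isotropic ψ a (b * lam) := by
  rw [dataOp, isotropic, isotropic, Complex.ofReal_zero, zero_smul, zero_add, smul_smul,
    Complex.ofReal_mul]

lemma exists_scaleAt {z : ℝ} (hz : 1 ≤ z) : ∃ H, 0 < H ∧ z ≤ scaleAt H ∧ scaleAt H ≤ 11 / 10 * z := by
  obtain ⟨k, h1, h2⟩ := exists_nat_pow_near hz (show (1 : ℝ) < 11 / 10 by norm_num)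
  refine ⟨k + 1, Nat.succ_pos k, h2.le, ?_⟩
  rw [scaleAt_add, pow_one]
  exact mul_le_mul_of_nonneg_left h1 (by norm_num)

/-- With `z = (1-f)/ε`, `v = (1-f)/f` and `q = 1/f²` the target is `10⁷ q (z + v)`, while the cost
is of order `q (z + v + 1)`. The surplus 1 is absorbed because `ε ≤ 1 - f` means `z ≥ 1`. -/
lemma costPot_C_le {f ε : ℝ} {H : ℕ} (hf : 0 < f) (hf1 : f ≤ 1) (hε : 0 < ε) (hεf : ε ≤ 1 - f)
    (hH : scaleAt H ≤ 11 / 10 * (10 * ((1 - f) / ε + 1 / f))) :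
    1 + (costPot f H).C ≤ 10 ^ 7 * ((1 - f) / f ^ 2 * (1 / ε + 1 / f)) := by
  obtain ⟨v, hv⟩ : ∃ v, v = (1 - f) / f := ⟨_, rfl⟩
  obtain ⟨z, hz⟩ : ∃ z, z = (1 - f) / ε := ⟨_, rfl⟩
  obtain ⟨q, hq⟩ : ∃ q, q = 1 / f ^ 2 := ⟨_, rfl⟩
  have hv0 : 0 ≤ v := hv ▸ div_nonneg (by linarith) hf.le
  have hz1 : 1 ≤ z := by rw [hz, le_div_iff₀ hε]; linarith
  have hq1 : 1 ≤ q := by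
    rw [hq, le_div_iff₀ (by positivity), one_mul]; exact pow_le_one₀ hf.le hf1
  have hfv : 1 / f = 1 + v := by rw [hv]; field_simp; ring
  have hG : scaleAt (H + 8) ≤ 24 * (z + v + 1) := by
    rw [hfv, ← hz] at hH
    rw [scaleAt_add]
    norm_num
    linarith
  have hB : (1 - f) / f ^ 2 * (1 / ε + 1 / f) = q * (z + v) := by
    rw [hq, hv, hz]; field_simp
  have hC : (costPot f H).C = 11 * (1 / f + 7 * (2000 * q) * scaleAt (H + 8) +
      25 * (2000 * q) * v) := by
    rw [hq, hv, mul_one_div]; rfl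
  have h1 := mul_le_mul_of_nonneg_left hG (show 0 ≤ q by linarith)
  have h2 : 0 ≤ q * v := by positivity
  have h3 : q * 1 ≤ q * z := mul_le_mul_of_nonneg_left hz1 (by linarith)
  have h4 : v ≤ q * v := le_mul_of_one_le_left hv0 hq1
  rw [hB, hC, hfv]
  linarith

end final

end

theorem mainTheorem3 :
    ∃ K : ℝ, 0 < K ∧
      ∀ (n : ℕ) (Fmin ε : ℝ), (2 : ℝ) ^ (2 - (n : ℤ)) ≤ Fmin → 0 < ε →
        -- the protocol depends only on `n`, `Fmin` and `ε`
        ∃ P : Protocol n,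
          -- gate cost per copy consumed, on every run and at all times
          (∀ (s : P.Ctrl) (a b c : ℕ), P.Reaches s a b c →
            (b : ℝ) ≤ K * a ∧ (c : ℝ) ≤ K * n * a) ∧
          ∀ (n' : ℕ) (E : Op n' n) (dev : (Bits n → ZMod 2) → SuperOp n n)
            (encN : SuperOp n n') (qecN Q : SuperOp n' n'),
            Eᴴ * E = 1 → DatasetIndependent dev → IsChannel encN → IsChannel qecN →
            IsQECProjector E Q →
            (∀ g, Fmin ≤ fidelity (E *ᵥ resourceState g) (encodedState dev encN qecN Q g)) →
            ∀ g : Bits n → ZMod 2,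
              (∀ T, P.expectedCopies
                  (logicalState E (twirledState E (encodedState dev encN qecN Q) g)) T ≤
                1 + K * ((1 - Fmin) / Fmin ^ 2 * (1 / ε + 1 / Fmin))) ∧
              (∀ T, P.expectedFracSwaps
                  (logicalState E (twirledState E (encodedState dev encN qecN Q) g)) T ≤
                K * ((1 - Fmin) / Fmin ^ 2 * (1 / ε + 1 / Fmin))) ∧
              ∃ φdist : Op n n,
                P.Outputs (logicalState E (twirledState E (encodedState dev encN qecN Q) g))
                  φdist ∧
                traceDist (ketbra (E *ᵥ resourceState g)) (conjBy E φdist) ≤ ε := by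
  refine ⟨10 ^ 7, by norm_num, fun n f ε hnf hε => ?_⟩
  have hf : 0 < f := lt_of_lt_of_le (by positivity) hnf
  have hN : (1 : ℝ) ≤ 2 ^ n := one_le_pow₀ (by norm_num)
  -- For such `ε` a single copy, at trace distance at most `1 - F ≤ 1 - f`, is already good enough.
  -- This covers `n = 0` and all `f ≥ 1`.
  by_cases hεf : 1 - f ≤ ε
  · refine ⟨copyProtocol n, ?_, ?_⟩
    · intro s a b c h
      obtain ⟨rfl, rfl⟩ := copyProtocol_reaches h
      constructor <;> · push_cast; positivity
    · intro n' E dev encN qecN Q hE hdev henc hqec hQ hF g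
      obtain ⟨F, lam, hfF, hlam, hFl, hρ⟩ := twirledState_isotropic hE hdev henc hqec hQ hF g
      have hψ := resourceState_norm g
      have hF1 : F ≤ 1 := by
        have : 0 ≤ (2 ^ n - 1) * lam := mul_nonneg (by linarith) hlam
        linarith
      have hB : 0 ≤ (10 : ℝ) ^ 7 * ((1 - f) / f ^ 2 * (1 / ε + 1 / f)) := by
        have : 0 ≤ 1 - f := by linarith
        positivity
      rw [hρ]
      refine ⟨fun T => ?_, fun T => ?_, _, copyProtocol_outputs _ ?_, ?_⟩
      · exact (copyProtocol_expectedCopies_le _ T).trans (by linarith)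
      · rw [copyProtocol_expectedFracSwaps]
        exact hB
      · rw [trace_isotropic hψ, hFl, Complex.ofReal_one]
      · refine (traceDist_isotropic hE hψ hlam hFl).trans ?_
        linarith
  · rw [not_le] at hεf
    have hf1 : f < 1 := by linarith
    have hN0 : (0 : ℝ) < 2 ^ n := by positivity
    -- The lower bound on the fidelity, in the form that separates the eigenvalues.
    have hfN : 4 ≤ f * 2 ^ n := by
      rw [zpow_sub₀ (by norm_num), zpow_natCast, div_le_iff₀ hN0] at hnf
      norm_num at hnf
      exact hnf
    have hN4 : (4 : ℝ) ≤ 2 ^ n := by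
      have := mul_le_mul_of_nonneg_right hf1.le hN0.le
      linarith
    have hn1 : 1 ≤ n := by
      rcases Nat.eq_zero_or_pos n with rfl | h
      · norm_num at hN4
      · exact h
    obtain ⟨z, hz⟩ : ∃ z, z = 10 * ((1 - f) / ε + 1 / f) := ⟨_, rfl⟩
    have hz1 : 1 ≤ z := by
      have h1 : 1 ≤ 1 / f := by rw [le_div_iff₀ hf]; linarith
      have h2 : 0 ≤ (1 - f) / ε := div_nonneg (by linarith) hε.le
      rw [hz]
      linarith
    obtain ⟨H, hH, hzH, hHz⟩ := exists_scaleAt hz1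
    rw [hz] at hzH hHz
    have hcost := costPot_C_le hf hf1.le hε hεf.le hHz
    refine ⟨distillProtocol n f H, ?_, ?_⟩
    · intro s a b c h
      obtain ⟨h1, h2⟩ := distillProtocol_reaches h
      have h3 : (b : ℝ) ≤ 7 * a := by exact_mod_cast (Nat.le_add_right _ _).trans h1
      have h4 : (c : ℝ) ≤ 2 * (n + 1) * a := by exact_mod_cast (Nat.le_add_right _ _).trans h2
      have ha : (0 : ℝ) ≤ a := Nat.cast_nonneg a
      have hn : (1 : ℝ) ≤ n := by exact_mod_cast hn1
      have h5 : (1 : ℝ) * a ≤ n * a := mul_le_mul_of_nonneg_right hn ha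
      constructor <;> linarith
    · intro n' E dev encN qecN Q hE hdev henc hqec hQ hF g
      obtain ⟨F, lam, hfF, hlam, hFl, hρ⟩ := twirledState_isotropic hE hdev henc hqec hQ hF g
      have hψ := resourceState_norm g
      have hsp := spectralPair_isotropic hψ (by linarith) (hf.le.trans hfF) hlam hFl
      -- `(2^n - 1) lam = 1 - F ≤ 1 - f ≤ 1 - f/4 ≤ (2^n - 1) f/4`, the last step by `f · 2^n ≥ 4`.
      have hlf : lam ≤ f / 4 := by
        have h1 : 0 ≤ (2 ^ n - 4) * lam := mul_nonneg (by linarith) hlam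
        have h2 : (2 ^ n - 1) * lam ≤ (2 ^ n - 1) * (f / 4) := by linarith
        exact le_of_mul_le_mul_left h2 (by linarith)
      rw [hρ]
      refine ⟨fun T => ?_, fun T => ?_, ?_⟩
      · refine (distill_expected_le hsp hf hfF hlf hH Instr.copies ?_ T).trans (by linarith)
        intro i
        cases i <;> simp [Instr.copies]
      · refine (distill_expected_le hsp hf hfF hlf hH Instr.fswaps ?_ T).trans hcost
        intro i
        cases i <;> simp [Instr.fswaps]
      · obtain ⟨a, b, hab, hb0, hbε, hout⟩ := distill_outputs hsp (ketbra_mul_self hψ)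
          (ketbra_mul_isotropic_zero hψ _) hf hfF hlf hH hε hzH
        refine ⟨_, hout, ?_⟩
        have hn0 : (2 ^ n - 1 : ℝ) ≠ 0 := by linarith
        rw [dataOp_isotropic]
        refine (traceDist_isotropic hE hψ (mul_nonneg hb0 ?_) ?_).trans (by linarith : 1 - a ≤ ε)
        · exact div_nonneg zero_le_one (by linarith)
        · rw [mul_left_comm, mul_one_div_cancel hn0, mul_one, hab]
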